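/- For $x,M\ge 0$ let $\Phi_{x,M}$ be the single-mode phase-insensitive Gaussian channel on $L^2(\mathbb R)$ that maps the first moments $\mathbf m$ to $\sqrt{x}\,\mathbf m$ and the covariance matrix $V$ (normalized to $I_2$ for the vacuum) to $xV+(2M+|1-x|)I_2$; equivalently, it maps a characteristic function $\chi(\xi)$ to $\chi(\sqrt{x}\,\xi)\,e^{-(2M+|1-x|)|\xi|^2/4}$. Let $\mathcal E_{\eta,N}=\Phi_{\eta,(1-\eta)N}$ ($\eta\in[0,1]$, $N\ge0$) be the thermal attenuator and $\mathcal A_{g,N}=\Phi_{g,(g-1)N}$ ($g\ge 1$, $N\ge 0$) the thermal amplifier. Put $$N^{(1)}_{\eta,N}(\eta')=N\,\tfrac{1-\eta}{\eta}\,\tfrac{\eta'}{1-\eta'},\qquad N^{(2)}_{\eta,N}(\eta')=(N+1)\,\tfrac{1-\eta}{1-\eta'}-1,$$ $$N^{(1)}_{g,N}(g')=N\,\tfrac{g-1}{g'-1},\qquad N^{(2)}_{g,N}(g')=(N+1)\,\tfrac{g-1}{g}\,\tfrac{g'}{g'-1}-1 .$$ Let $\mathcal K$ be the quantum capacity $Q$,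 the private capacity $P$, the two-way assisted quantum capacity $Q_2$ or the secret-key capacity $K$ (with values in $[0,\infty]$, without energy constraint). Then: (i) for $\eta\in(0,1]$ and $N\ge0$, the function $\eta'\mapsto\mathcal K(\mathcal E_{\eta',N'})$ with $N'=N^{(1)}_{\eta,N}(\eta')$ is non-decreasing on $0\le\eta'<1$; (ii) for $\eta\in[0,1]$ and $N\ge0$, the function $\eta'\mapsto\mathcal K(\mathcal E_{\eta',N'})$ with $N'=N^{(2)}_{\eta,N}(\eta')$ is non-increasing on the set of those $\eta'\in[0,1)$ for which $N^{(2)}_{\eta,N}(\eta')\ge0$; (iii) for $g\ge1$ and $N\ge0$, the function $g'\mapsto\mathcal K(\mathcal A_{g',N'})$ with $N'=N^{(1)}_{g,N}(g')$ is non-increasing on $g'>1$; (iv) for $g\ge1$ and $N\ge0$, the function $g'\mapsto\mathcal K(\mathcal A_{g',N'})$ with $N'=N^{(2)}_{g,N}(g')$ is non-decreasing on the set of those $g'>1$ for which $N^{(2)}_{g,N}(g')\ge0$. -/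

import Mathlib

open scoped TensorProduct ENNReal NNReal InnerProductSpace ComplexOrder
open MeasureTheory UniformSpace

noncomputable section

namespace BosonicGaussian

/-! ### Quantum systems and their Hilbert-space tensor products -/

/-- A quantum system: a complex Hilbert space. -/
structure QSystem where
  carrier : Type
  [normed : NormedAddCommGroup carrier]
  [hilbert : InnerProductSpace ℂ carrier]
  [complete : CompleteSpace carrier]

namespace QSystem

instance : CoeSort QSystem Type := ⟨QSystem.carrier⟩

attribute [instance] QSystem.normed QSystem.hilbert QSystem.complete

/-- The trivial system `ℂ`. -/
abbrev unit : QSystem := ⟨ℂ⟩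

/-- The `d`-level system `ℂ^d`. -/
abbrev qudit (d : ℕ) : QSystem := ⟨EuclideanSpace ℂ (Fin d)⟩

/-- The Hilbert space `L²(ℝ)` of one bosonic mode (one harmonic oscillator). -/
abbrev mode : QSystem := ⟨Lp ℂ 2 (volume : Measure ℝ)⟩

/-- The composite system: the Hilbert-space (completed) tensor product. -/
abbrev tensor (A B : QSystem) : QSystem := ⟨Completion (A ⊗[ℂ] B)⟩

/-- `n` copies of a system, `A ⊗ (A ⊗ (⋯ ⊗ ℂ))`. -/
def pow (A : QSystem) : ℕ → QSystem
  | 0 => unit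
  | n + 1 => tensor A (pow A n)

/-- The product vector `a ⊗ b`. -/
def tmul {A B : QSystem} (a : A) (b : B) : tensor A B := ((a ⊗ₜ[ℂ] b : A ⊗[ℂ] B) : Completion _)

/-- The tensor product `f ⊗ g` of two bounded operators. -/
def tmap {A A' B B' : QSystem} (f : A →L[ℂ] A') (g : B →L[ℂ] B') :
    tensor A B →L[ℂ] tensor A' B' :=
  ((Completion.toComplL : A' ⊗[ℂ] B' →L[ℂ] Completion (A' ⊗[ℂ] B')) ∘L
    TensorProduct.mapL f g).extend (Completion.toComplL : A ⊗[ℂ] B →L[ℂ] Completion (A ⊗[ℂ] B))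

theorem denseRange_toComplL (X : Type) [NormedAddCommGroup X] [NormedSpace ℂ X] :
    DenseRange (Completion.toComplL : X →L[ℂ] Completion X) := by
  rw [Completion.coe_toComplL]; exact Completion.denseRange_coe

theorem tmap_tmul {A A' B B' : QSystem} (f : A →L[ℂ] A') (g : B →L[ℂ] B') (a : A) (b : B) :
    tmap f g (tmul a b) = tmul (f a) (g b) := by
  have h := ContinuousLinearMap.extend_eq
    ((Completion.toComplL : A' ⊗[ℂ] B' →L[ℂ] Completion (A' ⊗[ℂ] B')) ∘L
      TensorProduct.mapL f g) (denseRange_toComplL (A ⊗[ℂ] B))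
    (by rw [Completion.coe_toComplL]; exact Completion.isUniformInducing_coe _) (a ⊗ₜ[ℂ] b)
  simpa [tmap, tmul] using! h

theorem denseRange_mapL {X X' Y Y' : Type}
    [NormedAddCommGroup X] [InnerProductSpace ℂ X] [NormedAddCommGroup X'] [InnerProductSpace ℂ X']
    [NormedAddCommGroup Y] [InnerProductSpace ℂ Y] [NormedAddCommGroup Y'] [InnerProductSpace ℂ Y']
    (f : X →L[ℂ] X') (g : Y →L[ℂ] Y') (hf : DenseRange f) (hg : DenseRange g) :
    DenseRange (TensorProduct.mapL f g) := by
  have key : ∀ z : X' ⊗[ℂ] Y',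
      z ∈ (LinearMap.range (TensorProduct.mapL f g).toLinearMap).topologicalClosure := by
    intro z
    induction z using TensorProduct.induction_on with
    | zero => exact Submodule.zero_mem _
    | add x y hx hy => exact Submodule.add_mem _ hx hy
    | tmul x y =>
      have hd : DenseRange (Prod.map f g) := hf.prodMap hg
      have hmem : (x, y) ∈ closure (Set.range (Prod.map f g)) := hd (x, y)
      have hc : Continuous fun p : X' × Y' => p.1 ⊗ₜ[ℂ] p.2 := TensorProduct.continuous_tmul
      refine map_mem_closure (f := fun p : X' × Y' => p.1 ⊗ₜ[ℂ] p.2) hc hmem ?_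
      rintro _ ⟨⟨a, b⟩, rfl⟩
      exact ⟨a ⊗ₜ b, by simp⟩
  exact fun z => key z

/-- The canonical dense isometric embedding of an algebraic tensor product of two spaces that are
densely and isometrically embedded in systems. -/
def embed {X Y : Type} [NormedAddCommGroup X] [InnerProductSpace ℂ X]
    [NormedAddCommGroup Y] [InnerProductSpace ℂ Y] {A B : QSystem}
    (f : X →ₗᵢ[ℂ] A) (g : Y →ₗᵢ[ℂ] B) : X ⊗[ℂ] Y →ₗᵢ[ℂ] tensor A B :=
  (Completion.toComplₗᵢ : A ⊗[ℂ] B →ₗᵢ[ℂ] Completion (A ⊗[ℂ] B)).comp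
    (TensorProduct.mapIsometry f g)

theorem denseRange_embed {X Y : Type} [NormedAddCommGroup X] [InnerProductSpace ℂ X]
    [NormedAddCommGroup Y] [InnerProductSpace ℂ Y] {A B : QSystem}
    (f : X →ₗᵢ[ℂ] A) (g : Y →ₗᵢ[ℂ] B) (hf : DenseRange f) (hg : DenseRange g) :
    DenseRange (embed f g) := by
  have h1 := denseRange_mapL f.toContinuousLinearMap g.toContinuousLinearMap hf hg
  have h2 : DenseRange (Completion.toComplₗᵢ : A ⊗[ℂ] B →ₗᵢ[ℂ] Completion (A ⊗[ℂ] B)) :=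
    Completion.denseRange_coe
  have h0 : ⇑(TensorProduct.mapL f.toContinuousLinearMap g.toContinuousLinearMap) =
      TensorProduct.mapIsometry f g := by
    ext x
    simp
  have h3 : DenseRange (TensorProduct.mapIsometry f g) := h0 ▸ h1
  exact h2.comp h3 (Completion.toComplₗᵢ : A ⊗[ℂ] B →ₗᵢ[ℂ] Completion (A ⊗[ℂ] B)).continuous

/-- The embedding of the algebraic tensor product in the completed one. -/
def incl (A B : QSystem) : A ⊗[ℂ] B →ₗᵢ[ℂ] tensor A B := Completion.toComplₗᵢ

theorem denseRange_incl (A B : QSystem) : DenseRange (incl A B) := Completion.denseRange_coe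

theorem denseRange_id (A : QSystem) : DenseRange (LinearIsometry.id : A →ₗᵢ[ℂ] A) :=
  Function.surjective_id.denseRange

theorem norm_tensorTensorTensorComm {A B C D : Type}
    [NormedAddCommGroup A] [InnerProductSpace ℂ A] [NormedAddCommGroup B] [InnerProductSpace ℂ B]
    [NormedAddCommGroup C] [InnerProductSpace ℂ C] [NormedAddCommGroup D] [InnerProductSpace ℂ D]
    (x : (A ⊗[ℂ] B) ⊗[ℂ] (C ⊗[ℂ] D)) :
    ‖TensorProduct.tensorTensorTensorComm ℂ A B C D x‖ = ‖x‖ := by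
  let T : (A ⊗[ℂ] B) ⊗[ℂ] (C ⊗[ℂ] D) ≃ₗᵢ[ℂ] (A ⊗[ℂ] C) ⊗[ℂ] (B ⊗[ℂ] D) :=
    (TensorProduct.assocIsometry ℂ A B (C ⊗[ℂ] D)).trans
      ((TensorProduct.congrIsometry (LinearIsometryEquiv.refl ℂ A)
        ((TensorProduct.assocIsometry ℂ B C D).symm.trans
          ((TensorProduct.congrIsometry (TensorProduct.commIsometry ℂ B C)
            (LinearIsometryEquiv.refl ℂ D)).trans (TensorProduct.assocIsometry ℂ C B D)))).trans
      (TensorProduct.assocIsometry ℂ A C (B ⊗[ℂ] D)).symm)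
  have h : (TensorProduct.tensorTensorTensorComm ℂ A B C D).toLinearMap =
      T.toLinearEquiv.toLinearMap := by
    ext a b c d
    rfl
  have h2 : TensorProduct.tensorTensorTensorComm ℂ A B C D x = T x :=
    LinearMap.congr_fun h x
  rw [h2, T.norm_map]

/-- The canonical unitary `(A ⊗ B) ⊗ C ≃ A ⊗ (B ⊗ C)`. -/
def assoc (A B C : QSystem) : tensor (tensor A B) C ≃ₗᵢ[ℂ] tensor A (tensor B C) :=
  (TensorProduct.assoc ℂ A B C).extendOfIsometry
    (embed (incl A B) (LinearIsometry.id : C →ₗᵢ[ℂ] C)).toLinearMap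
    (embed (LinearIsometry.id : A →ₗᵢ[ℂ] A) (incl B C)).toLinearMap
    (denseRange_embed _ _ (denseRange_incl A B) (denseRange_id C))
    (denseRange_embed _ _ (denseRange_id A) (denseRange_incl B C))
    (fun x => by
      simp only [LinearIsometry.coe_toLinearMap, LinearIsometry.norm_map]
      exact TensorProduct.norm_assoc x)

/-- The canonical unitary `(A ⊗ B) ⊗ (C ⊗ D) ≃ (A ⊗ C) ⊗ (B ⊗ D)`. -/
def interchange (A B C D : QSystem) :
    tensor (tensor A B) (tensor C D) ≃ₗᵢ[ℂ] tensor (tensor A C) (tensor B D) :=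
  (TensorProduct.tensorTensorTensorComm ℂ A B C D).extendOfIsometry
    (embed (incl A B) (incl C D)).toLinearMap
    (embed (incl A C) (incl B D)).toLinearMap
    (denseRange_embed _ _ (denseRange_incl A B) (denseRange_incl C D))
    (denseRange_embed _ _ (denseRange_incl A C) (denseRange_incl B D))
    (fun x => by
      simp only [LinearIsometry.coe_toLinearMap, LinearIsometry.norm_map]
      exact norm_tensorTensorTensorComm x)

end QSystem

open QSystem

/-! ### Trace-class operators -/

/-- Trace-class (nuclear) operators: `T = ∑ᵢ |uᵢ⟩⟨vᵢ|` with `∑ᵢ ‖uᵢ‖ ‖vᵢ‖ < ∞`. -/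
def IsTraceClass {H : QSystem} (T : H →L[ℂ] H) : Prop :=
  ∃ (ι : Type) (u v : ι → H), (Summable fun i => ‖u i‖ * ‖v i‖) ∧
    ∀ x, HasSum (fun i => inner ℂ (v i) x • u i) (T x)

/-- The space of trace-class operators of a system. -/
def TraceClass (H : QSystem) : Submodule ℂ (H →L[ℂ] H) where
  carrier := {T | IsTraceClass T}
  zero_mem' := ⟨Empty, fun _ => 0, fun _ => 0, summable_empty, fun x => by
    simp only [inner_zero_left, smul_zero, zero_apply]
    exact hasSum_zero⟩
  add_mem' := by
    rintro S T ⟨ι, u, v, hs, h⟩ ⟨κ, u', v', hs', h'⟩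
    refine ⟨ι ⊕ κ, Sum.elim u u', Sum.elim v v', Summable.sum _ hs hs', fun x => ?_⟩
    exact HasSum.sum (h x) (h' x)
  smul_mem' := by
    rintro c T ⟨ι, u, v, hs, h⟩
    refine ⟨ι, fun i => c • u i, v, ?_, fun x => ?_⟩
    · simpa [norm_smul, mul_assoc] using hs.mul_left ‖c‖
    · simpa [smul_comm c] using (h x).const_smul c

/-- A trace-class operator as a bounded operator. -/
abbrev op {H : QSystem} (T : TraceClass H) : H →L[ℂ] H := T

/-- The trace of an operator, in a Hilbert basis. -/
def trace {H : QSystem} (T : H →L[ℂ] H) : ℂ :=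
  ∑' i, inner ℂ ((exists_hilbertBasis ℂ H).choose_spec.choose i)
    (T ((exists_hilbertBasis ℂ H).choose_spec.choose i))

/-- Density operators: positive trace-class operators of trace one. -/
def IsState {H : QSystem} (ρ : TraceClass H) : Prop :=
  (op ρ).IsPositive ∧ trace (op ρ) = 1

/-- The rank-one operator `|ψ⟩⟨ψ|`. -/
def ketbra {H : QSystem} (ψ : H) : TraceClass H :=
  ⟨InnerProductSpace.rankOne ℂ ψ ψ, Unit, fun _ => ψ, fun _ => ψ, .of_finite, fun x => by
    simp⟩

/-! ### Quantum channels -/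

/-- A quantum channel: a linear, completely positive, trace-preserving map between spaces of
trace-class operators. Complete positivity says that every `k × k` block operator `(Tᵢⱼ)` which is
positive on `H ⊗ ℂ^k` is mapped to a positive block operator on `K ⊗ ℂ^k`. -/
structure QChannel (H K : QSystem) where
  toLin : TraceClass H →ₗ[ℂ] TraceClass K
  completelyPositive : ∀ (k : ℕ) (T : Fin k → Fin k → TraceClass H),
    (∀ x : Fin k → H, 0 ≤ ∑ i, ∑ j, inner ℂ (x i) (op (T i j) (x j))) →
    ∀ y : Fin k → K, 0 ≤ ∑ i, ∑ j, inner ℂ (y i) (op (toLin (T i j)) (y j))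
  tracePreserving : ∀ T : TraceClass H, trace (op (toLin T)) = trace (op T)

instance {H : QSystem} : Inhabited (QChannel H H) :=
  ⟨⟨LinearMap.id, fun _ _ h => h, fun _ => rfl⟩⟩

/-- `Λₙ` is the `n`-fold tensor power `Λ^{⊗n}`: the channel with
`Λₙ (T₁ ⊗ ⋯ ⊗ Tₙ) = Λ T₁ ⊗ ⋯ ⊗ Λ Tₙ`. -/
def IsTensorPower {H K : QSystem} (Λ : QChannel H K) :
    (n : ℕ) → QChannel (H.pow n) (K.pow n) → Prop
  | 0, Λ₀ => ∀ T : TraceClass unit, (Λ₀.toLin T : TraceClass unit) = T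
  | n + 1, Λ' => ∃ Λₙ : QChannel (H.pow n) (K.pow n), IsTensorPower Λ n Λₙ ∧
      ∀ (T : TraceClass H) (S : TraceClass (H.pow n)) (R : TraceClass (H.pow (n + 1))),
        op R = tmap (op T) (op S) → op (Λ'.toLin R) = tmap (op (Λ.toLin T)) (op (Λₙ.toLin S))

/-- The operator `V T V†`. -/
def conj {H L : QSystem} (V : H →L[ℂ] L) (T : TraceClass H) : L →L[ℂ] L :=
  V ∘L op T ∘L ContinuousLinearMap.adjoint V

/-- The isometry `V : H → K ⊗ E` is a Stinespring dilation of the channel `Λ` with environment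
`E`: `Λ T = Tr_E (V T V†)`. The partial trace is expressed through the identity
`Tr (X Tr_E Ω) = Tr ((X ⊗ 1) Ω)` for all bounded `X`, which determines it. -/
def IsStinespring {H K : QSystem} (Λ : QChannel H K) (E : QSystem) (V : H →ₗᵢ[ℂ] tensor K E) :
    Prop :=
  ∀ (T : TraceClass H) (X : K →L[ℂ] K),
    trace (X ∘L op (Λ.toLin T)) =
      trace (tmap X (ContinuousLinearMap.id ℂ E) ∘L conj V.toContinuousLinearMap T)

/-- `n` uses of a dilation: the isometry `V^{⊗n} : H^{⊗n} → K^{⊗n} ⊗ E^{⊗n}` (with the output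
factors reordered). -/
def dilationPow {H K E : QSystem} (V : H →ₗᵢ[ℂ] tensor K E) :
    (n : ℕ) → H.pow n →L[ℂ] tensor (K.pow n) (E.pow n)
  | 0 => (Completion.toComplL : ℂ ⊗[ℂ] ℂ →L[ℂ] Completion (ℂ ⊗[ℂ] ℂ)) ∘L
      (TensorProduct.mkL ℂ ℂ ℂ).flip 1
  | n + 1 => (interchange K E (K.pow n) (E.pow n)).toLinearIsometry.toContinuousLinearMap ∘L
      tmap V.toContinuousLinearMap (dilationPow V n)

/-! ### Capacities -/

/-- The capacity associated with a notion of code, where `Code n d ε` says that `n` uses of the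
channel can handle a message space of size (dimension) `d` with error at most `ε`: the supremum of
the rates `R` such that, for every `ε > 0` and every large enough `n`, there is a code with
`d ≥ 2 ^ (n R)` and error at most `ε`. It may be infinite. -/
def capacity (Code : ℕ → ℕ → ℝ → Prop) : ℝ≥0∞ :=
  ⨆ (R : ℝ≥0) (_ : ∀ ε : ℝ, 0 < ε → ∃ n₀ : ℕ, ∀ n ≥ n₀, ∃ d : ℕ,
    (2 : ℝ) ^ ((n : ℝ) * (R : ℝ)) ≤ d ∧ Code n d ε), (R : ℝ≥0∞)

/-- Quantum codes: an encoding channel and a decoding channel such that every pure state of `ℂ^d`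
is transmitted through `Λ^{⊗n}` with fidelity at least `1 - ε`. -/
def QuantumCode {H K : QSystem} (Λ : QChannel H K) (n d : ℕ) (ε : ℝ) : Prop :=
  ∃ (enc : QChannel (qudit d) (H.pow n)) (dec : QChannel (K.pow n) (qudit d)),
    ∀ Λₙ : QChannel (H.pow n) (K.pow n), IsTensorPower Λ n Λₙ →
      ∀ ψ : qudit d, ‖ψ‖ = 1 →
        1 - ε ≤ (inner ℂ ψ
          (op (dec.toLin (Λₙ.toLin (enc.toLin (ketbra ψ)))) ψ)).re

/-- Private codes: `d` classical messages `m` are encoded in states `ρ m` of `H^{⊗n}` and decoded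
by a measurement `D` on `K^{⊗n}`. Every message is received correctly with probability at least
`1 - ε`, and the states that two messages induce on the environment of the `n` uses of the
channel are at trace-norm distance at most `ε`
(`‖σ‖₁` is the supremum of `|Tr (X σ)|` over the contractions `X`). Dilations of a channel are
unique up to a partial isometry of the environment, so that it does not matter which one is
used. -/
def PrivateCode {H K : QSystem} (Λ : QChannel H K) (n d : ℕ) (ε : ℝ) : Prop :=
  ∃ (ρ : Fin d → TraceClass (H.pow n)) (D : Fin d → (K.pow n →L[ℂ] K.pow n)),
    (∀ m, IsState (ρ m)) ∧ (∀ m, (D m).IsPositive) ∧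
    ∑ m, D m = ContinuousLinearMap.id ℂ (K.pow n) ∧
    ∀ (E : QSystem) (V : H →ₗᵢ[ℂ] tensor K E), IsStinespring Λ E V →
      (∀ m, 1 - ε ≤ (trace (tmap (D m) (ContinuousLinearMap.id ℂ (E.pow n)) ∘L
        conj (dilationPow V n) (ρ m))).re) ∧
      ∀ (m m' : Fin d) (X : E.pow n →L[ℂ] E.pow n), ‖X‖ ≤ 1 →
        ‖trace (tmap (ContinuousLinearMap.id ℂ (K.pow n)) X ∘L
            conj (dilationPow V n) (ρ m)) -
          trace (tmap (ContinuousLinearMap.id ℂ (K.pow n)) X ∘L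
            conj (dilationPow V n) (ρ m'))‖ ≤ ε

/-- Adaptive protocols by which Alice and Bob, holding systems `A` and `B`, use a channel from `H`
to `K` exactly `n` more times, assisted by local operations and two-way classical communication.

* `alice`, `bob`: a local measurement with Kraus operators `M k`, whose outcome `k` is announced
  publicly; the rest of the protocol may depend on `k`. With a single outcome this is a local
  isometry, so that local ancillas, and by discarding at the end every local channel, are included.
* `use`: Alice splits off a system `H` of her laboratory, and sends it through the channel; Bob
  adds the output `K` to his laboratory.
* `finish`: each party splits off a `d`-level register. An isometry `A → ℂ^d ⊗ A'` is given by its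
  components `U i : A → A'`. The remaining systems `A'`, `B'` are discarded. -/
inductive Protocol (H K : QSystem) (d : ℕ) : ℕ → QSystem → QSystem → Type 1
  | finish {A B : QSystem} (A' B' : QSystem) (U : Fin d → A →L[ℂ] A') (W : Fin d → B →L[ℂ] B')
      (hU : ∀ x, ∑ i, ‖U i x‖ ^ 2 = ‖x‖ ^ 2) (hW : ∀ x, ∑ i, ‖W i x‖ ^ 2 = ‖x‖ ^ 2) :
      Protocol H K d 0 A B
  | alice {n : ℕ} {A B : QSystem} (ι : Type) (A' : ι → QSystem) (M : ∀ k, A →L[ℂ] A' k)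
      (hM : ∀ x, HasSum (fun k => ‖M k x‖ ^ 2) (‖x‖ ^ 2))
      (next : ∀ k, Protocol H K d n (A' k) B) : Protocol H K d n A B
  | bob {n : ℕ} {A B : QSystem} (ι : Type) (B' : ι → QSystem) (M : ∀ k, B →L[ℂ] B' k)
      (hM : ∀ x, HasSum (fun k => ‖M k x‖ ^ 2) (‖x‖ ^ 2))
      (next : ∀ k, Protocol H K d n A (B' k)) : Protocol H K d n A B
  | use {n : ℕ} {A B : QSystem} (A' : QSystem) (U : A →ₗᵢ[ℂ] tensor A' H)
      (next : Protocol H K d n A' (tensor K B)) : Protocol H K d (n + 1) A B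

/-- One use of the channel inside a protocol, on the joint vector of Alice, Bob and the
environment `E` of the previous uses; `F` is the environment of this use. -/
def useVector {H K F A A' B E : QSystem} (V : H →ₗᵢ[ℂ] tensor K F) (U : A →ₗᵢ[ℂ] tensor A' H)
    (ψ : tensor A (tensor B E)) : tensor A' (tensor (tensor K B) (tensor F E)) :=
  tmap (ContinuousLinearMap.id ℂ A')
      (interchange K F B E).toLinearIsometry.toContinuousLinearMap
    (QSystem.assoc A' (tensor K F) (tensor B E)
      (tmap (tmap (ContinuousLinearMap.id ℂ A') V.toContinuousLinearMap ∘L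
        U.toContinuousLinearMap) (ContinuousLinearMap.id ℂ (tensor B E)) ψ))

/-- The fidelity of the final state of the two registers with the maximally entangled state
`d^{-1/2} ∑ᵢ |i⟩|i⟩`, when the protocol is run with the dilation `V` of the channel from the
(unnormalized) joint vector `ψ` of Alice, Bob and the environment. -/
def Protocol.fidelity {H K F : QSystem} {d : ℕ} (V : H →ₗᵢ[ℂ] tensor K F) :
    {n : ℕ} → {A B : QSystem} → Protocol H K d n A B →
      (E : QSystem) → tensor A (tensor B E) → ℝ≥0∞
  | _, _, _, .finish _ _ U W _ _, E, ψ =>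
      ENNReal.ofReal
        (‖∑ i, tmap (U i) (tmap (W i) (ContinuousLinearMap.id ℂ E)) ψ‖ ^ 2 / d)
  | _, _, B, .alice _ _ M _ next, E, ψ =>
      ∑' k, (next k).fidelity V E
        (tmap (M k) (ContinuousLinearMap.id ℂ (tensor B E)) ψ)
  | _, A, _, .bob _ _ M _ next, E, ψ =>
      ∑' k, (next k).fidelity V E
        (tmap (ContinuousLinearMap.id ℂ A)
          (tmap (M k) (ContinuousLinearMap.id ℂ E)) ψ)
  | _, _, _, .use _ U next, E, ψ => next.fidelity V (tensor F E) (useVector V U ψ)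

/-- The distance from an ideal key. Alice and Bob measure their registers in the computational
basis, obtaining keys `i` and `j`, and the eavesdropper holds the environment of all uses of the
channel and the transcript of the public communication. The value is the trace-norm distance
`‖ρ - ω ⊗ σ‖₁` of the joint state `ρ` of the two keys and the eavesdropper from the product of
the uniformly distributed perfectly correlated pair of keys `ω` and the reduced state `σ` of
the eavesdropper. -/
def Protocol.keyError {H K F : QSystem} {d : ℕ} (V : H →ₗᵢ[ℂ] tensor K F) :
    {n : ℕ} → {A B : QSystem} → Protocol H K d n A B →
      (E : QSystem) → tensor A (tensor B E) → ℝ≥0∞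
  | _, A, B, .finish A' B' U W _ _, E, ψ =>
      ∑ i, ∑ j, ⨆ (X : E →L[ℂ] E) (_ : ‖X‖ ≤ 1), ENNReal.ofReal
        ‖inner ℂ (tmap (U i) (tmap (W j) (ContinuousLinearMap.id ℂ E)) ψ)
            (tmap (ContinuousLinearMap.id ℂ A')
              (tmap (ContinuousLinearMap.id ℂ B') X)
              (tmap (U i) (tmap (W j) (ContinuousLinearMap.id ℂ E)) ψ)) -
          if i = j then inner ℂ ψ (tmap (ContinuousLinearMap.id ℂ A)
              (tmap (ContinuousLinearMap.id ℂ B) X) ψ) / (d : ℂ)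
          else 0‖
  | _, _, B, .alice _ _ M _ next, E, ψ =>
      ∑' k, (next k).keyError V E
        (tmap (M k) (ContinuousLinearMap.id ℂ (tensor B E)) ψ)
  | _, A, _, .bob _ _ M _ next, E, ψ =>
      ∑' k, (next k).keyError V E
        (tmap (ContinuousLinearMap.id ℂ A)
          (tmap (M k) (ContinuousLinearMap.id ℂ E)) ψ)
  | _, _, _, .use _ U next, E, ψ => next.keyError V (tensor F E) (useVector V U ψ)

/-- The initial joint vector: no party holds anything. -/
def initialVector : tensor unit (tensor unit unit) := tmul (1 : ℂ) (tmul (1 : ℂ) (1 : ℂ))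

/-- Two-way assisted protocols which distil a `d`-dimensional maximally entangled state with
fidelity at least `1 - ε` from `n` uses of the channel. -/
def TwoWayCode {H K : QSystem} (Λ : QChannel H K) (n d : ℕ) (ε : ℝ) : Prop :=
  ∃ P : Protocol H K d n unit unit,
    ∀ (E : QSystem) (V : H →ₗᵢ[ℂ] tensor K E), IsStinespring Λ E V →
      ENNReal.ofReal (1 - ε) ≤ P.fidelity V unit initialVector

/-- Two-way assisted protocols which distil a secret key with `d` values, up to an error `ε`, from
`n` uses of the channel. -/
def KeyCode {H K : QSystem} (Λ : QChannel H K) (n d : ℕ) (ε : ℝ) : Prop :=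
  ∃ P : Protocol H K d n unit unit,
    ∀ (E : QSystem) (V : H →ₗᵢ[ℂ] tensor K E), IsStinespring Λ E V →
      P.keyError V unit initialVector ≤ ENNReal.ofReal ε

/-- The quantum capacity `Q`. -/
def quantumCapacity {H K : QSystem} (Λ : QChannel H K) : ℝ≥0∞ := capacity (QuantumCode Λ)

/-- The private capacity `P`. -/
def privateCapacity {H K : QSystem} (Λ : QChannel H K) : ℝ≥0∞ := capacity (PrivateCode Λ)

/-- The two-way quantum capacity `Q₂`. -/
def twoWayQuantumCapacity {H K : QSystem} (Λ : QChannel H K) : ℝ≥0∞ := capacity (TwoWayCode Λ)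

/-- The secret-key capacity `K`. -/
def secretKeyCapacity {H K : QSystem} (Λ : QChannel H K) : ℝ≥0∞ := capacity (KeyCode Λ)

/-! ### Single-mode phase-insensitive Gaussian channels -/

/-- The function `exp (i (a x + a b / 2)) φ (x + b)`. -/
def weylFun (a b : ℝ) (φ : ℝ → ℂ) (x : ℝ) : ℂ :=
  Complex.exp (Complex.I * ((a * x + a * b / 2 : ℝ) : ℂ)) * φ (x + b)

theorem norm_weylFun (a b : ℝ) (φ : ℝ → ℂ) (x : ℝ) : ‖weylFun a b φ x‖ = ‖φ (x + b)‖ := by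
  rw [weylFun, norm_mul, mul_comm Complex.I, Complex.norm_exp_ofReal_mul_I, one_mul]

theorem eLpNorm_weylFun (a b : ℝ) (φ : mode) :
    eLpNorm (weylFun a b φ) 2 volume = eLpNorm φ 2 volume := by
  rw [eLpNorm_congr_norm_ae (g := fun x => φ (x + b)) (.of_forall fun x => norm_weylFun a b φ x)]
  exact eLpNorm_comp_measurePreserving (Lp.aestronglyMeasurable φ)
    (measurePreserving_add_right volume b)

theorem memLp_weylFun (a b : ℝ) (φ : mode) : MemLp (weylFun a b φ) 2 volume := by
  refine ⟨?_, by rw [eLpNorm_weylFun]; exact Lp.eLpNorm_lt_top φ⟩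
  refine AEStronglyMeasurable.mul (Continuous.aestronglyMeasurable (by fun_prop)) ?_
  exact (Lp.aestronglyMeasurable φ).comp_measurePreserving (measurePreserving_add_right volume b)

/-- The Weyl operator `exp (i (a x̂ + b p̂))` on `L²(ℝ)`, where `x̂` is multiplication by the
coordinate and `p̂ = -i d/dx`. -/
def weyl (a b : ℝ) : mode →L[ℂ] mode :=
  LinearMap.mkContinuous
    { toFun := fun φ => (memLp_weylFun a b φ).toLp
      map_add' := fun φ χ => by
        rw [← MemLp.toLp_add]
        refine MemLp.toLp_congr _ _ ?_
        filter_upwards [(measurePreserving_add_right volume b).quasiMeasurePreserving.ae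
          (Lp.coeFn_add φ χ)] with x hx
        simp only [weylFun, Pi.add_apply, hx, mul_add]
      map_smul' := fun c φ => by
        simp only [RingHom.id_apply]
        rw [← MemLp.toLp_const_smul]
        refine MemLp.toLp_congr _ _ ?_
        filter_upwards [(measurePreserving_add_right volume b).quasiMeasurePreserving.ae
          (Lp.coeFn_smul c φ)] with x hx
        simp only [weylFun, Pi.smul_apply, hx, smul_eq_mul]
        ring }
    1 (fun φ => by
      rw [one_mul]
      change ‖(memLp_weylFun a b φ).toLp‖ ≤ ‖φ‖
      rw [Lp.norm_toLp, eLpNorm_weylFun, Lp.norm_def])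

/-- `Λ` is the phase-insensitive Gaussian channel with parameters `x, M ≥ 0`, i.e. the Gaussian
channel which maps the first moments `m` to `√x m` and the covariance matrix `V` (with the
convention that it is the identity for the vacuum) to `x V + (2 M + |1 - x|) 1`: on characteristic
functions it acts by
`χ (ξ) ↦ χ (√x ξ) exp (- (2 M + |1 - x|) |ξ|² / 4)`. -/
def IsPhaseInsensitive (x M : ℝ) (Λ : QChannel mode mode) : Prop :=
  ∀ (T : TraceClass mode) (a b : ℝ),
    trace (weyl a b ∘L op (Λ.toLin T)) =
      (Real.exp (-(2 * M + |1 - x|) * (a ^ 2 + b ^ 2) / 4) : ℂ) *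
        trace (weyl (√x * a) (√x * b) ∘L op T)

/-- The phase-insensitive Gaussian channel `Φ_{x,M}`, for `x, M ≥ 0`: the unique channel with
the prescribed action on characteristic functions. -/
def phaseInsensitive (x M : ℝ) : QChannel mode mode := Classical.epsilon (IsPhaseInsensitive x M)

/-- The thermal attenuator `ℰ_{η,N}`, for `η ∈ [0, 1]` and `N ≥ 0`. -/
def attenuator (η N : ℝ) : QChannel mode mode := phaseInsensitive η ((1 - η) * N)

/-- The thermal amplifier `𝒜_{g,N}`, for `g ≥ 1` and `N ≥ 0`. -/
def amplifier (g N : ℝ) : QChannel mode mode := phaseInsensitive g ((g - 1) * N)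

/-- The curve `N^{(1)}_{η,N}`, defined for `η > 0` and `η' < 1`. -/
def attCurve₁ (η N η' : ℝ) : ℝ := N * ((1 - η) / η) * (η' / (1 - η'))

/-- The curve `N^{(2)}_{η,N}`, defined for `η' < 1`. -/
def attCurve₂ (η N η' : ℝ) : ℝ := (N + 1) * ((1 - η) / (1 - η')) - 1

/-- The curve `N^{(1)}_{g,N}`, defined for `g' > 1`. -/
def ampCurve₁ (g N g' : ℝ) : ℝ := N * ((g - 1) / (g' - 1))

/-- The curve `N^{(2)}_{g,N}`, defined for `g' > 1`. -/
def ampCurve₂ (g N g' : ℝ) : ℝ := (N + 1) * ((g - 1) / g) * (g' / (g' - 1)) - 1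

end BosonicGaussian

end

noncomputable section

namespace BosonicGaussian

open QSystem ContinuousLinearMap

/-! ### Calculus of completed tensor products -/

section Tensor

variable {A A' A'' B B' B'' C D X Y : QSystem}

/-! Write a phase-insensitive channel as a pair `(x, y)`: it sends `χ(ξ)` to `χ(√x ξ) exp(-y|ξ|²/4)`
(`IsPI x y`). Composition acts on pairs by `(x', y') ∘ (x, y) = (x'x, x'y + y')`. Attenuating the
output by `λ ≤ 1`, which is the pair `(λ, 1 - λ)`, sends `(x, y)` to `(λx, λ(y - 1) + 1)`, so it
moves points along the lines through `(0, 1)`. Amplifying the input by `x'/x ≥ 1` sends `(x, y)` to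
`(x', y + x' - x)`, so it moves points along the lines on which `y - x` is constant. The curves
`attCurve₁` and `ampCurve₂` are lines of the first kind, `attCurve₂` and `ampCurve₁` lines of the
second kind. Hence two channels on one curve differ by a quantum-limited attenuator after the
channel or a quantum-limited amplifier before it, and all four statements follow from data
processing (`IsCapacity.le_of_loss`, `IsCapacity.le_of_amp`). The exception is transmissivity `0` on
the second attenuator curve, where no amplifier leads away from `x = 0`. If that point is
admissible, every other point of the curve satisfies `y ≥ 1 + x`, and there all capacities vanish
(`IsCapacity.eq_zero_of_le`).

Data processing uses a dilation `W` of the auxiliary channel. A dilation `V` of `Λ` gives the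
dilation `compDil W V` of the composite, so what a code guarantees for the composite can be read off
for every dilation of `Λ`. For `Q` and `P` the tensor power of `W` is absorbed into the encoder or
the decoder. For `Q₂` and `K` the party that applies `W` measures its environment in a basis and
announces the outcome, so the protocol is simulated with local Kraus measurements. The fidelity is
unchanged, and the key error does not grow, because the eavesdropper now holds a pinched version of
what was held before (`Simulates.fidelity_eq`, `Simulates.keyError_le`).

Vanishing above the threshold: a channel with `y ≥ 1 + x` is an attenuator followed by heterodyne
detection and preparation of coherent states (`exists_isPI_eb`). The outputs of the dilation of the
second step are limits of sums `∑ aᵢ ⊗ bᵢ ⊗ eᵢ` with orthogonal `eᵢ` (`IsEB`). Protocols preserve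
this form, which bounds the fidelity by `1/d` and the key error below by `1/4`. For private codes
the environment can distinguish two messages as well as the receiver can, and for quantum codes
positivity after partial transposition rules out coherent transmission.

Finally, `phaseInsensitive` is chosen by `Classical.epsilon`, so existence and uniqueness are both
needed: existence by composing a quantum-limited attenuator with an amplifier (`exists_isPI`),
uniqueness because a trace-class operator is determined by its characteristic function
(`eq_of_trace_weyl`). -/

@[simp] theorem inner_tmul (a a' : A) (b b' : B) :
    inner ℂ (tmul a b) (tmul a' b') = inner ℂ a a' * inner ℂ b b' := by
  simp [tmul]

@[simp] theorem norm_tmul (a : A) (b : B) : ‖tmul a b‖ = ‖a‖ * ‖b‖ := by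
  simp [tmul]

/-- The map `b ↦ a ⊗ b`. -/
def tmulLeft (B : QSystem) (a : A) : B →L[ℂ] tensor A B :=
  (Completion.toComplL : A ⊗[ℂ] B →L[ℂ] Completion (A ⊗[ℂ] B)) ∘L TensorProduct.mkL ℂ A B a

/-- The map `a ↦ a ⊗ b`. -/
def tmulRight (A : QSystem) (b : B) : A →L[ℂ] tensor A B :=
  (Completion.toComplL : A ⊗[ℂ] B →L[ℂ] Completion (A ⊗[ℂ] B)) ∘L
    (TensorProduct.mkL ℂ A B).flip b

@[simp] theorem tmulLeft_apply (a : A) (b : B) : tmulLeft B a b = tmul a b := rfl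

@[simp] theorem tmulRight_apply (a : A) (b : B) : tmulRight A b a = tmul a b := rfl

theorem tmul_add_right (a : A) (b b' : B) : tmul a (b + b') = tmul a b + tmul a b' :=
  map_add (tmulLeft B a) b b'

theorem tmul_smul_left (c : ℂ) (a : A) (b : B) : tmul (c • a) b = c • tmul a b :=
  map_smul (tmulRight A b) c a

theorem tmul_smul_right (c : ℂ) (a : A) (b : B) : tmul a (c • b) = c • tmul a b :=
  map_smul (tmulLeft B a) c b

theorem tmul_sum_left {ι : Type*} (s : Finset ι) (a : ι → A) (b : B) :
    tmul (∑ i ∈ s, a i) b = ∑ i ∈ s, tmul (a i) b :=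
  map_sum (tmulRight A b) a s

theorem tmul_sum_right {ι : Type*} (s : Finset ι) (a : A) (b : ι → B) :
    tmul a (∑ i ∈ s, b i) = ∑ i ∈ s, tmul a (b i) :=
  map_sum (tmulLeft B a) b s

@[simp] theorem tmul_zero_left (b : B) : tmul (0 : A) b = 0 := map_zero (tmulRight A b)

@[simp] theorem tmul_zero_right (a : A) : tmul a (0 : B) = 0 := map_zero (tmulLeft B a)

/-- Sums of product vectors are dense in the completion. Closure under scalars need not be assumed,
since a scalar is absorbed into one factor of a product vector. -/
theorem tensor_induction {p : tensor A B → Prop} (hc : IsClosed {z | p z})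
    (hadd : ∀ z w, p z → p w → p (z + w)) (hmul : ∀ a b, p (tmul a b)) (z : tensor A B) : p z := by
  refine (denseRange_toComplL (A ⊗[ℂ] B)).induction_on z hc fun x => ?_
  induction x using TensorProduct.induction_on with
  | zero =>
    have h : p (tmul (0 : A) (0 : B)) := hmul 0 0
    rwa [show tmul (0 : A) (0 : B) = (Completion.toComplL : A ⊗[ℂ] B →L[ℂ] Completion (A ⊗[ℂ] B)) 0 by
      rw [map_zero]; exact map_zero (tmulLeft B (0 : A))] at h
  | tmul a b => exact hmul a b
  | add x y hx hy =>
    rw [map_add]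
    exact hadd _ _ hx hy

theorem clm_ext_tmul {Z : Type*} [NormedAddCommGroup Z] [NormedSpace ℂ Z]
    {f g : tensor A B →L[ℂ] Z} (h : ∀ a b, f (tmul a b) = g (tmul a b)) : f = g := by
  ext z
  refine tensor_induction (p := fun z => f z = g z) (isClosed_eq f.continuous g.continuous)
    (fun z w hz hw => by rw [map_add, map_add, hz, hw]) h z

theorem vec_ext_tmul {z z' : tensor A B}
    (h : ∀ a b, inner ℂ (tmul a b) z = inner ℂ (tmul a b) z') : z = z' := by
  refine ext_inner_left ℂ fun w => ?_
  refine tensor_induction (p := fun w => inner ℂ w z = inner ℂ w z')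
    (isClosed_eq (by fun_prop) (by fun_prop)) (fun z w hz hw => ?_) h w
  rw [inner_add_left, inner_add_left, hz, hw]

attribute [simp] tmap_tmul

@[simp] theorem tmap_id : tmap (.id ℂ A) (.id ℂ B) = .id ℂ (tensor A B) :=
  clm_ext_tmul fun a b => by simp -proj

theorem tmap_comp (f : A →L[ℂ] A') (f' : A' →L[ℂ] A'') (g : B →L[ℂ] B') (g' : B' →L[ℂ] B'') :
    tmap f' g' ∘L tmap f g = tmap (f' ∘L f) (g' ∘L g) :=
  clm_ext_tmul fun a b => by simp -proj

theorem tmap_tmap (f : A →L[ℂ] A') (f' : A' →L[ℂ] A'') (g : B →L[ℂ] B') (g' : B' →L[ℂ] B'')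
    (z : tensor A B) : tmap f' g' (tmap f g z) = tmap (f' ∘L f) (g' ∘L g) z :=
  congrArg (fun F => F z) (tmap_comp f f' g g')

theorem tmap_add_right (f : A →L[ℂ] A') (g g' : B →L[ℂ] B') :
    tmap f (g + g') = tmap f g + tmap f g' :=
  clm_ext_tmul fun a b => by simp -proj [tmul_add_right]

theorem tmap_smul_right (c : ℂ) (f : A →L[ℂ] A') (g : B →L[ℂ] B') :
    tmap f (c • g) = c • tmap f g :=
  clm_ext_tmul fun a b => by simp -proj [tmul_smul_right]

theorem tmap_sum_left {ι : Type*} (s : Finset ι) (f : ι → A →L[ℂ] A') (g : B →L[ℂ] B') :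
    tmap (∑ i ∈ s, f i) g = ∑ i ∈ s, tmap (f i) g :=
  clm_ext_tmul fun a b => by simp -proj [tmul_sum_left, sum_apply]

@[simp] theorem tmap_zero_right (f : A →L[ℂ] A') : tmap f (0 : B →L[ℂ] B') = 0 :=
  clm_ext_tmul fun a b => by simp -proj

@[simp] theorem tmap_zero_left (g : B →L[ℂ] B') : tmap (0 : A →L[ℂ] A') g = 0 :=
  clm_ext_tmul fun a b => by simp -proj

theorem adjoint_tmap (f : A →L[ℂ] A') (g : B →L[ℂ] B') :
    adjoint (tmap f g) = tmap (adjoint f) (adjoint g) := by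
  refine clm_ext_tmul fun a b => vec_ext_tmul fun a' b' => ?_
  simp -proj [adjoint_inner_right]

theorem norm_tmap_le (f : A →L[ℂ] A') (g : B →L[ℂ] B') : ‖tmap f g‖ ≤ ‖f‖ * ‖g‖ := by
  have h : ∀ z, ‖tmap f g z‖ ≤ ‖f‖ * ‖g‖ * ‖z‖ := by
    intro z
    refine (denseRange_toComplL (A ⊗[ℂ] B)).induction_on z
      (isClosed_le (by fun_prop) (by fun_prop)) fun x => ?_
    have h1 : tmap f g ((Completion.toComplL : A ⊗[ℂ] B →L[ℂ] Completion (A ⊗[ℂ] B)) x) =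
        ((TensorProduct.mapL f g x : A' ⊗[ℂ] B') : Completion (A' ⊗[ℂ] B')) := by
      induction x using TensorProduct.induction_on with
      | zero =>
        simp only [map_zero, Completion.coe_zero]
      | tmul a b => exact tmap_tmul f g a b
      | add x y hx hy => simp -proj only [map_add, hx, hy, Completion.coe_add]
    rw [h1, Completion.norm_coe, Completion.coe_toComplL, Completion.norm_coe]
    exact (le_opNorm _ _).trans (by gcongr; exact TensorProduct.norm_mapL_le f g)
  exact opNorm_le_bound _ (by positivity) h

/-! ### Contracting one tensor factor with a vector -/

/-- The map `⟨a| ⊗ 1`. -/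
def sliceL (B : QSystem) (a : A) : tensor A B →L[ℂ] B := adjoint (tmulLeft B a)

/-- The map `1 ⊗ ⟨b|`. -/
def sliceR (A : QSystem) (b : B) : tensor A B →L[ℂ] A := adjoint (tmulRight A b)

theorem inner_sliceL (a : A) (b : B) (z : tensor A B) :
    inner ℂ b (sliceL B a z) = inner ℂ (tmul a b) z := by
  rw [sliceL, adjoint_inner_right, tmulLeft_apply]

theorem inner_sliceR (a : A) (b : B) (z : tensor A B) :
    inner ℂ a (sliceR A b z) = inner ℂ (tmul a b) z := by
  rw [sliceR, adjoint_inner_right, tmulRight_apply]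

@[simp] theorem sliceL_tmul (a a' : A) (b : B) : sliceL B a (tmul a' b) = inner ℂ a a' • b :=
  ext_inner_left ℂ fun v => by simp -proj [inner_sliceL, inner_smul_right]

@[simp] theorem sliceR_tmul (b b' : B) (a : A) : sliceR A b (tmul a b') = inner ℂ b b' • a :=
  ext_inner_left ℂ fun v => by simp -proj [inner_sliceR, inner_smul_right, mul_comm]

theorem sliceR_tmap (f : A →L[ℂ] A') (b : B) (z : tensor A B) :
    sliceR A' b (tmap f (.id ℂ B) z) = f (sliceR A b z) := by
  have h : sliceR A' b ∘L tmap f (.id ℂ B) = f ∘L sliceR A b := clm_ext_tmul fun a b => by simp -proj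
  exact congrArg (fun F => F z) h

theorem sliceL_tmap (g : B →L[ℂ] B') (a : A) (z : tensor A B) :
    sliceL B' a (tmap (.id ℂ A) g z) = g (sliceL B a z) := by
  have h : sliceL B' a ∘L tmap (.id ℂ A) g = g ∘L sliceL B a := clm_ext_tmul fun a b => by simp -proj
  exact congrArg (fun F => F z) h

theorem adjoint_sliceL (a : A) : adjoint (sliceL B a) = tmulLeft B a := adjoint_adjoint _

theorem adjoint_sliceR (b : B) : adjoint (sliceR A b) = tmulRight A b := adjoint_adjoint _

/-! ### Associator and interchange on product vectors -/

@[simp] theorem assoc_tmul (a : A) (b : B) (c : C) :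
    QSystem.assoc A B C (tmul (tmul a b) c) = tmul a (tmul b c) := by
  exact LinearEquiv.extendOfIsometry_eq (f := TensorProduct.assoc ℂ A B C)
    (e₁ := (embed (incl A B) (LinearIsometry.id : C →ₗᵢ[ℂ] C)).toLinearMap)
    (e₂ := (embed (LinearIsometry.id : A →ₗᵢ[ℂ] A) (incl B C)).toLinearMap)
    (denseRange_embed _ _ (denseRange_incl A B) (denseRange_id C))
    (denseRange_embed _ _ (denseRange_id A) (denseRange_incl B C))
    (fun x => by
      simp only [LinearIsometry.coe_toLinearMap, LinearIsometry.norm_map]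
      exact TensorProduct.norm_assoc x) ((a ⊗ₜ b) ⊗ₜ c)

@[simp] theorem interchange_tmul (a : A) (b : B) (c : C) (d : D) :
    interchange A B C D (tmul (tmul a b) (tmul c d)) = tmul (tmul a c) (tmul b d) := by
  exact LinearEquiv.extendOfIsometry_eq (f := TensorProduct.tensorTensorTensorComm ℂ A B C D)
    (e₁ := (embed (incl A B) (incl C D)).toLinearMap)
    (e₂ := (embed (incl A C) (incl B D)).toLinearMap)
    (denseRange_embed _ _ (denseRange_incl A B) (denseRange_incl C D))
    (denseRange_embed _ _ (denseRange_incl A C) (denseRange_incl B D))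
    (fun x => by
      simp only [LinearIsometry.coe_toLinearMap, LinearIsometry.norm_map]
      exact norm_tensorTensorTensorComm x) ((a ⊗ₜ b) ⊗ₜ (c ⊗ₜ d))

/-- The associator as a bounded operator. -/
def assocL (A B C : QSystem) : tensor (tensor A B) C →L[ℂ] tensor A (tensor B C) :=
  (QSystem.assoc A B C).toLinearIsometry.toContinuousLinearMap

/-- The interchange of the inner factors as a bounded operator. -/
def interL (A B C D : QSystem) :
    tensor (tensor A B) (tensor C D) →L[ℂ] tensor (tensor A C) (tensor B D) :=
  (interchange A B C D).toLinearIsometry.toContinuousLinearMap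

@[simp] theorem assocL_tmul (a : A) (b : B) (c : C) :
    assocL A B C (tmul (tmul a b) c) = tmul a (tmul b c) := assoc_tmul a b c

@[simp] theorem interL_tmul (a : A) (b : B) (c : C) (d : D) :
    interL A B C D (tmul (tmul a b) (tmul c d)) = tmul (tmul a c) (tmul b d) :=
  interchange_tmul a b c d

theorem clm_ext_tmul₃ {Z : Type*} [NormedAddCommGroup Z] [NormedSpace ℂ Z]
    {f g : tensor (tensor A B) C →L[ℂ] Z}
    (h : ∀ a b c, f (tmul (tmul a b) c) = g (tmul (tmul a b) c)) : f = g := by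
  refine clm_ext_tmul fun ab c => ?_
  have h' : f ∘L tmulRight _ c = g ∘L tmulRight _ c := clm_ext_tmul fun a b => h a b c
  exact congrArg (fun F => F ab) h'

theorem clm_ext_tmul₃' {Z : Type*} [NormedAddCommGroup Z] [NormedSpace ℂ Z]
    {f g : tensor A (tensor B C) →L[ℂ] Z}
    (h : ∀ a b c, f (tmul a (tmul b c)) = g (tmul a (tmul b c))) : f = g := by
  refine clm_ext_tmul fun a bc => ?_
  have h' : f ∘L tmulLeft _ a = g ∘L tmulLeft _ a := clm_ext_tmul fun b c => h a b c
  exact congrArg (fun F => F bc) h'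

theorem clm_ext_tmul₄ {Z : Type*} [NormedAddCommGroup Z] [NormedSpace ℂ Z]
    {f g : tensor (tensor A B) (tensor C D) →L[ℂ] Z}
    (h : ∀ a b c d, f (tmul (tmul a b) (tmul c d)) = g (tmul (tmul a b) (tmul c d))) : f = g := by
  refine clm_ext_tmul₃' fun ab c d => ?_
  have h' : f ∘L tmulRight _ (tmul c d) = g ∘L tmulRight _ (tmul c d) :=
    clm_ext_tmul fun a b => h a b c d
  exact congrArg (fun F => F ab) h'

theorem assocL_naturality (f : A →L[ℂ] A') (g : B →L[ℂ] B') (h : C →L[ℂ] D) :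
    tmap f (tmap g h) ∘L assocL A B C = assocL A' B' D ∘L tmap (tmap f g) h :=
  clm_ext_tmul₃ fun a b c => by simp -proj

theorem interL_naturality {D' C' : QSystem} (f : A →L[ℂ] A') (g : B →L[ℂ] B') (h : C →L[ℂ] C')
    (k : D →L[ℂ] D') :
    tmap (tmap f h) (tmap g k) ∘L interL A B C D = interL A' B' C' D' ∘L tmap (tmap f g) (tmap h k) :=
  clm_ext_tmul₄ fun a b c d => by simp -proj

theorem adjoint_comp_self_of_isometry {H K : QSystem} (V : H →L[ℂ] K) (h : ∀ x, ‖V x‖ = ‖x‖) :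
    adjoint V ∘L V = .id ℂ H :=
  (norm_map_iff_adjoint_comp_self V).1 h

/-- The tensor product of two isometries. -/
def tmapIso (f : A →ₗᵢ[ℂ] A') (g : B →ₗᵢ[ℂ] B') : tensor A B →ₗᵢ[ℂ] tensor A' B' where
  toLinearMap := (tmap f.toContinuousLinearMap g.toContinuousLinearMap).toLinearMap
  norm_map' := by
    refine (norm_map_iff_adjoint_comp_self _).2 ?_
    rw [adjoint_tmap, tmap_comp, adjoint_comp_self_of_isometry _ f.norm_map,
      adjoint_comp_self_of_isometry _ g.norm_map, tmap_id]
    rfl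

/-! ### Bases of tensor products and Kraus families -/

/-- The product basis of a tensor product. -/
def tensorBasis {ι κ : Type*} (a : HilbertBasis ι ℂ A) (b : HilbertBasis κ ℂ B) :
    HilbertBasis (ι × κ) ℂ (tensor A B) :=
  HilbertBasis.mkOfOrthogonalEqBot (v := fun p : ι × κ => tmul (a p.1) (b p.2))
    (by
      classical
      rw [orthonormal_iff_ite]
      rintro ⟨i, j⟩ ⟨i', j'⟩
      rw [inner_tmul, orthonormal_iff_ite.1 a.orthonormal, orthonormal_iff_ite.1 b.orthonormal]
      by_cases h1 : i = i' <;> by_cases h2 : j = j' <;> simp -proj [h1, h2])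
    (by
      rw [Submodule.eq_bot_iff]
      intro z hz
      have hz' : ∀ i j, inner ℂ (tmul (a i) (b j)) z = 0 := fun i j =>
        (Submodule.mem_orthogonal _ _).1 hz _ (Submodule.subset_span ⟨(i, j), rfl⟩)
      -- Completeness is obtained one factor at a time: slices along basis vectors of `B` vanish
      -- because their coordinates in `A` do, then slices along arbitrary vectors of `A` vanish.
      have h1 : ∀ j, sliceR A (b j) z = 0 := fun j => by
        refine a.repr.injective (lp.ext (funext fun i => ?_))
        rw [a.repr_apply_apply, inner_sliceR, hz', map_zero]
        rfl
      have h2 : ∀ x, sliceL B x z = 0 := fun x => by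
        refine b.repr.injective (lp.ext (funext fun j => ?_))
        rw [b.repr_apply_apply, inner_sliceL, ← inner_sliceR, h1, inner_zero_right, map_zero]
        rfl
      refine vec_ext_tmul fun x y => ?_
      rw [← inner_sliceL, h2, inner_zero_right, inner_zero_right])

@[simp] theorem tensorBasis_apply {ι κ : Type*} (a : HilbertBasis ι ℂ A) (b : HilbertBasis κ ℂ B)
    (p : ι × κ) : tensorBasis a b p = tmul (a p.1) (b p.2) := by
  simp -proj [tensorBasis]

theorem enorm_sq_eq_tsum {ι : Type*} {H : QSystem} (b : HilbertBasis ι ℂ H) (x : H) :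
    ‖x‖ₑ ^ 2 = ∑' i, ‖inner ℂ (b i) x‖ₑ ^ 2 := by
  have h := b.hasSum_inner_mul_inner x x
  have h' : HasSum (fun i => ‖inner ℂ (b i) x‖ ^ 2) (‖x‖ ^ 2) := by
    have h2 := (Complex.hasSum_iff _ _).1 h |>.1
    convert h2 using 1
    · ext i
      have h3 := inner_mul_symm_re_eq_norm (𝕜 := ℂ) x (b i)
      rw [norm_mul, norm_inner_symm x (b i), ← sq] at h3
      exact h3.symm
    · rw [← inner_self_eq_norm_sq (𝕜 := ℂ)]; rfl
  have h3 := ENNReal.ofReal_tsum_of_nonneg (fun i => by positivity) h'.summable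
  rw [h'.tsum_eq] at h3
  simpa -proj [ENNReal.ofReal_pow] using h3

/-- Kraus families: `∑ₖ ‖Aₖ x‖² = ‖x‖²`. -/
def IsKraus {ι : Type*} {H K : QSystem} (M : ι → H →L[ℂ] K) : Prop :=
  ∀ x, ∑' k, ‖M k x‖ₑ ^ 2 = ‖x‖ₑ ^ 2

variable {ι κ : Type*} {H K L : QSystem}

/-- Protocols state the completeness of a measurement with real sums. The version in `ℝ≥0∞` is the
one used in proofs, since there sums are exchanged without any summability condition. -/
theorem hasSum_norm_sq_iff {K : ι → QSystem} (M : ∀ k, H →L[ℂ] K k) (x : H) :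
    HasSum (fun k => ‖M k x‖ ^ 2) (‖x‖ ^ 2) ↔ ∑' k, ‖M k x‖ₑ ^ 2 = ‖x‖ₑ ^ 2 := by
  have e : ∀ k, ‖M k x‖ₑ ^ 2 = ENNReal.ofReal (‖M k x‖ ^ 2) := fun k => by
    simp -proj [ENNReal.ofReal_pow]
  have e' : ‖x‖ₑ ^ 2 = ENNReal.ofReal (‖x‖ ^ 2) := by simp -proj [ENNReal.ofReal_pow]
  simp_rw [e, e']
  constructor
  · intro h
    rw [← h.tsum_eq, ENNReal.ofReal_tsum_of_nonneg (fun k => by positivity) h.summable]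
  · intro h
    have hs : ∑' k, ENNReal.ofReal (‖M k x‖ ^ 2) ≠ ⊤ := by rw [h]; exact ENNReal.ofReal_ne_top
    have h2 := ENNReal.hasSum_toReal hs
    rw [← ENNReal.tsum_toReal_eq (fun k => ENNReal.ofReal_ne_top), h, ENNReal.toReal_ofReal (by positivity)] at h2
    simpa -proj [ENNReal.toReal_ofReal, sq_nonneg] using h2

theorem IsKraus.hasSum {M : ι → H →L[ℂ] K} (hM : IsKraus M) (x : H) :
    HasSum (fun k => ‖M k x‖ ^ 2) (‖x‖ ^ 2) :=
  (hasSum_norm_sq_iff (K := fun _ => K) M x).2 (hM x)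

theorem IsKraus.comp {M : ι → H →L[ℂ] K} {N : κ → K →L[ℂ] L} (hN : IsKraus N) (hM : IsKraus M) :
    IsKraus fun p : κ × ι => N p.1 ∘L M p.2 := fun x => by
  rw [ENNReal.tsum_prod (f := fun k i => ‖(N k ∘L M i) x‖ₑ ^ 2), ENNReal.tsum_comm, ← hM x]
  exact tsum_congr fun i => hN (M i x)

theorem isKraus_of_isometry [Unique ι] {V : H →L[ℂ] K} (h : ∀ x, ‖V x‖ = ‖x‖) :
    IsKraus fun _ : ι => V := fun x => by
  rw [tsum_eq_single default (by intro b hb; exact absurd (Unique.eq_default b) hb),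
    ← ofReal_norm, h, ofReal_norm]

/-- Parseval in a product basis, regrouped by the index of `B`. These slices are the Kraus operators
of a basis measurement that consumes the second factor. -/
theorem isKraus_sliceR (b : HilbertBasis ι ℂ B) : IsKraus fun i => sliceR A (b i) := fun z => by
  obtain ⟨w, a, -⟩ := exists_hilbertBasis ℂ A
  rw [enorm_sq_eq_tsum (tensorBasis a b), ENNReal.tsum_prod (f := fun i j =>
    ‖inner ℂ (tensorBasis a b (i, j)) z‖ₑ ^ 2), ENNReal.tsum_comm]
  refine tsum_congr fun j => ?_
  rw [enorm_sq_eq_tsum a]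
  simp -proj [inner_sliceR]

theorem isKraus_sliceL (a : HilbertBasis ι ℂ A) : IsKraus fun i => sliceL B (a i) := fun z => by
  obtain ⟨w, b, -⟩ := exists_hilbertBasis ℂ B
  rw [enorm_sq_eq_tsum (tensorBasis a b), ENNReal.tsum_prod (f := fun i j =>
    ‖inner ℂ (tensorBasis a b (i, j)) z‖ₑ ^ 2)]
  refine tsum_congr fun j => ?_
  rw [enorm_sq_eq_tsum b]
  simp -proj [inner_sliceL]

/-- Slicing the spectator `B` in a basis reduces the identity to the one on `H`. The targets depend
on `k`, as they do for the outcomes of a protocol. -/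
theorem tsum_tmap_right {K : ι → QSystem} (M : ∀ k, H →L[ℂ] K k)
    (h : ∀ x, ∑' k, ‖M k x‖ₑ ^ 2 = ‖x‖ₑ ^ 2) (z : tensor H B) :
    ∑' k, ‖tmap (M k) (.id ℂ B) z‖ₑ ^ 2 = ‖z‖ₑ ^ 2 := by
  obtain ⟨w, b, -⟩ := exists_hilbertBasis ℂ B
  have e : ∀ k, ‖tmap (M k) (.id ℂ B) z‖ₑ ^ 2 = ∑' j, ‖M k (sliceR H (b j) z)‖ₑ ^ 2 := fun k => by
    rw [← isKraus_sliceR b]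
    simp -proj [sliceR_tmap]
  simp_rw [e]
  rw [ENNReal.tsum_comm, ← isKraus_sliceR b z]
  exact tsum_congr fun j => h _

theorem tsum_tmap_left {K : ι → QSystem} (M : ∀ k, H →L[ℂ] K k)
    (h : ∀ x, ∑' k, ‖M k x‖ₑ ^ 2 = ‖x‖ₑ ^ 2) (z : tensor B H) :
    ∑' k, ‖tmap (.id ℂ B) (M k) z‖ₑ ^ 2 = ‖z‖ₑ ^ 2 := by
  obtain ⟨w, b, -⟩ := exists_hilbertBasis ℂ B
  have e : ∀ k, ‖tmap (.id ℂ B) (M k) z‖ₑ ^ 2 = ∑' j, ‖M k (sliceL H (b j) z)‖ₑ ^ 2 := fun k => by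
    rw [← isKraus_sliceL b]
    simp -proj [sliceL_tmap]
  simp_rw [e]
  rw [ENNReal.tsum_comm, ← isKraus_sliceL b z]
  exact tsum_congr fun j => h _

theorem IsKraus.tmap_id {M : ι → H →L[ℂ] K} (hM : IsKraus M) (B : QSystem) :
    IsKraus fun k => tmap (M k) (.id ℂ B) := tsum_tmap_right M hM

theorem IsKraus.id_tmap {M : ι → H →L[ℂ] K} (hM : IsKraus M) (B : QSystem) :
    IsKraus fun k => tmap (.id ℂ B) (M k) := tsum_tmap_left M hM

theorem IsKraus.tmap {H' K' : QSystem} {M : ι → H →L[ℂ] K} {N : κ → H' →L[ℂ] K'} (hM : IsKraus M)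
    (hN : IsKraus N) : IsKraus fun p : ι × κ => QSystem.tmap (M p.1) (N p.2) := by
  have h := (hM.tmap_id K').comp (hN.id_tmap H)
  intro z
  rw [← h z]
  refine tsum_congr fun p => ?_
  change _ = ‖(QSystem.tmap (M p.1) (.id ℂ K') ∘L QSystem.tmap (.id ℂ H) (N p.2)) z‖ₑ ^ 2
  rw [tmap_comp]
  rfl

end Tensor

end BosonicGaussian

end

noncomputable section

namespace BosonicGaussian

open QSystem ContinuousLinearMap InnerProductSpace

/-! ### Nuclear representations and the trace -/

section TraceClass

variable {H K L E : QSystem} {ι κ : Type}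

/-- `T = ∑ᵢ |uᵢ⟩⟨vᵢ|`, absolutely convergent. -/
structure NRep (T : H →L[ℂ] H) (u v : ι → H) : Prop where
  summable : Summable fun i => ‖u i‖ * ‖v i‖
  hasSum : ∀ x, HasSum (fun i => inner ℂ (v i) x • u i) (T x)

theorem isTraceClass_iff {T : H →L[ℂ] H} :
    IsTraceClass T ↔ ∃ (ι : Type) (u v : ι → H), NRep T u v :=
  ⟨fun ⟨ι, u, v, h, h'⟩ => ⟨ι, u, v, h, h'⟩, fun ⟨ι, u, v, h⟩ => ⟨ι, u, v, h.1, h.2⟩⟩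

theorem NRep.isTraceClass {T : H →L[ℂ] H} {u v : ι → H} (h : NRep T u v) : IsTraceClass T :=
  ⟨ι, u, v, h.1, h.2⟩

theorem exists_nRep (u v : ι → H) (h : Summable fun i => ‖u i‖ * ‖v i‖) :
    ∃ T : H →L[ℂ] H, NRep T u v := by
  have hs : Summable fun i => rankOne ℂ (u i) (v i) :=
    Summable.of_norm (by simpa only [norm_rankOne] using h)
  exact ⟨∑' i, rankOne ℂ (u i) (v i), h, fun x => by
    simpa -proj using hs.hasSum.mapL (ContinuousLinearMap.apply ℂ H x)⟩

theorem NRep.comp {T : H →L[ℂ] H} {u v : ι → H} (h : NRep T u v) (X : H →L[ℂ] K)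
    (Y : K →L[ℂ] H) : NRep (X ∘L T ∘L Y) (fun i => X (u i)) (fun i => adjoint Y (v i)) where
  summable := by
    refine Summable.of_nonneg_of_le (fun i => by positivity) (fun i => ?_)
      (h.summable.mul_left (‖X‖ * ‖adjoint Y‖))
    calc ‖X (u i)‖ * ‖adjoint Y (v i)‖ ≤ (‖X‖ * ‖u i‖) * (‖adjoint Y‖ * ‖v i‖) := by
          gcongr <;> exact le_opNorm _ _
      _ = _ := by ring
  hasSum := fun x => by
    simpa -proj [adjoint_inner_left] using (h.hasSum (Y x)).mapL X

theorem NRep.comp_left {T : H →L[ℂ] H} {u v : ι → H} (h : NRep T u v) (X : H →L[ℂ] H) :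
    NRep (X ∘L T) (fun i => X (u i)) v := by
  have h2 := h.comp X (.id ℂ H)
  have e : adjoint (ContinuousLinearMap.id ℂ H) = .id ℂ H := by
    simpa using ContinuousLinearMap.adjoint_id (𝕜 := ℂ) (E := H)
  rw [e] at h2
  exact h2

theorem NRep.hasSum_inner {T : H →L[ℂ] H} {u v : ι → H} (h : NRep T u v) (x y : H) :
    HasSum (fun i => inner ℂ (v i) x * inner ℂ y (u i)) (inner ℂ y (T x)) := by
  simpa -proj [inner_smul_right] using (h.hasSum x).mapL (innerSL ℂ y)

theorem tsum_mul_le_of_sq {a b : κ → ℝ} {A B : ℝ} (ha : ∀ k, 0 ≤ a k) (hb : ∀ k, 0 ≤ b k)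
    (hA : 0 ≤ A) (hB : 0 ≤ B) (h1 : HasSum (fun k => a k ^ 2) (A ^ 2))
    (h2 : HasSum (fun k => b k ^ 2) (B ^ 2)) :
    Summable (fun k => a k * b k) ∧ ∑' k, a k * b k ≤ A * B := by
  have key : ∀ s : Finset κ, ∑ k ∈ s, a k * b k ≤ A * B := fun s => by
    refine le_of_sq_le_sq ?_ (by positivity)
    calc (∑ k ∈ s, a k * b k) ^ 2 ≤ (∑ k ∈ s, a k ^ 2) * ∑ k ∈ s, b k ^ 2 :=
          Finset.sum_mul_sq_le_sq_mul_sq s a b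
      _ ≤ A ^ 2 * B ^ 2 := by
          gcongr
          · exact sum_le_hasSum s (fun k _ => by positivity) h1
          · exact sum_le_hasSum s (fun k _ => by positivity) h2
      _ = (A * B) ^ 2 := by ring
  have hs : Summable fun k => a k * b k :=
    summable_of_sum_le (fun k => mul_nonneg (ha k) (hb k)) key
  exact ⟨hs, hs.tsum_le_of_sum_le key⟩

/-- Cauchy–Schwarz in `k` bounds each inner sum by `u i * v i`. This is what permits nuclear
representations to be expanded in a basis. -/
theorem summable_mul_of_sq {u v : ι → ℝ} (a b : ι → κ → ℝ) (ha : ∀ i k, 0 ≤ a i k)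
    (hb : ∀ i k, 0 ≤ b i k) (hu : ∀ i, 0 ≤ u i) (hv : ∀ i, 0 ≤ v i)
    (h1 : ∀ i, HasSum (fun k => a i k ^ 2) (u i ^ 2))
    (h2 : ∀ i, HasSum (fun k => b i k ^ 2) (v i ^ 2)) (h : Summable fun i => u i * v i) :
    Summable fun p : ι × κ => a p.1 p.2 * b p.1 p.2 := by
  refine (summable_prod_of_nonneg fun p => mul_nonneg (ha _ _) (hb _ _)).2 ⟨fun i => ?_, ?_⟩
  · exact (tsum_mul_le_of_sq (ha i) (hb i) (hu i) (hv i) (h1 i) (h2 i)).1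
  · exact Summable.of_nonneg_of_le (fun i => tsum_nonneg fun k => mul_nonneg (ha _ _) (hb _ _))
      (fun i => (tsum_mul_le_of_sq (ha i) (hb i) (hu i) (hv i) (h1 i) (h2 i)).2) h

theorem hasSum_norm_inner_sq {κ : Type*} (b : HilbertBasis κ ℂ H) (x : H) :
    HasSum (fun k => ‖inner ℂ (b k) x‖ ^ 2) (‖x‖ ^ 2) := by
  have h := b.hasSum_inner_mul_inner x x
  have h2 := (Complex.hasSum_iff _ _).1 h |>.1
  convert h2 using 1
  · ext i
    have h3 := inner_mul_symm_re_eq_norm (𝕜 := ℂ) x (b i)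
    rw [norm_mul, norm_inner_symm x (b i), ← sq] at h3
    exact h3.symm
  · rw [← inner_self_eq_norm_sq (𝕜 := ℂ)]; rfl

/-- Parseval and an exchange of two absolutely convergent sums. The limit does not mention the
basis, so the chosen basis in `trace` is immaterial. -/
theorem NRep.hasSum_basis {T : H →L[ℂ] H} {u v : ι → H} (h : NRep T u v)
    (b : HilbertBasis κ ℂ H) :
    HasSum (fun k => inner ℂ (b k) (T (b k))) (∑' i, inner ℂ (v i) (u i)) := by
  have hs : Summable fun p : ι × κ => inner ℂ (v p.1) (b p.2) * inner ℂ (b p.2) (u p.1) := by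
    have h0 : ∀ i, HasSum (fun k => ‖inner ℂ (v i) (b k)‖ ^ 2) (‖v i‖ ^ 2) := fun i => by
      simpa -proj only [norm_inner_symm] using hasSum_norm_inner_sq b (v i)
    have hs := summable_mul_of_sq (u := fun i => ‖u i‖) (v := fun i => ‖v i‖) _ _
      (fun _ _ => norm_nonneg _) (fun _ _ => norm_nonneg _) (fun _ => norm_nonneg _)
      (fun _ => norm_nonneg _) (fun i => hasSum_norm_inner_sq b (u i)) h0 h.summable
    refine Summable.of_norm (hs.congr fun p => ?_)
    rw [norm_mul, mul_comm]
  have h1 : ∀ k, HasSum (fun i => inner ℂ (v i) (b k) * inner ℂ (b k) (u i))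
      (inner ℂ (b k) (T (b k))) := fun k => h.hasSum_inner (b k) (b k)
  have h2 : HasSum (fun p : κ × ι => inner ℂ (v p.2) (b p.1) * inner ℂ (b p.1) (u p.2))
      (∑' p : ι × κ, inner ℂ (v p.1) (b p.2) * inner ℂ (b p.2) (u p.1)) :=
    (Equiv.prodComm κ ι).hasSum_iff.2 hs.hasSum
  have h3 := h2.prod_fiberwise h1
  rw [hs.tsum_prod] at h3
  convert h3 using 1
  exact tsum_congr fun i => ((b.tsum_inner_mul_inner (v i) (u i)).symm)

theorem NRep.trace_eq {T : H →L[ℂ] H} {u v : ι → H} (h : NRep T u v) :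
    trace T = ∑' i, inner ℂ (v i) (u i) :=
  (h.hasSum_basis (exists_hilbertBasis ℂ H).choose_spec.choose).tsum_eq

theorem NRep.summable_inner {T : H →L[ℂ] H} {u v : ι → H} (h : NRep T u v) :
    Summable fun i => inner ℂ (v i) (u i) :=
  Summable.of_norm_bounded h.summable fun i => (norm_inner_le_norm _ _).trans_eq (mul_comm _ _)

theorem NRep.hasSum_trace {T : H →L[ℂ] H} {u v : ι → H} (h : NRep T u v) :
    HasSum (fun i => inner ℂ (v i) (u i)) (trace T) :=
  h.trace_eq ▸ h.summable_inner.hasSum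

theorem hasSum_trace_basis {T : H →L[ℂ] H} (h : IsTraceClass T) (b : HilbertBasis κ ℂ H) :
    HasSum (fun k => inner ℂ (b k) (T (b k))) (trace T) := by
  obtain ⟨ι, u, v, h⟩ := isTraceClass_iff.1 h
  exact h.trace_eq ▸ h.hasSum_basis b

theorem IsTraceClass.comp {T : H →L[ℂ] H} (h : IsTraceClass T) (X : H →L[ℂ] K)
    (Y : K →L[ℂ] H) : IsTraceClass (X ∘L T ∘L Y) := by
  obtain ⟨ι, u, v, h⟩ := isTraceClass_iff.1 h
  exact (h.comp X Y).isTraceClass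

theorem IsTraceClass.comp_left {T : H →L[ℂ] H} (h : IsTraceClass T) (X : H →L[ℂ] H) :
    IsTraceClass (X ∘L T) := h.comp X (.id ℂ H)

theorem IsTraceClass.add {S T : H →L[ℂ] H} (hS : IsTraceClass S) (hT : IsTraceClass T) :
    IsTraceClass (S + T) := (TraceClass H).add_mem hS hT

theorem IsTraceClass.smul {T : H →L[ℂ] H} (c : ℂ) (hT : IsTraceClass T) :
    IsTraceClass (c • T) := (TraceClass H).smul_mem c hT

theorem trace_comp_comp {T : H →L[ℂ] H} (h : IsTraceClass T) (X : H →L[ℂ] K) (Y : K →L[ℂ] H) :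
    trace (X ∘L T ∘L Y) = trace ((Y ∘L X) ∘L T) := by
  obtain ⟨ι, u, v, h⟩ := isTraceClass_iff.1 h
  rw [(h.comp X Y).trace_eq, (h.comp_left (Y ∘L X)).trace_eq]
  exact tsum_congr fun i => adjoint_inner_left _ _ _

theorem trace_add {S T : H →L[ℂ] H} (hS : IsTraceClass S) (hT : IsTraceClass T) :
    trace (S + T) = trace S + trace T := by
  have b := (exists_hilbertBasis ℂ H).choose_spec.choose
  refine (hasSum_trace_basis (hS.add hT) b).unique ?_
  simpa -proj [inner_add_right] using (hasSum_trace_basis hS b).add (hasSum_trace_basis hT b)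

theorem trace_smul {T : H →L[ℂ] H} (c : ℂ) (hT : IsTraceClass T) :
    trace (c • T) = c * trace T := by
  have b := (exists_hilbertBasis ℂ H).choose_spec.choose
  refine (hasSum_trace_basis (hT.smul c) b).unique ?_
  simpa -proj [inner_smul_right] using (hasSum_trace_basis hT b).mul_left c

theorem trace_sum {α : Type*} (s : Finset α) (T : α → H →L[ℂ] H) (hT : ∀ a, IsTraceClass (T a)) :
    IsTraceClass (∑ a ∈ s, T a) ∧ trace (∑ a ∈ s, T a) = ∑ a ∈ s, trace (T a) := by
  classical
  induction s using Finset.induction_on with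
  | empty =>
    refine ⟨(TraceClass H).zero_mem, ?_⟩
    simp [trace]
  | insert a s ha ih =>
    rw [Finset.sum_insert ha, Finset.sum_insert ha, trace_add (hT a) ih.1, ih.2]
    exact ⟨(hT a).add ih.1, rfl⟩

theorem trace_rankOne_comp {T : H →L[ℂ] H} (h : IsTraceClass T) (x y : H) :
    trace (rankOne ℂ x y ∘L T) = inner ℂ y (T x) := by
  obtain ⟨ι, u, v, h⟩ := isTraceClass_iff.1 h
  rw [(h.comp_left _).trace_eq, ← (h.hasSum_inner x y).tsum_eq]
  exact tsum_congr fun i => by simp -proj [mul_comm]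

/-- Rank-one test operators recover the matrix elements. It makes the partial trace in
`IsStinespring` unique, and with it the channel of a dilation. -/
theorem ext_of_trace {S T : H →L[ℂ] H} (hS : IsTraceClass S) (hT : IsTraceClass T)
    (h : ∀ X : H →L[ℂ] H, trace (X ∘L S) = trace (X ∘L T)) : S = T := by
  ext x
  refine ext_inner_left ℂ fun y => ?_
  rw [← trace_rankOne_comp hS, ← trace_rankOne_comp hT, h]

theorem hasSum_mul_prod {f : ι → ℂ} {g : κ → ℂ} {a b : ℂ} (hf : HasSum f a) (hg : HasSum g b) :
    HasSum (fun p : ι × κ => f p.1 * g p.2) (a * b) :=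
  hf.mul hg (summable_mul_of_summable_norm hf.summable.norm hg.summable.norm)

theorem NRep.tmap {T : H →L[ℂ] H} {S : K →L[ℂ] K} {u v : ι → H} {u' v' : κ → K}
    (hT : NRep T u v) (hS : NRep S u' v') :
    NRep (QSystem.tmap T S) (fun p : ι × κ => tmul (u p.1) (u' p.2))
      (fun p => tmul (v p.1) (v' p.2)) := by
  have hs : Summable fun p : ι × κ => ‖tmul (u p.1) (u' p.2)‖ * ‖tmul (v p.1) (v' p.2)‖ := by
    have := hT.summable.mul_of_nonneg hS.summable (fun i => by positivity) (fun i => by positivity)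
    refine this.congr fun p => ?_
    rw [norm_tmul, norm_tmul]
    ring
  obtain ⟨R, hR⟩ := exists_nRep _ _ hs
  have e : R = QSystem.tmap T S := by
    refine clm_ext_tmul fun a b => vec_ext_tmul fun x y => ?_
    refine (hR.hasSum_inner _ _).unique ?_
    have h1 := hT.hasSum_inner a x
    have h2 := hS.hasSum_inner b y
    rw [tmap_tmul, inner_tmul]
    refine (hasSum_mul_prod h1 h2).congr_fun ?_
    intro p
    rw [inner_tmul, inner_tmul]
    ring
  exact e ▸ hR

theorem IsTraceClass.tmap {T : H →L[ℂ] H} {S : K →L[ℂ] K} (hT : IsTraceClass T)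
    (hS : IsTraceClass S) : IsTraceClass (QSystem.tmap T S) := by
  obtain ⟨ι, u, v, hT⟩ := isTraceClass_iff.1 hT
  obtain ⟨κ, u', v', hS⟩ := isTraceClass_iff.1 hS
  exact (hT.tmap hS).isTraceClass

theorem trace_tmap {T : H →L[ℂ] H} {S : K →L[ℂ] K} (hT : IsTraceClass T)
    (hS : IsTraceClass S) : trace (tmap T S) = trace T * trace S := by
  obtain ⟨ι, u, v, hT⟩ := isTraceClass_iff.1 hT
  obtain ⟨κ, u', v', hS⟩ := isTraceClass_iff.1 hS
  refine (hT.tmap hS).hasSum_trace.unique ?_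
  refine (hasSum_mul_prod hT.hasSum_trace hS.hasSum_trace).congr_fun ?_
  intro p
  rw [inner_tmul]

/-- With `R = √T` and a Hilbert basis `b`, inserting the basis into `T = R R` gives `∑ |R bᵢ⟩⟨R
bᵢ|`, and `∑ ‖R bᵢ‖²` is the trace of `T`. -/
theorem exists_nRep_of_isPositive {T : H →L[ℂ] H} (hT : IsTraceClass T) (hp : T.IsPositive) :
    ∃ (ι : Type) (w : ι → H), (Summable fun i => ‖w i‖ ^ 2) ∧ NRep T w w := by
  obtain ⟨s, b, -⟩ := exists_hilbertBasis ℂ H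
  have h0 : (0 : H →L[ℂ] H) ≤ T := (nonneg_iff_isPositive T).2 hp
  set R : H →L[ℂ] H := CFC.sqrt T with hR
  have hRR : R * R = T := CFC.sqrt_mul_sqrt_self T h0
  have hRs : adjoint R = R :=
    ((nonneg_iff_isPositive R).1 (CFC.sqrt_nonneg T)).isSelfAdjoint
  have hn : ∀ x, inner ℂ x (T x) = ((‖R x‖ ^ 2 : ℝ) : ℂ) := fun x => by
    rw [← hRR]
    change inner ℂ x (R (R x)) = _
    rw [← adjoint_inner_left, hRs, inner_self_eq_norm_sq_to_K]
    norm_cast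
  have hs : Summable fun i => ‖R (b i)‖ ^ 2 := by
    have := (hasSum_trace_basis hT b).summable
    simp_rw [hn] at this
    exact_mod_cast this
  refine ⟨s, fun i => R (b i), hs, by simpa only [sq] using hs, fun x => ?_⟩
  have h1 := (b.hasSum_repr (R x)).mapL R
  rw [show R (R x) = T x by rw [← hRR]; rfl] at h1
  refine h1.congr_fun ?_
  intro i
  simp -proj only [map_smul, b.repr_apply_apply]
  rw [← adjoint_inner_left, hRs]

/-! ### Partial traces and channels defined by isometries -/

theorem IsKraus.hasSum_inner {ι : Type*} {M : ι → H →L[ℂ] K} (hM : IsKraus M) (x y : H) :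
    HasSum (fun k => inner ℂ (M k x) (M k y)) (inner ℂ x y) := by
  have h : ∀ z, HasSum (fun k => ((‖M k z‖ : ℂ) ^ 2)) ((‖z‖ : ℂ) ^ 2) := fun z => by
    have := hM.hasSum z
    exact_mod_cast Complex.hasSum_ofReal.2 this
  have h2 := (((h (x + y)).sub (h (x - y))).add
    (((h (x - Complex.I • y)).sub (h (x + Complex.I • y))).mul_right Complex.I)).div_const 4
  rw [inner_eq_sum_norm_sq_div_four]
  refine HasSum.congr_fun h2 ?_
  intro k
  rw [inner_eq_sum_norm_sq_div_four]
  simp -proj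

/-- Slicing both vectors of every rank-one term of `Ω` along a basis of `E` produces a nuclear
representation of the reduced operator. -/
theorem exists_partialTrace {Ω : tensor K E →L[ℂ] tensor K E} (h : IsTraceClass Ω) :
    ∃ S : TraceClass K, ∀ X : K →L[ℂ] K, trace (X ∘L op S) = trace (tmap X (.id ℂ E) ∘L Ω) := by
  obtain ⟨ι, u, v, h⟩ := isTraceClass_iff.1 h
  obtain ⟨w, e, -⟩ := exists_hilbertBasis ℂ E
  have hk := isKraus_sliceR (A := K) e
  have hs : Summable fun p : ι × w => ‖sliceR K (e p.2) (u p.1)‖ * ‖sliceR K (e p.2) (v p.1)‖ :=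
    summable_mul_of_sq (u := fun i => ‖u i‖) (v := fun i => ‖v i‖)
      (fun i k => ‖sliceR K (e k) (u i)‖) (fun i k => ‖sliceR K (e k) (v i)‖)
      (fun _ _ => norm_nonneg _) (fun _ _ => norm_nonneg _) (fun _ => norm_nonneg _)
      (fun _ => norm_nonneg _) (fun i => hk.hasSum _) (fun i => hk.hasSum _) h.summable
  obtain ⟨S, hS⟩ := exists_nRep _ _ hs
  refine ⟨⟨S, hS.isTraceClass⟩, fun X => ?_⟩
  have h1 := (hS.comp_left X).hasSum_trace.prod_fiberwise fun i => by
    have := hk.hasSum_inner (v i) (tmap X (.id ℂ E) (u i))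
    simpa -proj only [sliceR_tmap] using this
  exact h1.unique (h.comp_left _).hasSum_trace

theorem isTraceClass_conj (V : H →L[ℂ] L) (T : TraceClass H) : IsTraceClass (conj V T) :=
  IsTraceClass.comp T.2 V (adjoint V)

theorem trace_comp_conj (V : H →L[ℂ] L) (T : TraceClass H) (X : L →L[ℂ] L) :
    trace (X ∘L conj V T) = trace ((adjoint V ∘L X ∘L V) ∘L op T) :=
  trace_comp_comp T.2 (X ∘L V) (adjoint V)

theorem trace_tmap_rankOne_comp {Ω : tensor K E →L[ℂ] tensor K E} (h : IsTraceClass Ω) {κ : Type}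
    (e : HilbertBasis κ ℂ E) (x y : K) :
    HasSum (fun k => inner ℂ (tmul y (e k)) (Ω (tmul x (e k))))
      (trace (tmap (rankOne ℂ x y) (.id ℂ E) ∘L Ω)) := by
  have e1 : tmap (rankOne ℂ x y) (.id ℂ E) = tmulLeft E x ∘L sliceL E y :=
    clm_ext_tmul fun a b => by simp -proj [tmul_smul_left]
  have e2 := trace_comp_comp h (sliceL E y) (tmulLeft E x)
  rw [e1, ← e2]
  refine (hasSum_trace_basis (h.comp _ _) e).congr_fun ?_
  intro k
  rw [← inner_sliceL]
  rfl

/-- The channel `T ↦ Tr_E (V T V†)`. -/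
def chanOfIsometry (V : H →ₗᵢ[ℂ] tensor K E) : QChannel H K :=
  have hex (T : TraceClass H) := exists_partialTrace (isTraceClass_conj V.toContinuousLinearMap T)
  have hext (S S' : TraceClass K) (h : ∀ X : K →L[ℂ] K, trace (X ∘L op S) = trace (X ∘L op S')) :
      S = S' := Subtype.ext (ext_of_trace S.2 S'.2 h)
  { toLin :=
    { toFun := fun T => (hex T).choose
      map_add' := fun S T => hext _ _ fun X => by
        have h1 := trace_add ((hex S).choose.2.comp_left X) ((hex T).choose.2.comp_left X)
        have h2 := trace_add ((isTraceClass_conj V.toContinuousLinearMap S).comp_left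
          (tmap X (.id ℂ E))) ((isTraceClass_conj V.toContinuousLinearMap T).comp_left
          (tmap X (.id ℂ E)))
        rw [(hex (S + T)).choose_spec]
        change _ = trace (X ∘L (op (hex S).choose + op (hex T).choose))
        rw [comp_add, h1, (hex S).choose_spec, (hex T).choose_spec, ← h2]
        congr 1
        ext x
        simp -proj [conj]
      map_smul' := fun c T => hext _ _ fun X => by
        have h1 := trace_smul c ((hex T).choose.2.comp_left X)
        have h2 := trace_smul c ((isTraceClass_conj V.toContinuousLinearMap T).comp_left
          (tmap X (.id ℂ E)))
        rw [(hex (c • T)).choose_spec]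
        change _ = trace (X ∘L (c • op (hex T).choose))
        rw [comp_smul, h1, (hex T).choose_spec, ← h2]
        congr 1
        ext x
        simp -proj [conj] }
    completelyPositive := fun k T hT y => by
      obtain ⟨w, e, -⟩ := exists_hilbertBasis ℂ E
      -- A matrix element of the partial trace is the sum over the basis of `E` of matrix elements
      -- of `T i j` at the vectors `V†(y ⊗ eₖ)`, so positivity holds term by term.
      have h1 : ∀ i j, HasSum (fun k => inner ℂ
          (adjoint V.toContinuousLinearMap (tmul (y i) (e k)))
          (op (T i j) (adjoint V.toContinuousLinearMap (tmul (y j) (e k)))))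
          (inner ℂ (y i) (op (hex (T i j)).choose (y j))) := fun i j => by
        rw [← trace_rankOne_comp (hex (T i j)).choose.2, (hex (T i j)).choose_spec]
        refine (trace_tmap_rankOne_comp
          (isTraceClass_conj V.toContinuousLinearMap (T i j)) e (y j) (y i)).congr_fun ?_
        intro k
        rw [adjoint_inner_left]
        rfl
      have h2 := hasSum_sum (s := Finset.univ) fun i _ => hasSum_sum (s := Finset.univ)
        fun j _ => h1 i j
      exact h2.nonneg fun k => hT _
    tracePreserving := fun T => by
      have h := (hex T).choose_spec (.id ℂ K)
      rw [tmap_id, trace_comp_conj, id_comp, id_comp,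
        adjoint_comp_self_of_isometry _ V.norm_map] at h
      exact h }

theorem isStinespring_chanOfIsometry (V : H →ₗᵢ[ℂ] tensor K E) :
    IsStinespring (chanOfIsometry V) E V := fun T X =>
  (exists_partialTrace (isTraceClass_conj V.toContinuousLinearMap T)).choose_spec X

theorem QChannel.ext_trace {Λ Λ' : QChannel H K}
    (h : ∀ (T : TraceClass H) (X : K →L[ℂ] K),
      trace (X ∘L op (Λ.toLin T)) = trace (X ∘L op (Λ'.toLin T))) : Λ = Λ' := by
  have e : Λ.toLin = Λ'.toLin := LinearMap.ext fun T =>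
    Subtype.ext (ext_of_trace (Λ.toLin T).2 (Λ'.toLin T).2 (h T))
  cases Λ
  cases Λ'
  congr

/-- The composition of two channels. -/
def QChannel.comp (Λ' : QChannel K L) (Λ : QChannel H K) : QChannel H L where
  toLin := Λ'.toLin ∘ₗ Λ.toLin
  completelyPositive := fun k T h =>
    Λ'.completelyPositive k (fun i j => Λ.toLin (T i j)) (Λ.completelyPositive k T h)
  tracePreserving := fun T => (Λ'.tracePreserving _).trans (Λ.tracePreserving _)

/-- The dilation of a composition `Λ' ∘ Λ` of channels with dilations `W` and `V`. -/
def compDil {F G : QSystem} (W : K →ₗᵢ[ℂ] tensor L G) (V : H →ₗᵢ[ℂ] tensor K F) :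
    H →ₗᵢ[ℂ] tensor L (tensor G F) :=
  ((QSystem.assoc L G F).toLinearIsometry.comp (tmapIso W (.id : F →ₗᵢ[ℂ] F))).comp V

theorem compDil_toCLM {F G : QSystem} (W : K →ₗᵢ[ℂ] tensor L G) (V : H →ₗᵢ[ℂ] tensor K F) :
    (compDil W V).toContinuousLinearMap = assocL L G F ∘L
      tmap W.toContinuousLinearMap (.id ℂ F) ∘L V.toContinuousLinearMap := rfl

theorem adjoint_assocL_comp {A B C : QSystem} : adjoint (assocL A B C) ∘L assocL A B C = .id ℂ _ :=
  adjoint_comp_self_of_isometry _ (QSystem.assoc A B C).norm_map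

theorem adjoint_interL_comp {A B C D : QSystem} :
    adjoint (interL A B C D) ∘L interL A B C D = .id ℂ _ :=
  adjoint_comp_self_of_isometry _ (interchange A B C D).norm_map

/-- In the Heisenberg picture both sides test `T` against `V† ((W† (X ⊗ 1) W) ⊗ 1) V`; the
associator cancels because it commutes with operators on the separate factors. -/
theorem IsStinespring.comp {F G : QSystem} {Λ' : QChannel K L} {Λ : QChannel H K}
    {W : K →ₗᵢ[ℂ] tensor L G} {V : H →ₗᵢ[ℂ] tensor K F} (hW : IsStinespring Λ' G W)
    (hV : IsStinespring Λ F V) : IsStinespring (Λ'.comp Λ) (tensor G F) (compDil W V) := by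
  intro T X
  change trace (X ∘L op (Λ'.toLin (Λ.toLin T))) = _
  rw [hW, trace_comp_conj, hV, trace_comp_conj, trace_comp_conj, compDil_toCLM]
  congr 2
  have e1 : tmap X (.id ℂ (tensor G F)) ∘L assocL L G F =
      assocL L G F ∘L tmap (tmap X (.id ℂ G)) (.id ℂ F) := by
    rw [← assocL_naturality, tmap_id]
  have e2 : adjoint (assocL L G F) ∘L tmap X (.id ℂ (tensor G F)) ∘L assocL L G F =
      tmap (tmap X (.id ℂ G)) (.id ℂ F) := by
    rw [e1, ← ContinuousLinearMap.comp_assoc, adjoint_assocL_comp, id_comp]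
  have e3 : adjoint (tmap W.toContinuousLinearMap (.id ℂ F)) ∘L
      tmap (tmap X (.id ℂ G)) (.id ℂ F) ∘L tmap W.toContinuousLinearMap (.id ℂ F) =
      tmap (adjoint W.toContinuousLinearMap ∘L tmap X (.id ℂ G) ∘L W.toContinuousLinearMap)
        (.id ℂ F) := by
    have e4 : adjoint (ContinuousLinearMap.id ℂ F) = .id ℂ F := ContinuousLinearMap.adjoint_id
    rw [adjoint_tmap, tmap_comp, tmap_comp, e4]
    rfl
  rw [← e3, ← e2]
  simp -proj only [adjoint_comp, ContinuousLinearMap.comp_assoc]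

end TraceClass

end BosonicGaussian

end

noncomputable section

namespace BosonicGaussian

open QSystem ContinuousLinearMap InnerProductSpace

/-! ### Tensor powers of channels and of dilations -/

section Powers

variable {H K L E F G H' K' E' : QSystem}

theorem isPositive_of_inner_nonneg {T : H →L[ℂ] H} (h : ∀ x, 0 ≤ inner ℂ x (T x)) :
    T.IsPositive := by
  rw [isPositive_iff_complex]
  intro x
  have h1 := Complex.nonneg_iff.1 (h x)
  have h2 : inner ℂ (T x) x = inner ℂ x (T x) := by
    rw [← inner_conj_symm (T x) x]
    exact Complex.conj_eq_iff_im.2 h1.2.symm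
  rw [h2]
  refine ⟨Complex.ext ?_ ?_, h1.1⟩
  · simp
  · simpa using h1.2

theorem IsPositive.tmap_id {D : K →L[ℂ] K} (hD : D.IsPositive) (E : QSystem) :
    (tmap D (.id ℂ E)).IsPositive := by
  refine isPositive_of_inner_nonneg fun z => ?_
  obtain ⟨w, e, -⟩ := exists_hilbertBasis ℂ E
  have h := (isKraus_sliceR (A := K) e).hasSum_inner z (tmap D (.id ℂ E) z)
  refine h.nonneg fun k => ?_
  rw [sliceR_tmap]
  exact hD.inner_nonneg_right _

/-- Rank-one operators between product vectors are themselves products, so product tests already see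
all matrix elements between product vectors. -/
theorem ext_of_trace_tmap {Z W : tensor H K →L[ℂ] tensor H K} (hZ : IsTraceClass Z)
    (hW : IsTraceClass W) (h : ∀ (X : H →L[ℂ] H) (Y : K →L[ℂ] K),
      trace (tmap X Y ∘L Z) = trace (tmap X Y ∘L W)) : Z = W := by
  refine clm_ext_tmul fun x x' => vec_ext_tmul fun y y' => ?_
  have e : rankOne ℂ (tmul x x') (tmul y y') = tmap (rankOne ℂ x y) (rankOne ℂ x' y') :=
    clm_ext_tmul fun a b => by
      simp -proj [tmul_smul_left, tmul_smul_right, smul_smul, mul_comm]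
  rw [← trace_rankOne_comp hZ, ← trace_rankOne_comp hW, e, h]

theorem trace_conj_interchange (V : H →L[ℂ] tensor K E) (V' : H' →L[ℂ] tensor K' E')
    (R : TraceClass (tensor H H')) (T : TraceClass H) (S : TraceClass H')
    (hR : op R = tmap (op T) (op S)) (X : K →L[ℂ] K) (X' : K' →L[ℂ] K') :
    trace (tmap (tmap X X') (.id ℂ (tensor E E')) ∘L conj (interL K E K' E' ∘L tmap V V') R) =
      trace (tmap X (.id ℂ E) ∘L conj V T) * trace (tmap X' (.id ℂ E') ∘L conj V' S) := by
  rw [trace_comp_conj, trace_comp_conj, trace_comp_conj, hR,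
    ← trace_tmap (IsTraceClass.comp_left T.2 _) (IsTraceClass.comp_left S.2 _), ← tmap_comp]
  congr 2
  have e1 : tmap (tmap X X') (.id ℂ (tensor E E')) ∘L interL K E K' E' =
      interL K E K' E' ∘L tmap (tmap X (.id ℂ E)) (tmap X' (.id ℂ E')) := by
    rw [← interL_naturality, tmap_id]
  have e2 : adjoint (interL K E K' E') ∘L tmap (tmap X X') (.id ℂ (tensor E E')) ∘L
      interL K E K' E' = tmap (tmap X (.id ℂ E)) (tmap X' (.id ℂ E')) := by
    rw [e1, ← ContinuousLinearMap.comp_assoc, adjoint_interL_comp, id_comp]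
  rw [← tmap_comp, ← tmap_comp, ← adjoint_tmap, ← e2]
  simp -proj only [adjoint_comp, ContinuousLinearMap.comp_assoc]

/-- The isometry `z ↦ z ⊗ 1` of the trivial system. -/
def unitDil : unit →ₗᵢ[ℂ] tensor unit unit where
  toLinearMap := ((Completion.toComplL : ℂ ⊗[ℂ] ℂ →L[ℂ] Completion (ℂ ⊗[ℂ] ℂ)) ∘L
    (TensorProduct.mkL ℂ ℂ ℂ).flip 1).toLinearMap
  norm_map' z := by
    change ‖((z ⊗ₜ[ℂ] (1 : ℂ) : ℂ ⊗[ℂ] ℂ) : Completion (ℂ ⊗[ℂ] ℂ))‖ = ‖z‖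
    rw [Completion.norm_coe, TensorProduct.norm_tmul, norm_one, mul_one]

/-- The dilation `V ⊗ V'` of a product channel. -/
def prodDil (V : H →ₗᵢ[ℂ] tensor K E) (V' : H' →ₗᵢ[ℂ] tensor K' E') :
    tensor H H' →ₗᵢ[ℂ] tensor (tensor K K') (tensor E E') :=
  (interchange K E K' E').toLinearIsometry.comp (tmapIso V V')

theorem prodDil_toCLM (V : H →ₗᵢ[ℂ] tensor K E) (V' : H' →ₗᵢ[ℂ] tensor K' E') :
    (prodDil V V').toContinuousLinearMap =
      interL K E K' E' ∘L tmap V.toContinuousLinearMap V'.toContinuousLinearMap := rfl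

/-- The tensor power of a dilation, as an isometry. -/
def dilIso (V : H →ₗᵢ[ℂ] tensor K E) : (n : ℕ) → H.pow n →ₗᵢ[ℂ] tensor (K.pow n) (E.pow n)
  | 0 => unitDil
  | n + 1 => prodDil V (dilIso V n)

theorem toCLM_dilIso (V : H →ₗᵢ[ℂ] tensor K E) (n : ℕ) :
    (dilIso V n).toContinuousLinearMap = dilationPow V n := by
  induction n with
  | zero => rfl
  | succ n ih =>
    rw [dilationPow, ← ih]
    rfl

theorem adjoint_dilationPow_comp (V : H →ₗᵢ[ℂ] tensor K E) (n : ℕ) :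
    adjoint (dilationPow V n) ∘L dilationPow V n = .id ℂ _ := by
  rw [← toCLM_dilIso]
  exact adjoint_comp_self_of_isometry _ (dilIso V n).norm_map

theorem chanOfIsometry_unitDil (T : TraceClass unit) : (chanOfIsometry unitDil).toLin T = T := by
  refine Subtype.ext (ext_of_trace (Subtype.property _) T.2 fun X => ?_)
  refine (isStinespring_chanOfIsometry unitDil T X).trans ?_
  rw [trace_comp_conj]
  congr 2
  refine ContinuousLinearMap.ext fun z => ext_inner_left ℂ fun y => ?_
  rw [comp_apply, adjoint_inner_right]
  change inner ℂ (tmul (A := unit) (B := unit) y (1 : ℂ))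
    (tmap X (.id ℂ unit) (tmul (A := unit) (B := unit) z (1 : ℂ))) = _
  rw [tmap_tmul, inner_tmul]
  simp

theorem IsStinespring.prodDil {Λ : QChannel H K} {Λ' : QChannel H' K'}
    {Λ'' : QChannel (tensor H H') (tensor K K')} {V : H →ₗᵢ[ℂ] tensor K E}
    {V' : H' →ₗᵢ[ℂ] tensor K' E'} (h : IsStinespring Λ E V) (h' : IsStinespring Λ' E' V')
    (h'' : IsStinespring Λ'' (tensor E E') (BosonicGaussian.prodDil V V'))
    (T : TraceClass H) (S : TraceClass H') (R : TraceClass (tensor H H'))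
    (hR : op R = tmap (op T) (op S)) :
    op (Λ''.toLin R) = tmap (op (Λ.toLin T)) (op (Λ'.toLin S)) := by
  refine ext_of_trace_tmap (Subtype.property _)
    (IsTraceClass.tmap (Subtype.property _) (Subtype.property _)) fun X Y => ?_
  rw [h'', prodDil_toCLM, trace_conj_interchange _ _ R T S hR, tmap_comp,
    trace_tmap (T := X ∘L op (Λ.toLin T)) (S := Y ∘L op (Λ'.toLin S))
      (IsTraceClass.comp_left (Λ.toLin T).2 _) (IsTraceClass.comp_left (Λ'.toLin S).2 _), h, h']

/-- `QuantumCode` refers to any channel with the tensor-power property. This exhibits one for a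
channel with a dilation, so that the auxiliary channel can be applied to all `n` systems at once. -/
theorem IsStinespring.isTensorPower {Λ : QChannel H K} {V : H →ₗᵢ[ℂ] tensor K E}
    (h : IsStinespring Λ E V) (n : ℕ) : IsTensorPower Λ n (chanOfIsometry (dilIso V n)) := by
  induction n with
  | zero => exact chanOfIsometry_unitDil
  | succ n ih =>
    exact ⟨_, ih, fun T S R hR => h.prodDil (isStinespring_chanOfIsometry (dilIso V n))
      (isStinespring_chanOfIsometry (BosonicGaussian.prodDil V (dilIso V n))) T S R hR⟩

theorem IsTensorPower.comp {Λ' : QChannel K L} {Λ : QChannel H K} {n : ℕ}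
    {Λ'ₙ : QChannel (K.pow n) (L.pow n)} {Λₙ : QChannel (H.pow n) (K.pow n)}
    (h' : IsTensorPower Λ' n Λ'ₙ) (h : IsTensorPower Λ n Λₙ) :
    IsTensorPower (Λ'.comp Λ) n (Λ'ₙ.comp Λₙ) := by
  induction n with
  | zero =>
    intro T
    change Λ'ₙ.toLin (Λₙ.toLin T) = T
    exact (h' _).trans (h T)
  | succ n ih =>
    obtain ⟨A', hA', h'⟩ := h'
    obtain ⟨A, hA, h⟩ := h
    exact ⟨_, ih hA' hA, fun T S R hR => h' _ _ _ (h _ _ _ hR)⟩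

/-! ### Data processing for unassisted codes -/

/-- The receiver applies the tensor power of `Δ` before decoding. In `QuantumCode.of_precomp` the
sender applies it after encoding. -/
theorem QuantumCode.of_postcomp {Λ : QChannel H K} {Δ : QChannel K L} {W : K →ₗᵢ[ℂ] tensor L G}
    (hW : IsStinespring Δ G W) {n d : ℕ} {ε : ℝ} (h : QuantumCode (Δ.comp Λ) n d ε) :
    QuantumCode Λ n d ε := by
  obtain ⟨enc, dec, h⟩ := h
  exact ⟨enc, dec.comp (chanOfIsometry (dilIso W n)), fun Λₙ hΛ ψ hψ =>
    h _ ((hW.isTensorPower n).comp hΛ) ψ hψ⟩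

theorem QuantumCode.of_precomp {Λ : QChannel H K} {Δ : QChannel L H} {W : L →ₗᵢ[ℂ] tensor H G}
    (hW : IsStinespring Δ G W) {n d : ℕ} {ε : ℝ} (h : QuantumCode (Λ.comp Δ) n d ε) :
    QuantumCode Λ n d ε := by
  obtain ⟨enc, dec, h⟩ := h
  exact ⟨(chanOfIsometry (dilIso W n)).comp enc, dec, fun Λₙ hΛ ψ hψ =>
    h _ (hΛ.comp (hW.isTensorPower n)) ψ hψ⟩

theorem adjoint_id' : adjoint (ContinuousLinearMap.id ℂ H) = .id ℂ H :=
  ContinuousLinearMap.adjoint_id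

theorem assocL_interL (a : tensor L G) (f : F) (b : tensor L' G') (f' : E) :
    tmap (.id ℂ (tensor L L')) (interL G F G' E) (interL L (tensor G F) L' (tensor G' E)
      (tmul (assocL L G F (tmul a f)) (assocL L' G' E (tmul b f')))) =
    assocL (tensor L L') (tensor G G') (tensor F E)
      (tmul (interL L G L' G' (tmul a b)) (tmul f f')) := by
  have h := clm_ext_tmul₄ (A := L) (B := G) (C := L') (D := G')
    (f := tmap (.id ℂ (tensor L L')) (interL G F G' E) ∘L
      interL L (tensor G F) L' (tensor G' E) ∘L
      tmap (assocL L G F ∘L tmulRight _ f) (assocL L' G' E ∘L tmulRight _ f'))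
    (g := assocL (tensor L L') (tensor G G') (tensor F E) ∘L
      tmulRight _ (tmul f f') ∘L interL L G L' G')
    (fun a b c d => by simp -proj)
  have h := congrArg (fun Z => Z (tmul a b)) h
  simpa -proj using h

theorem assocL_interL_tmap (W : K →L[ℂ] tensor L G) (W' : K' →L[ℂ] tensor L' G')
    (y : tensor K F) (y' : tensor K' E) :
    tmap (.id ℂ (tensor L L')) (interL G F G' E) (interL L (tensor G F) L' (tensor G' E)
      (tmul (assocL L G F (tmap W (.id ℂ F) y)) (assocL L' G' E (tmap W' (.id ℂ E) y')))) =
    assocL (tensor L L') (tensor G G') (tensor F E)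
      (tmap (interL L G L' G' ∘L tmap W W') (.id ℂ (tensor F E))
        (interL K F K' E (tmul y y'))) := by
  have h := clm_ext_tmul₄ (A := K) (B := F) (C := K') (D := E)
    (f := tmap (.id ℂ (tensor L L')) (interL G F G' E) ∘L
      interL L (tensor G F) L' (tensor G' E) ∘L
      tmap (assocL L G F ∘L tmap W (.id ℂ F)) (assocL L' G' E ∘L tmap W' (.id ℂ E)))
    (g := assocL (tensor L L') (tensor G G') (tensor F E) ∘L
      tmap (interL L G L' G' ∘L tmap W W') (.id ℂ (tensor F E)) ∘L interL K F K' E)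
    (fun a b c d => by
      simp -proj only [comp_apply, tmap_tmul, id_apply, interL_tmul]
      exact assocL_interL _ _ _ _)
  have h := congrArg (fun Z => Z (tmul y y')) h
  simpa -proj only [comp_apply, tmap_tmul] using h

theorem interL_tmap_apply {A B C D A' B' C' D' : QSystem} (f : A →L[ℂ] A') (g : B →L[ℂ] B')
    (h : C →L[ℂ] C') (k : D →L[ℂ] D') (z : tensor (tensor A B) (tensor C D)) :
    tmap (tmap f h) (tmap g k) (interL A B C D z) =
      interL A' B' C' D' (tmap (tmap f g) (tmap h k) z) :=
  congrArg (fun Z => Z z) (interL_naturality f g h k)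

/-- Induction step for `exists_dilationPow_compDil`: the environment `G ⊗ F` of the first use is
interleaved with the environments of the remaining uses, already regrouped by `Ξ`. -/
theorem compDil_prodDil {E₁ : QSystem} (W : K →ₗᵢ[ℂ] tensor L G) (V : H →ₗᵢ[ℂ] tensor K F)
    (W' : K' →L[ℂ] tensor L' G') (V' : H' →L[ℂ] tensor K' E) (V₁ : H' →L[ℂ] tensor L' E₁)
    (Ξ : E₁ →L[ℂ] tensor G' E)
    (h : tmap (.id ℂ L') Ξ ∘L V₁ = assocL L' G' E ∘L tmap W' (.id ℂ E) ∘L V') :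
    tmap (.id ℂ (tensor L L')) (interL G F G' E ∘L tmap (.id ℂ (tensor G F)) Ξ) ∘L
        interL L (tensor G F) L' E₁ ∘L tmap (compDil W V).toContinuousLinearMap V₁ =
      assocL (tensor L L') (tensor G G') (tensor F E) ∘L
        tmap (interL L G L' G' ∘L tmap W.toContinuousLinearMap W') (.id ℂ (tensor F E)) ∘L
        interL K F K' E ∘L tmap V.toContinuousLinearMap V' := by
  refine clm_ext_tmul fun x x' => ?_
  simp -proj only [comp_apply, tmap_tmul]
  rw [← assocL_interL_tmap]
  have h1 := congrArg (fun Z => Z x') h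
  simp -proj only [comp_apply] at h1
  have h2 : tmap (.id ℂ (tensor L L')) (interL G F G' E ∘L tmap (.id ℂ (tensor G F)) Ξ) =
      tmap (.id ℂ (tensor L L')) (interL G F G' E) ∘L
        tmap (tmap (.id ℂ L) (.id ℂ L')) (tmap (.id ℂ (tensor G F)) Ξ) := by
    rw [tmap_comp, tmap_id, id_comp]
  rw [h2, comp_apply, interL_tmap_apply, tmap_tmul, h1, tmap_id]
  rfl

theorem adjoint_interL_comp_tmap {E₁ : QSystem} {Ξ : E₁ →L[ℂ] tensor G' E}
    (h : adjoint Ξ ∘L Ξ = .id ℂ _) :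
    adjoint (interL G F G' E ∘L tmap (.id ℂ (tensor G F)) Ξ) ∘L
      (interL G F G' E ∘L tmap (.id ℂ (tensor G F)) Ξ) = .id ℂ _ := by
  have h' := (norm_map_iff_adjoint_comp_self Ξ).2 h
  refine adjoint_comp_self_of_isometry _ fun x => ?_
  exact (prodDil (.id : tensor G F →ₗᵢ[ℂ] tensor G F) ⟨Ξ.toLinearMap, h'⟩).norm_map x

theorem compDil_unitDil :
    tmap (.id ℂ unit) unitDil.toContinuousLinearMap ∘L unitDil.toContinuousLinearMap =
      assocL unit unit unit ∘L tmap unitDil.toContinuousLinearMap (.id ℂ unit) ∘L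
        unitDil.toContinuousLinearMap := by
  refine ContinuousLinearMap.ext fun z => ?_
  change tmap (.id ℂ unit) unitDil.toContinuousLinearMap (tmul (A := unit) (B := unit) z (1 : ℂ)) =
    assocL unit unit unit (tmap unitDil.toContinuousLinearMap (.id ℂ unit)
      (tmul (A := unit) (B := unit) z (1 : ℂ)))
  rw [tmap_tmul, tmap_tmul]
  change _ = assocL unit unit unit (tmul (A := tensor unit unit) (B := unit)
    (tmul (A := unit) (B := unit) z (1 : ℂ)) (1 : ℂ))
  rw [assocL_tmul]
  rfl

/-- The composite dilation leaves the environment `(G ⊗ F)^n`, the two separate ones leave `G^n ⊗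
F^n`, and `Ξ` regroups the factors. An isometry is enough, because test operators are only pulled
back by `X ↦ Ξ† X Ξ`, which preserves contractions. -/
theorem exists_dilationPow_compDil (W : K →ₗᵢ[ℂ] tensor L G) (V : H →ₗᵢ[ℂ] tensor K F) (n : ℕ) :
    ∃ Ξ : (tensor G F).pow n →L[ℂ] tensor (G.pow n) (F.pow n),
      adjoint Ξ ∘L Ξ = .id ℂ _ ∧
      tmap (.id ℂ (L.pow n)) Ξ ∘L dilationPow (compDil W V) n =
        assocL (L.pow n) (G.pow n) (F.pow n) ∘L
          tmap (dilationPow W n) (.id ℂ (F.pow n)) ∘L dilationPow V n := by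
  induction n with
  | zero => exact ⟨unitDil.toContinuousLinearMap,
      adjoint_comp_self_of_isometry _ unitDil.norm_map, compDil_unitDil⟩
  | succ n ih =>
    obtain ⟨Ξ, h1, h2⟩ := ih
    exact ⟨_, adjoint_interL_comp_tmap h1, compDil_prodDil W V _ _ _ Ξ h2⟩

/-- The regrouping relation in the Heisenberg picture, for a test `Y` on the output and `P ⊗ Q` on
the two environments. Decoding uses `P = Q = 1`; secrecy puts the eavesdropper's test into one of
the two slots. -/
theorem sandwich_of_dilation {E₁ : QSystem} {V₁ : H →L[ℂ] tensor L E₁}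
    {Ξ : E₁ →L[ℂ] tensor G F} {W : K →L[ℂ] tensor L G} {V : H →L[ℂ] tensor K F}
    (h : tmap (.id ℂ L) Ξ ∘L V₁ = assocL L G F ∘L tmap W (.id ℂ F) ∘L V)
    (Y : L →L[ℂ] L) (P : G →L[ℂ] G) (Q : F →L[ℂ] F) :
    adjoint V₁ ∘L tmap Y (adjoint Ξ ∘L tmap P Q ∘L Ξ) ∘L V₁ =
      adjoint V ∘L tmap (adjoint W ∘L tmap Y P ∘L W) Q ∘L V := by
  have e1 : tmap Y (adjoint Ξ ∘L tmap P Q ∘L Ξ) =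
      adjoint (tmap (.id ℂ L) Ξ) ∘L tmap Y (tmap P Q) ∘L tmap (.id ℂ L) Ξ := by
    rw [adjoint_tmap, tmap_comp, tmap_comp, adjoint_id', id_comp, comp_id]
  have e2 : adjoint (assocL L G F) ∘L tmap Y (tmap P Q) ∘L assocL L G F =
      tmap (tmap Y P) Q := by
    rw [assocL_naturality, ← ContinuousLinearMap.comp_assoc, adjoint_assocL_comp, id_comp]
  have e3 : tmap (adjoint W ∘L tmap Y P ∘L W) Q =
      adjoint (tmap W (.id ℂ F)) ∘L tmap (tmap Y P) Q ∘L tmap W (.id ℂ F) := by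
    rw [adjoint_tmap, tmap_comp, tmap_comp, adjoint_id', id_comp, comp_id]
  calc _ = adjoint (tmap (.id ℂ L) Ξ ∘L V₁) ∘L tmap Y (tmap P Q) ∘L
        (tmap (.id ℂ L) Ξ ∘L V₁) := by
        rw [e1, adjoint_comp]
        simp -proj only [ContinuousLinearMap.comp_assoc]
    _ = _ := by
        rw [h, e3, ← e2]
        simp -proj only [adjoint_comp, ContinuousLinearMap.comp_assoc]

theorem norm_le_one_of_adjoint_comp {Ξ : H →L[ℂ] K} (h : adjoint Ξ ∘L Ξ = .id ℂ _) : ‖Ξ‖ ≤ 1 := by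
  have h1 := (norm_map_iff_adjoint_comp_self Ξ).2 h
  exact opNorm_le_bound _ zero_le_one fun x => by rw [h1, one_mul]

theorem norm_sandwich_le {Ξ : H →L[ℂ] K} (h : adjoint Ξ ∘L Ξ = .id ℂ _) {X : K →L[ℂ] K}
    (hX : ‖X‖ ≤ 1) : ‖adjoint Ξ ∘L X ∘L Ξ‖ ≤ 1 := by
  have h1 := norm_le_one_of_adjoint_comp h
  have h2 : ‖adjoint Ξ‖ ≤ 1 := by rwa [LinearIsometryEquiv.norm_map]
  calc ‖adjoint Ξ ∘L X ∘L Ξ‖ ≤ ‖adjoint Ξ‖ * ‖X ∘L Ξ‖ := opNorm_comp_le _ _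
    _ ≤ 1 * (‖X‖ * ‖Ξ‖) := by gcongr; exact opNorm_comp_le _ _
    _ ≤ 1 * (1 * 1) := by gcongr
    _ = 1 := by norm_num

theorem IsStinespring.isState {Λ : QChannel H K} {ρ : TraceClass H} (hρ : IsState ρ) :
    IsState (Λ.toLin ρ) := by
  refine ⟨isPositive_of_inner_nonneg fun x => ?_, (Λ.tracePreserving ρ).trans hρ.2⟩
  have h := Λ.completelyPositive 1 (fun _ _ => ρ)
    (fun x => by simpa using hρ.1.inner_nonneg_right (x 0)) (fun _ => x)
  simpa using h

/-- The measurement is pulled back through the tensor power of `W`. The environment of `Λ` is a part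
of the environment of the composite, so a test `X` on it is also available there, as `1 ⊗ X`. -/
theorem PrivateCode.of_postcomp {Λ : QChannel H K} {Δ : QChannel K L} {W : K →ₗᵢ[ℂ] tensor L G}
    (hW : IsStinespring Δ G W) {n d : ℕ} {ε : ℝ} (h : PrivateCode (Δ.comp Λ) n d ε) :
    PrivateCode Λ n d ε := by
  obtain ⟨ρ, D, hρ, hD, hsum, h⟩ := h
  have hWW := adjoint_dilationPow_comp W n
  refine ⟨ρ, fun m => adjoint (dilationPow W n) ∘L tmap (D m) (.id ℂ _) ∘L dilationPow W n, hρ,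
    fun m => (IsPositive.tmap_id (hD m) _).adjoint_conj _, ?_, fun E V hV => ?_⟩
  · have e : ∑ m, adjoint (dilationPow W n) ∘L tmap (D m) (.id ℂ _) ∘L dilationPow W n =
        adjoint (dilationPow W n) ∘L tmap (∑ m, D m) (.id ℂ _) ∘L dilationPow W n := by
      ext x
      rw [tmap_sum_left]
      simp -proj [sum_apply]
    rw [e, hsum, tmap_id, id_comp, hWW]
  · obtain ⟨Ξ, hΞ, hdil⟩ := exists_dilationPow_compDil W V n
    obtain ⟨h1, h2⟩ := h _ _ (hW.comp hV)
    have key := sandwich_of_dilation hdil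
    refine ⟨fun m => (h1 m).trans_eq ?_, fun m m' X hX => ?_⟩
    · rw [trace_comp_conj, trace_comp_conj, ← key, tmap_id, id_comp, hΞ]
    · have h3 := h2 m m' (adjoint Ξ ∘L tmap (.id ℂ _) X ∘L Ξ) (norm_sandwich_le hΞ
        ((norm_tmap_le _ _).trans (mul_le_one₀ norm_id_le (norm_nonneg _) hX)))
      rw [trace_comp_conj, trace_comp_conj, key, tmap_id, id_comp, hWW] at h3
      rwa [trace_comp_conj, trace_comp_conj]

/-- The code states are sent through the tensor power of `Δ` and the measurement is kept; the
environment `G` of `Δ` stays with the sender, and tests extend as `X ⊗ 1`. -/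
theorem PrivateCode.of_precomp {Λ : QChannel H K} {Δ : QChannel L H} {W : L →ₗᵢ[ℂ] tensor H G}
    (hW : IsStinespring Δ G W) {n d : ℕ} {ε : ℝ} (h : PrivateCode (Λ.comp Δ) n d ε) :
    PrivateCode Λ n d ε := by
  obtain ⟨ρ, D, hρ, hD, hsum, h⟩ := h
  refine ⟨fun m => (chanOfIsometry (dilIso W n)).toLin (ρ m), D,
    fun m => IsStinespring.isState (hρ m), hD, hsum, fun E V hV => ?_⟩
  obtain ⟨Ξ, hΞ, hdil⟩ := exists_dilationPow_compDil V W n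
  obtain ⟨h1, h2⟩ := h _ _ (hV.comp hW)
  have key := sandwich_of_dilation hdil
  have e : ∀ (Z : tensor (K.pow n) (E.pow n) →L[ℂ] tensor (K.pow n) (E.pow n)) m,
      trace (Z ∘L conj (dilationPow V n) ((chanOfIsometry (dilIso W n)).toLin (ρ m))) =
      trace ((adjoint (dilationPow W n) ∘L
        tmap (adjoint (dilationPow V n) ∘L Z ∘L dilationPow V n) (.id ℂ _) ∘L
        dilationPow W n) ∘L op (ρ m)) := fun Z m => by
    rw [trace_comp_conj, isStinespring_chanOfIsometry, trace_comp_conj, toCLM_dilIso]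
  refine ⟨fun m => (h1 m).trans_eq ?_, fun m m' X hX => ?_⟩
  · rw [e, trace_comp_conj, ← key, tmap_id, id_comp, hΞ]
  · have h3 := h2 m m' (adjoint Ξ ∘L tmap X (.id ℂ _) ∘L Ξ) (norm_sandwich_le hΞ
      ((norm_tmap_le _ _).trans (mul_le_one₀ hX (norm_nonneg _) norm_id_le)))
    rw [trace_comp_conj, trace_comp_conj, key] at h3
    rwa [e, e]

end Powers

end BosonicGaussian

end

noncomputable section

namespace BosonicGaussian

open QSystem ContinuousLinearMap InnerProductSpace

/-! ### Simulation of two-way assisted protocols -/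

section Simulation

variable {H₁ K₁ F₁ H₂ K₂ F₂ : QSystem} {α β : Type}

theorem norm_tmap_isometry_comp {A A' H K : QSystem} {B : β → H →L[ℂ] K} (hB : IsKraus B)
    (U : A →ₗᵢ[ℂ] tensor A' H) (x : A) :
    ∑' j, ‖(tmap (.id ℂ A') (B j) ∘L U.toContinuousLinearMap) x‖ₑ ^ 2 = ‖x‖ₑ ^ 2 := by
  have h := hB.id_tmap A' (U x)
  rw [U.enorm_map] at h
  exact h

/-- The protocol in which every use of a channel is replaced by a use of another channel, with
local Kraus measurements before and after it. -/
def Protocol.simulate {d : ℕ} (M : α → K₂ →L[ℂ] K₁) (N : β → H₁ →L[ℂ] H₂) (hM : IsKraus M)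
    (hN : IsKraus N) : {n : ℕ} → {A B : QSystem} → Protocol H₁ K₁ d n A B → Protocol H₂ K₂ d n A B
  | _, _, _, .finish A' B' U W hU hW => .finish A' B' U W hU hW
  | _, _, _, .alice ι A' L hL next => .alice ι A' L hL fun k => (next k).simulate M N hM hN
  | _, _, _, .bob ι B' L hL next => .bob ι B' L hL fun k => (next k).simulate M N hM hN
  -- Alice splits off the input with `U` and measures it in the same step. Her laboratory is then
  -- already of the form `A' ⊗ H₂`, so the use itself splits with the identity, and Bob measures the
  -- received system.
  | _, _, B, .use A' U next =>
      .alice β (fun _ => tensor A' H₂)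
        (fun j => tmap (.id ℂ A') (N j) ∘L U.toContinuousLinearMap)
        (fun x => (hasSum_norm_sq_iff _ x).2 (norm_tmap_isometry_comp hN U x))
        fun _ => .use A' .id <|
          .bob α (fun _ => tensor K₁ B) (fun k => tmap (M k) (.id ℂ B))
            (fun x => (hasSum_norm_sq_iff _ x).2 (hM.tmap_id B x))
            fun _ => next.simulate M N hM hN

theorem useVector_eq {H K F A A' B E : QSystem} (V : H →ₗᵢ[ℂ] tensor K F)
    (U : A →ₗᵢ[ℂ] tensor A' H) (ψ : tensor A (tensor B E)) :
    useVector V U ψ = tmap (.id ℂ A') (interL K F B E) (assocL A' (tensor K F) (tensor B E)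
      (tmap (tmap (.id ℂ A') V.toContinuousLinearMap ∘L U.toContinuousLinearMap)
        (.id ℂ (tensor B E)) ψ)) := rfl

theorem assocL_tmap_apply {A B C A' B' C' : QSystem} (f : A →L[ℂ] A') (g : B →L[ℂ] B')
    (h : C →L[ℂ] C') (z : tensor (tensor A B) C) :
    tmap f (tmap g h) (assocL A B C z) = assocL A' B' C' (tmap (tmap f g) h z) := by
  have := assocL_naturality f g h
  exact congrFun (congrArg DFunLike.coe this) z

/-- By `h`, a use of `V₂` between two measurement outcomes is a use of `V₁` followed by `R` on the
new environment. The rest is naturality of the rearrangements, with `S` acting on the environment of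
earlier uses. -/
theorem useVector_simulate {A A' B E₁ E₂ : QSystem} {V₁ : H₁ →ₗᵢ[ℂ] tensor K₁ F₁}
    {V₂ : H₂ →ₗᵢ[ℂ] tensor K₂ F₂} {M : K₂ →L[ℂ] K₁} {N : H₁ →L[ℂ] H₂} {R : F₁ →L[ℂ] F₂}
    (h : tmap (.id ℂ K₁) R ∘L V₁.toContinuousLinearMap =
      tmap M (.id ℂ F₂) ∘L V₂.toContinuousLinearMap ∘L N)
    (S : E₁ →L[ℂ] E₂) (U : A →ₗᵢ[ℂ] tensor A' H₁) (ψ : tensor A (tensor B E₁)) :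
    tmap (.id ℂ A') (tmap (tmap M (.id ℂ B)) (.id ℂ (tensor F₂ E₂)))
      (useVector V₂ (.id : tensor A' H₂ →ₗᵢ[ℂ] tensor A' H₂)
        (tmap (tmap (.id ℂ A') N ∘L U.toContinuousLinearMap) (.id ℂ (tensor B E₂))
          (tmap (.id ℂ A) (tmap (.id ℂ B) S) ψ))) =
    tmap (.id ℂ A') (tmap (.id ℂ (tensor K₁ B)) (tmap R S)) (useVector V₁ U ψ) := by
  have n1 : tmap (tmap M (.id ℂ B)) (.id ℂ (tensor F₂ E₂)) ∘L interL K₂ F₂ B E₂ =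
      interL K₁ F₂ B E₂ ∘L tmap (tmap M (.id ℂ F₂)) (.id ℂ (tensor B E₂)) := by
    rw [← tmap_id, interL_naturality, tmap_id]
  have n2 : tmap (.id ℂ (tensor K₁ B)) (tmap R S) ∘L interL K₁ F₁ B E₁ =
      interL K₁ F₂ B E₂ ∘L tmap (tmap (.id ℂ K₁) R) (tmap (.id ℂ B) S) := by
    rw [← tmap_id, interL_naturality]
  have a1 : ∀ z, tmap (.id ℂ A') (tmap (tmap M (.id ℂ F₂)) (.id ℂ (tensor B E₂)))
      (assocL A' (tensor K₂ F₂) (tensor B E₂) z) = assocL A' (tensor K₁ F₂) (tensor B E₂)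
        (tmap (tmap (.id ℂ A') (tmap M (.id ℂ F₂))) (.id ℂ (tensor B E₂)) z) := fun z =>
    assocL_tmap_apply _ _ _ z
  have a2 : ∀ z, tmap (.id ℂ A') (tmap (tmap (.id ℂ K₁) R) (tmap (.id ℂ B) S))
      (assocL A' (tensor K₁ F₁) (tensor B E₁) z) = assocL A' (tensor K₁ F₂) (tensor B E₂)
        (tmap (tmap (.id ℂ A') (tmap (.id ℂ K₁) R)) (tmap (.id ℂ B) S) z) := fun z =>
    assocL_tmap_apply _ _ _ z
  have b1 : ∀ z, tmap (.id ℂ A') (tmap (tmap M (.id ℂ B)) (.id ℂ (tensor F₂ E₂)))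
      (tmap (.id ℂ A') (interL K₂ F₂ B E₂) z) = tmap (.id ℂ A') (interL K₁ F₂ B E₂)
        (tmap (.id ℂ A') (tmap (tmap M (.id ℂ F₂)) (.id ℂ (tensor B E₂))) z) := fun z => by
    rw [tmap_tmap, n1, tmap_tmap]
  have b2 : ∀ z, tmap (.id ℂ A') (tmap (.id ℂ (tensor K₁ B)) (tmap R S))
      (tmap (.id ℂ A') (interL K₁ F₁ B E₁) z) = tmap (.id ℂ A') (interL K₁ F₂ B E₂)
        (tmap (.id ℂ A') (tmap (tmap (.id ℂ K₁) R) (tmap (.id ℂ B) S)) z) := fun z => by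
    rw [tmap_tmap, n2, tmap_tmap]
  rw [useVector_eq, useVector_eq, b1, b2, a1, a2]
  have hl : tmap (.id ℂ A') (tmap M (.id ℂ F₂)) ∘L (tmap (.id ℂ A') V₂.toContinuousLinearMap ∘L
      (LinearIsometry.id : tensor A' H₂ →ₗᵢ[ℂ] tensor A' H₂).toContinuousLinearMap) ∘L
      (tmap (.id ℂ A') N ∘L U.toContinuousLinearMap) =
      tmap (.id ℂ A') (tmap (.id ℂ K₁) R) ∘L
        (tmap (.id ℂ A') V₁.toContinuousLinearMap ∘L U.toContinuousLinearMap) := by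
    rw [show (LinearIsometry.id : tensor A' H₂ →ₗᵢ[ℂ] tensor A' H₂).toContinuousLinearMap =
      .id ℂ _ from rfl, comp_id, ← ContinuousLinearMap.comp_assoc, ← ContinuousLinearMap.comp_assoc,
      ← ContinuousLinearMap.comp_assoc, tmap_comp, tmap_comp, tmap_comp, id_comp, h, id_comp,
      ContinuousLinearMap.comp_assoc]
  rw [tmap_tmap, tmap_tmap, tmap_tmap, tmap_tmap, comp_id, id_comp, id_comp, id_comp, comp_id,
    ContinuousLinearMap.comp_assoc, hl]

theorem tsum_tsum_tsum_eq {σ : Type} (f : α → β → σ → ℝ≥0∞) :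
    ∑' s, ∑' j, ∑' k, f k j s = ∑' p : (α × β) × σ, f p.1.1 p.1.2 p.2 := by
  symm
  rw [ENNReal.tsum_prod (f := fun (p : α × β) (s : σ) => f p.1 p.2 s), ENNReal.tsum_comm]
  refine tsum_congr fun s => ?_
  rw [ENNReal.tsum_prod (f := fun k j => f k j s), ENNReal.tsum_comm]

theorem ofReal_norm_sq_div (H : QSystem) (x : H) (d : ℕ) :
    ENNReal.ofReal (‖x‖ ^ 2 / d) = ‖x‖ₑ ^ 2 * ENNReal.ofReal (d : ℝ)⁻¹ := by
  rw [div_eq_mul_inv, ENNReal.ofReal_mul (by positivity), ENNReal.ofReal_pow (norm_nonneg _),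
    ofReal_norm]

/-- The Kraus family `S` on the environment records the simulated outcomes so far, and a use
replaces it by the products of `R` and `S`. The final overlap does not touch the environment, so
summing over the record restores the full norm. -/
theorem Protocol.tsum_fidelity_simulate {d : ℕ} {V₁ : H₁ →ₗᵢ[ℂ] tensor K₁ F₁}
    {V₂ : H₂ →ₗᵢ[ℂ] tensor K₂ F₂} {M : α → K₂ →L[ℂ] K₁} {N : β → H₁ →L[ℂ] H₂}
    {R : α × β → F₁ →L[ℂ] F₂} (hM : IsKraus M) (hN : IsKraus N) (hR : IsKraus R)
    (h : ∀ p, tmap (.id ℂ K₁) (R p) ∘L V₁.toContinuousLinearMap =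
      tmap (M p.1) (.id ℂ F₂) ∘L V₂.toContinuousLinearMap ∘L N p.2)
    {n : ℕ} {A B : QSystem} (P : Protocol H₁ K₁ d n A B) {σ : Type} {E₁ E₂ : QSystem}
    (S : σ → E₁ →L[ℂ] E₂) (hS : IsKraus S) (ψ : tensor A (tensor B E₁)) :
    ∑' s, (P.simulate M N hM hN).fidelity V₂ E₂ (tmap (.id ℂ A) (tmap (.id ℂ B) (S s)) ψ) =
      P.fidelity V₁ E₁ ψ := by
  induction P generalizing σ E₁ E₂ with
  | finish A' B' U W hU hW =>
    simp -proj only [simulate, fidelity, ofReal_norm_sq_div]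
    rw [ENNReal.tsum_mul_right]
    congr 1
    rw [← (hS.id_tmap B').id_tmap A']
    refine tsum_congr fun s => ?_
    change _ = ‖tmap (.id ℂ A') (tmap (.id ℂ B') (S s))
      (∑ i, tmap (U i) (tmap (W i) (.id ℂ _)) ψ)‖ₑ ^ 2
    rw [map_sum]
    congr 2
    refine Finset.sum_congr rfl fun i _ => ?_
    simp -proj only [tmap_tmap, tmap_comp, comp_id, id_comp]
  | alice ι A' L hL next ih =>
    simp -proj only [simulate, fidelity]
    rw [ENNReal.tsum_comm]
    refine tsum_congr fun k => ?_
    rw [← ih k S hS]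
    refine tsum_congr fun s => ?_
    rw [tmap_tmap, tmap_tmap, comp_id, id_comp, comp_id, id_comp]
  | bob ι B' L hL next ih =>
    simp -proj only [simulate, fidelity]
    rw [ENNReal.tsum_comm]
    refine tsum_congr fun k => ?_
    rw [← ih k S hS]
    refine tsum_congr fun s => ?_
    simp -proj only [tmap_tmap, tmap_comp, comp_id, id_comp]
  | use A' U next ih =>
    simp -proj only [simulate, fidelity]
    rw [← ih (fun p : (α × β) × σ => tmap (R p.1) (S p.2)) (hR.tmap hS)]
    refine Eq.trans ?_ (tsum_tsum_tsum_eq fun k j s =>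
      (next.simulate M N hM hN).fidelity V₂ (tensor F₂ _)
        (tmap (.id ℂ _) (tmap (.id ℂ _) (tmap (R (k, j)) (S s))) (useVector V₁ U ψ)))
    refine tsum_congr fun s => tsum_congr fun j => tsum_congr fun k => ?_
    rw [← useVector_simulate (h (k, j))]

/-! ### Pinching and the key error -/

/-- Operators with orthogonal isometric adjoints: `Rₛ Rₜ† = δₛₜ`. -/
def IsCoisometric {σ : Type} {E F : QSystem} (R : σ → E →L[ℂ] F) : Prop :=
  ∀ s t, (s = t → R s ∘L adjoint (R t) = .id ℂ F) ∧ (s ≠ t → R s ∘L adjoint (R t) = 0)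

theorem IsCoisometric.tmap {σ τ : Type} {E F E' F' : QSystem} {R : σ → E →L[ℂ] F}
    {S : τ → E' →L[ℂ] F'} (hR : IsCoisometric R) (hS : IsCoisometric S) :
    IsCoisometric fun p : σ × τ => QSystem.tmap (R p.1) (S p.2) := by
  rintro ⟨s, t⟩ ⟨s', t'⟩
  simp -proj only [adjoint_tmap, tmap_comp]
  constructor
  · rintro h
    obtain ⟨rfl, rfl⟩ := Prod.mk.inj h
    rw [(hR s s).1 rfl, (hS t t).1 rfl, tmap_id]
  · intro h
    by_cases hs : s = s'
    · have ht : t ≠ t' := fun ht => h (by rw [hs, ht])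
      rw [(hS t t').2 ht, tmap_zero_right]
    · rw [(hR s s').2 hs, tmap_zero_left]

/-- Choices for different indices are independent, so the suprema are pulled out one at a time; in
the induction the constant `c` collects the terms already fixed. -/
theorem sum_iSup_le {σ X : Type} [Nonempty X] (g : σ → X → ℝ≥0∞) (t : Finset σ) (Z : ℝ≥0∞)
    (h : ∀ x : σ → X, ∑ s ∈ t, g s (x s) ≤ Z) : ∑ s ∈ t, ⨆ x, g s x ≤ Z := by
  classical
  suffices H : ∀ (t : Finset σ) (c : ℝ≥0∞), (∀ x : σ → X, c + ∑ s ∈ t, g s (x s) ≤ Z) →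
      c + ∑ s ∈ t, ⨆ x, g s x ≤ Z by
    simpa using H t 0 (by simpa using h)
  intro t
  induction t using Finset.induction_on with
  | empty =>
    intro c hc
    simpa using hc fun _ => Classical.arbitrary X
  | insert a t ha ih =>
    intro c hc
    rw [Finset.sum_insert ha, ← add_assoc, ENNReal.add_iSup, ENNReal.iSup_add]
    refine iSup_le fun x => ih _ fun y => ?_
    have := hc (Function.update y a x)
    rw [Finset.sum_insert ha, Function.update_self, ← add_assoc] at this
    refine le_of_eq_of_le ?_ this
    congr 1
    refine Finset.sum_congr rfl fun s hs => ?_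
    rw [Function.update_of_ne (ne_of_mem_of_not_mem hs ha)]

/-- A block-diagonal operator with contractive blocks is a contraction: the outputs of different
blocks are orthogonal, and the Kraus identity controls the inputs. -/
theorem IsCoisometric.norm_sum_le {σ : Type} {E F : QSystem} {R : σ → E →L[ℂ] F}
    (hR : IsCoisometric R) (hK : IsKraus R) (t : Finset σ) (X : σ → F →L[ℂ] F)
    (hX : ∀ s, ‖X s‖ ≤ 1) : ‖∑ s ∈ t, adjoint (R s) ∘L X s ∘L R s‖ ≤ 1 := by
  classical
  refine opNorm_le_bound _ zero_le_one fun x => ?_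
  rw [one_mul]
  refine le_of_sq_le_sq ?_ (norm_nonneg _)
  have e : ‖∑ s ∈ t, adjoint (R s) (X s (R s x))‖ ^ 2 = ∑ s ∈ t, ‖X s (R s x)‖ ^ 2 := by
    have h1 : ∀ s s' (y y' : F), inner ℂ (adjoint (R s) y) (adjoint (R s') y') =
        if s = s' then inner ℂ y y' else 0 := fun s s' y y' => by
      rw [adjoint_inner_left]
      change inner ℂ y ((R s ∘L adjoint (R s')) y') = _
      split_ifs with h
      · rw [(hR s s').1 h]; rfl
      · rw [(hR s s').2 h]; simp
    have h2 : inner ℂ (∑ s ∈ t, adjoint (R s) (X s (R s x)))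
        (∑ s ∈ t, adjoint (R s) (X s (R s x))) =
        ((∑ s ∈ t, ‖X s (R s x)‖ ^ 2 : ℝ) : ℂ) := by
      simp_rw [sum_inner, inner_sum, h1]
      push_cast
      refine Finset.sum_congr rfl fun s hs => ?_
      rw [Finset.sum_ite_eq, if_pos hs, inner_self_eq_norm_sq_to_K]
      rfl
    rw [inner_self_eq_norm_sq_to_K] at h2
    refine Complex.ofReal_injective (Eq.trans ?_ h2)
    exact Complex.ofReal_pow _ _
  rw [sum_apply]
  simp only [comp_apply]
  rw [e]
  refine le_trans (Finset.sum_le_sum fun s _ => ?_)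
    (sum_le_hasSum t (fun s _ => sq_nonneg _) (hK.hasSum x))
  gcongr
  exact (le_of_opNorm_le _ (hX s) _).trans_eq (one_mul _)

/-- Pinching does not increase the trace norm, in dual form: contractive tests of the separate
blocks assemble into one contractive test of `E`. -/
theorem IsCoisometric.tsum_iSup_le {σ : Type} {E F : QSystem} {R : σ → E →L[ℂ] F}
    (hR : IsCoisometric R) (hK : IsKraus R) (c : (E →L[ℂ] E) →ₗ[ℂ] ℂ) :
    ∑' s, ⨆ (X : F →L[ℂ] F) (_ : ‖X‖ ≤ 1), ENNReal.ofReal ‖c (adjoint (R s) ∘L X ∘L R s)‖ ≤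
      ⨆ (X : E →L[ℂ] E) (_ : ‖X‖ ≤ 1), ENNReal.ofReal ‖c X‖ := by
  rw [ENNReal.tsum_eq_iSup_sum]
  refine iSup_le fun t => ?_
  have e : ∀ s, (⨆ (X : F →L[ℂ] F) (_ : ‖X‖ ≤ 1),
      ENNReal.ofReal ‖c (adjoint (R s) ∘L X ∘L R s)‖) =
      ⨆ X : {X : F →L[ℂ] F // ‖X‖ ≤ 1}, ENNReal.ofReal ‖c (adjoint (R s) ∘L X.1 ∘L R s)‖ :=
    fun s => iSup_subtype'
  simp_rw [e]
  have : Nonempty {X : F →L[ℂ] F // ‖X‖ ≤ 1} := ⟨⟨0, by simp⟩⟩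
  refine sum_iSup_le _ t _ fun X => ?_
  -- Phases make every term a nonnegative real, so that the sum of the norms is one value of `c`.
  choose ζ hζ hζ' using fun s => RCLike.exists_norm_eq_mul_self (K := ℂ)
    (c (adjoint (R s) ∘L (X s).1 ∘L R s))
  have hle := hR.norm_sum_le hK t (fun s => ζ s • (X s).1) fun s => by
    rw [norm_smul, hζ, one_mul]; exact (X s).2
  refine le_iSup₂_of_le _ hle ?_
  rw [← ENNReal.ofReal_sum_of_nonneg fun s _ => norm_nonneg _]
  refine ENNReal.ofReal_le_ofReal ?_
  rw [map_sum]
  have e2 : ∀ s, c (adjoint (R s) ∘L (ζ s • (X s).1) ∘L R s) =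
      (‖c (adjoint (R s) ∘L (X s).1 ∘L R s)‖ : ℂ) := fun s => by
    rw [smul_comp, comp_smul, map_smul, smul_eq_mul]
    exact (hζ' s).symm
  simp_rw [e2]
  rw [← Complex.ofReal_sum, Complex.norm_real]
  exact le_abs_self _

/-- The functional that defines one term of the key error. -/
def keyFunctional {A B A' B' E : QSystem} (χ : tensor A' (tensor B' E)) (ψ : tensor A (tensor B E))
    (w : ℂ) : (E →L[ℂ] E) →ₗ[ℂ] ℂ where
  toFun X := inner ℂ χ (tmap (.id ℂ A') (tmap (.id ℂ B') X) χ) -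
    w * inner ℂ ψ (tmap (.id ℂ A) (tmap (.id ℂ B) X) ψ)
  map_add' X Y := by
    simp -proj only [tmap_add_right, add_apply, inner_add_right]
    ring
  map_smul' c X := by
    simp -proj only [tmap_smul_right, smul_apply, inner_smul_right, RingHom.id_apply, smul_eq_mul]
    ring

theorem keyFunctional_apply {A B A' B' E : QSystem} (χ : tensor A' (tensor B' E))
    (ψ : tensor A (tensor B E)) (w : ℂ) (X : E →L[ℂ] E) :
    keyFunctional χ ψ w X = inner ℂ χ (tmap (.id ℂ A') (tmap (.id ℂ B') X) χ) -
      w * inner ℂ ψ (tmap (.id ℂ A) (tmap (.id ℂ B) X) ψ) := rfl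

theorem inner_tmap_sandwich {A B E₁ E₂ : QSystem} (S : E₁ →L[ℂ] E₂) (X : E₂ →L[ℂ] E₂)
    (χ : tensor A (tensor B E₁)) :
    inner ℂ (tmap (.id ℂ A) (tmap (.id ℂ B) S) χ) (tmap (.id ℂ A) (tmap (.id ℂ B) X)
      (tmap (.id ℂ A) (tmap (.id ℂ B) S) χ)) =
    inner ℂ χ (tmap (.id ℂ A) (tmap (.id ℂ B) (adjoint S ∘L X ∘L S)) χ) := by
  rw [← adjoint_inner_right, adjoint_tmap, adjoint_tmap, adjoint_id', adjoint_id', tmap_tmap,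
    tmap_tmap]
  simp -proj only [id_comp, tmap_comp, ContinuousLinearMap.comp_assoc]

/-- Here the eavesdropper does hold the environment, which the simulation splits into announced,
mutually orthogonal outcomes. Only an inequality survives, by the pinching bound applied to the
functional of each pair of keys. -/
theorem Protocol.tsum_keyError_simulate_le {d : ℕ} {V₁ : H₁ →ₗᵢ[ℂ] tensor K₁ F₁}
    {V₂ : H₂ →ₗᵢ[ℂ] tensor K₂ F₂} {M : α → K₂ →L[ℂ] K₁} {N : β → H₁ →L[ℂ] H₂}
    {R : α × β → F₁ →L[ℂ] F₂} (hM : IsKraus M) (hN : IsKraus N) (hR : IsKraus R)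
    (hR' : IsCoisometric R)
    (h : ∀ p, tmap (.id ℂ K₁) (R p) ∘L V₁.toContinuousLinearMap =
      tmap (M p.1) (.id ℂ F₂) ∘L V₂.toContinuousLinearMap ∘L N p.2)
    {n : ℕ} {A B : QSystem} (P : Protocol H₁ K₁ d n A B) {σ : Type} {E₁ E₂ : QSystem}
    (S : σ → E₁ →L[ℂ] E₂) (hS : IsKraus S) (hS' : IsCoisometric S) (ψ : tensor A (tensor B E₁)) :
    ∑' s, (P.simulate M N hM hN).keyError V₂ E₂ (tmap (.id ℂ A) (tmap (.id ℂ B) (S s)) ψ) ≤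
      P.keyError V₁ E₁ ψ := by
  induction P generalizing σ E₁ E₂ with
  | finish A' B' U W hU hW =>
    simp -proj only [simulate, keyError]
    rw [Summable.tsum_finsetSum fun _ _ => ENNReal.summable]
    refine Finset.sum_le_sum fun i _ => ?_
    rw [Summable.tsum_finsetSum fun _ _ => ENNReal.summable]
    refine Finset.sum_le_sum fun j _ => ?_
    have e : ∀ {E : QSystem} (X : E →L[ℂ] E) (φ : tensor _ (tensor _ E)),
        (inner ℂ (tmap (U i) (tmap (W j) (.id ℂ E)) φ)
            (tmap (.id ℂ A') (tmap (.id ℂ B') X) (tmap (U i) (tmap (W j) (.id ℂ E)) φ)) -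
          if i = j then inner ℂ φ (tmap (.id ℂ _) (tmap (.id ℂ _) X) φ) / (d : ℂ) else 0) =
        keyFunctional (tmap (U i) (tmap (W j) (.id ℂ E)) φ) φ (if i = j then (d : ℂ)⁻¹ else 0) X :=
      fun X φ => by
        rw [keyFunctional_apply]
        split_ifs
        · rw [div_eq_inv_mul]
        · rw [zero_mul]
    have e2 : ∀ s, tmap (U i) (tmap (W j) (.id ℂ E₂)) (tmap (.id ℂ _) (tmap (.id ℂ _) (S s)) ψ) =
        tmap (.id ℂ A') (tmap (.id ℂ B') (S s)) (tmap (U i) (tmap (W j) (.id ℂ E₁)) ψ) :=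
      fun s => by simp -proj only [tmap_tmap, tmap_comp, comp_id, id_comp]
    simp -proj only [e]
    refine le_of_eq_of_le ?_ (hS'.tsum_iSup_le hS _)
    refine tsum_congr fun s => iSup_congr fun X => iSup_congr fun _ => ?_
    rw [e2]
    rw [keyFunctional_apply, keyFunctional_apply, inner_tmap_sandwich, inner_tmap_sandwich]
  | alice ι A' L hL next ih =>
    simp -proj only [simulate, keyError]
    rw [ENNReal.tsum_comm]
    refine ENNReal.tsum_le_tsum fun k => ?_
    refine le_of_eq_of_le ?_ (ih k S hS hS' _)
    refine tsum_congr fun s => ?_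
    rw [tmap_tmap, tmap_tmap, comp_id, id_comp, comp_id, id_comp]
  | bob ι B' L hL next ih =>
    simp -proj only [simulate, keyError]
    rw [ENNReal.tsum_comm]
    refine ENNReal.tsum_le_tsum fun k => ?_
    refine le_of_eq_of_le ?_ (ih k S hS hS' _)
    refine tsum_congr fun s => ?_
    simp -proj only [tmap_tmap, tmap_comp, comp_id, id_comp]
  | use A' U next ih =>
    simp -proj only [simulate, keyError]
    refine le_of_eq_of_le ?_ (ih (fun p : (α × β) × σ => tmap (R p.1) (S p.2)) (hR.tmap hS)
      (hR'.tmap hS') _)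
    refine Eq.trans ?_ (tsum_tsum_tsum_eq fun k j s =>
      (next.simulate M N hM hN).keyError V₂ (tensor F₂ _)
        (tmap (.id ℂ _) (tmap (.id ℂ _) (tmap (R (k, j)) (S s))) (useVector V₁ U ψ)))
    refine tsum_congr fun s => tsum_congr fun j => tsum_congr fun k => ?_
    rw [← useVector_simulate (h (k, j))]

/-- A dilation `V₁` is simulated by `V₂` with Kraus families before and after it. -/
structure Simulates (V₂ : H₂ →ₗᵢ[ℂ] tensor K₂ F₂) (V₁ : H₁ →ₗᵢ[ℂ] tensor K₁ F₁)
    (M : α → K₂ →L[ℂ] K₁) (N : β → H₁ →L[ℂ] H₂) : Prop where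
  exists_env : ∃ R : α × β → F₁ →L[ℂ] F₂, IsKraus R ∧ IsCoisometric R ∧
    ∀ p, tmap (.id ℂ K₁) (R p) ∘L V₁.toContinuousLinearMap =
      tmap (M p.1) (.id ℂ F₂) ∘L V₂.toContinuousLinearMap ∘L N p.2

theorem Simulates.fidelity_eq {V₂ : H₂ →ₗᵢ[ℂ] tensor K₂ F₂} {V₁ : H₁ →ₗᵢ[ℂ] tensor K₁ F₁}
    {M : α → K₂ →L[ℂ] K₁} {N : β → H₁ →L[ℂ] H₂} (h : Simulates V₂ V₁ M N) (hM : IsKraus M)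
    (hN : IsKraus N) {d n : ℕ} (P : Protocol H₁ K₁ d n unit unit) :
    (P.simulate M N hM hN).fidelity V₂ unit initialVector = P.fidelity V₁ unit initialVector := by
  obtain ⟨R, hR, -, h⟩ := h.exists_env
  have := P.tsum_fidelity_simulate hM hN hR h (fun _ : Unit => .id ℂ unit)
    (isKraus_of_isometry fun _ => rfl) initialVector
  rw [tsum_eq_single () (by simp), tmap_id, tmap_id] at this
  exact this

theorem Simulates.keyError_le {V₂ : H₂ →ₗᵢ[ℂ] tensor K₂ F₂} {V₁ : H₁ →ₗᵢ[ℂ] tensor K₁ F₁}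
    {M : α → K₂ →L[ℂ] K₁} {N : β → H₁ →L[ℂ] H₂} (h : Simulates V₂ V₁ M N) (hM : IsKraus M)
    (hN : IsKraus N) {d n : ℕ} (P : Protocol H₁ K₁ d n unit unit) :
    (P.simulate M N hM hN).keyError V₂ unit initialVector ≤ P.keyError V₁ unit initialVector := by
  obtain ⟨R, hR, hR', h⟩ := h.exists_env
  have := P.tsum_keyError_simulate_le hM hN hR hR' h (fun _ : Unit => .id ℂ unit)
    (isKraus_of_isometry fun _ => rfl)
    (fun s t => ⟨fun _ => by rw [adjoint_id', id_comp], fun h => absurd rfl h⟩) initialVector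
  rw [tsum_eq_single () (by simp), tmap_id, tmap_id] at this
  exact this

/-! ### Data processing for two-way assisted codes -/

variable {G : QSystem}

theorem isCoisometric_sliceL {κ : Type} (g : HilbertBasis κ ℂ G) (F : QSystem) :
    IsCoisometric fun k => sliceL F (g k) := by
  classical
  intro s t
  have h : ∀ f, (sliceL F (g s) ∘L adjoint (sliceL F (g t))) f = inner ℂ (g s) (g t) • f := by
    intro f
    rw [adjoint_sliceL, comp_apply, tmulLeft_apply, sliceL_tmul]
  constructor
  · rintro rfl
    ext f
    rw [h, orthonormal_iff_ite.1 g.orthonormal, if_pos rfl, one_smul]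
    rfl
  · intro hst
    ext f
    rw [h, orthonormal_iff_ite.1 g.orthonormal, if_neg hst, zero_smul]
    rfl

theorem isCoisometric_sliceR {κ : Type} (g : HilbertBasis κ ℂ G) (F : QSystem) :
    IsCoisometric fun k => sliceR F (g k) := by
  classical
  intro s t
  have h : ∀ f, (sliceR F (g s) ∘L adjoint (sliceR F (g t))) f = inner ℂ (g s) (g t) • f := by
    intro f
    rw [adjoint_sliceR, comp_apply, tmulRight_apply, sliceR_tmul]
  constructor
  · rintro rfl
    ext f
    rw [h, orthonormal_iff_ite.1 g.orthonormal, if_pos rfl, one_smul]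
    rfl
  · intro hst
    ext f
    rw [h, orthonormal_iff_ite.1 g.orthonormal, if_neg hst, zero_smul]
    rfl

theorem IsKraus.slice_isometry {H K : QSystem} {κ : Type} (W : H →ₗᵢ[ℂ] tensor K G)
    (g : HilbertBasis κ ℂ G) : IsKraus fun k => sliceR K (g k) ∘L W.toContinuousLinearMap := by
  intro x
  have h := isKraus_sliceR (A := K) g (W x)
  rw [W.enorm_map] at h
  exact h

theorem IsKraus.unit {H : QSystem} : IsKraus fun _ : Unit => ContinuousLinearMap.id ℂ H :=
  isKraus_of_isometry fun _ => rfl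

/-- Bob applies `W` and measures `G` in the basis `g`; on the composite environment `G ⊗ F` each
outcome is the slice along the same basis vector. Alice has only the trivial one-outcome
measurement. -/
theorem simulates_postcomp {H K L F : QSystem} {κ : Type} (W : K →ₗᵢ[ℂ] tensor L G)
    (V : H →ₗᵢ[ℂ] tensor K F) (g : HilbertBasis κ ℂ G) :
    Simulates V (compDil W V) (fun k => sliceR L (g k) ∘L W.toContinuousLinearMap)
      (fun _ : Unit => .id ℂ H) := by
  have e : ∀ k, tmap (.id ℂ L) (sliceL F (g k)) ∘L assocL L G F =
      tmap (sliceR L (g k)) (.id ℂ F) := fun k =>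
    clm_ext_tmul₃ fun a b c => by simp -proj [tmul_smul_left, tmul_smul_right]
  refine ⟨fun p => sliceL F (g p.1), ?_, ?_, fun p => ?_⟩
  · simpa using (isKraus_sliceL (B := F) g).comp (IsKraus.unit (H := tensor G F))
  · rintro ⟨s, -⟩ ⟨t, -⟩
    have := isCoisometric_sliceL g F s t
    exact ⟨fun h => this.1 (congrArg Prod.fst h), fun h => this.2 fun h' => h (by rw [h'])⟩
  · rw [compDil_toCLM, ← ContinuousLinearMap.comp_assoc, e, ← ContinuousLinearMap.comp_assoc,
      tmap_comp, comp_id, comp_id]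

theorem simulates_precomp {H K L F : QSystem} {κ : Type} (V : K →ₗᵢ[ℂ] tensor L F)
    (W : H →ₗᵢ[ℂ] tensor K G) (g : HilbertBasis κ ℂ G) :
    Simulates V (compDil V W) (fun _ : Unit => .id ℂ L)
      (fun k => sliceR K (g k) ∘L W.toContinuousLinearMap) := by
  have e : ∀ k, tmap (.id ℂ L) (sliceR F (g k)) ∘L assocL L F G = sliceR (tensor L F) (g k) :=
    fun k => clm_ext_tmul₃ fun a b c => by simp -proj [tmul_smul_right]
  have e2 : ∀ k, sliceR (tensor L F) (g k) ∘L tmap V.toContinuousLinearMap (.id ℂ G) =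
      V.toContinuousLinearMap ∘L sliceR K (g k) := fun k =>
    ContinuousLinearMap.ext fun z => sliceR_tmap _ _ _
  refine ⟨fun p => sliceR F (g p.2), ?_, ?_, fun p => ?_⟩
  · simpa using (IsKraus.unit (H := F)).comp (isKraus_sliceR (A := F) g)
  · rintro ⟨-, s⟩ ⟨-, t⟩
    have := isCoisometric_sliceR g F s t
    exact ⟨fun h => this.1 (congrArg Prod.snd h), fun h => this.2 fun h' => h (by rw [h'])⟩
  · rw [compDil_toCLM, ← ContinuousLinearMap.comp_assoc, e, ← ContinuousLinearMap.comp_assoc,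
      e2, tmap_id, id_comp, ContinuousLinearMap.comp_assoc]

variable {H K L : QSystem}

theorem TwoWayCode.of_postcomp {Λ : QChannel H K} {Δ : QChannel K L} {W : K →ₗᵢ[ℂ] tensor L G}
    (hW : IsStinespring Δ G W) {n d : ℕ} {ε : ℝ} (h : TwoWayCode (Δ.comp Λ) n d ε) :
    TwoWayCode Λ n d ε := by
  obtain ⟨P, h⟩ := h
  obtain ⟨κ, g, -⟩ := exists_hilbertBasis ℂ G
  exact ⟨P.simulate _ _ (IsKraus.slice_isometry W g) IsKraus.unit, fun E V hV => by
    rw [(simulates_postcomp W V g).fidelity_eq]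
    exact h _ _ (hW.comp hV)⟩

theorem TwoWayCode.of_precomp {Λ : QChannel H K} {Δ : QChannel L H} {W : L →ₗᵢ[ℂ] tensor H G}
    (hW : IsStinespring Δ G W) {n d : ℕ} {ε : ℝ} (h : TwoWayCode (Λ.comp Δ) n d ε) :
    TwoWayCode Λ n d ε := by
  obtain ⟨P, h⟩ := h
  obtain ⟨κ, g, -⟩ := exists_hilbertBasis ℂ G
  exact ⟨P.simulate _ _ IsKraus.unit (IsKraus.slice_isometry W g), fun E V hV => by
    rw [(simulates_precomp V W g).fidelity_eq]
    exact h _ _ (hV.comp hW)⟩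

theorem KeyCode.of_postcomp {Λ : QChannel H K} {Δ : QChannel K L} {W : K →ₗᵢ[ℂ] tensor L G}
    (hW : IsStinespring Δ G W) {n d : ℕ} {ε : ℝ} (h : KeyCode (Δ.comp Λ) n d ε) :
    KeyCode Λ n d ε := by
  obtain ⟨P, h⟩ := h
  obtain ⟨κ, g, -⟩ := exists_hilbertBasis ℂ G
  exact ⟨P.simulate _ _ (IsKraus.slice_isometry W g) IsKraus.unit, fun E V hV =>
    ((simulates_postcomp W V g).keyError_le _ _ P).trans (h _ _ (hW.comp hV))⟩

theorem KeyCode.of_precomp {Λ : QChannel H K} {Δ : QChannel L H} {W : L →ₗᵢ[ℂ] tensor H G}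
    (hW : IsStinespring Δ G W) {n d : ℕ} {ε : ℝ} (h : KeyCode (Λ.comp Δ) n d ε) :
    KeyCode Λ n d ε := by
  obtain ⟨P, h⟩ := h
  obtain ⟨κ, g, -⟩ := exists_hilbertBasis ℂ G
  exact ⟨P.simulate _ _ IsKraus.unit (IsKraus.slice_isometry W g), fun E V hV =>
    ((simulates_precomp V W g).keyError_le _ _ P).trans (h _ _ (hV.comp hW))⟩

/-! ### Data processing for the capacities -/

theorem capacity_mono {C C' : ℕ → ℕ → ℝ → Prop} (h : ∀ n d ε, C n d ε → C' n d ε) :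
    capacity C ≤ capacity C' :=
  iSup₂_le fun R hR => le_iSup₂_of_le R (fun ε hε =>
    let ⟨n₀, hn⟩ := hR ε hε
    ⟨n₀, fun n hn' => let ⟨d, h1, h2⟩ := hn n hn'; ⟨d, h1, h _ _ _ h2⟩⟩) le_rfl

/-- `𝒦` is one of the four capacities. -/
def IsCapacity {H K : QSystem} (𝒦 : QChannel H K → ℝ≥0∞) : Prop :=
  𝒦 = quantumCapacity ∨ 𝒦 = privateCapacity ∨ 𝒦 = twoWayQuantumCapacity ∨ 𝒦 = secretKeyCapacity

theorem IsCapacity.postcomp_le {𝒦 : QChannel H H → ℝ≥0∞} (h𝒦 : IsCapacity 𝒦) {Λ : QChannel H H}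
    {Δ : QChannel H H} {W : H →ₗᵢ[ℂ] tensor H G} (hW : IsStinespring Δ G W) :
    𝒦 (Δ.comp Λ) ≤ 𝒦 Λ := by
  rcases h𝒦 with rfl | rfl | rfl | rfl
  · exact capacity_mono fun n d ε => QuantumCode.of_postcomp hW
  · exact capacity_mono fun n d ε => PrivateCode.of_postcomp hW
  · exact capacity_mono fun n d ε => TwoWayCode.of_postcomp hW
  · exact capacity_mono fun n d ε => KeyCode.of_postcomp hW

theorem IsCapacity.precomp_le {𝒦 : QChannel H H → ℝ≥0∞} (h𝒦 : IsCapacity 𝒦) {Λ : QChannel H H}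
    {Δ : QChannel H H} {W : H →ₗᵢ[ℂ] tensor H G} (hW : IsStinespring Δ G W) :
    𝒦 (Λ.comp Δ) ≤ 𝒦 Λ := by
  rcases h𝒦 with rfl | rfl | rfl | rfl
  · exact capacity_mono fun n d ε => QuantumCode.of_precomp hW
  · exact capacity_mono fun n d ε => PrivateCode.of_precomp hW
  · exact capacity_mono fun n d ε => TwoWayCode.of_precomp hW
  · exact capacity_mono fun n d ε => KeyCode.of_precomp hW

end Simulation

end BosonicGaussian

end

noncomputable section

namespace BosonicGaussian

open QSystem ContinuousLinearMap InnerProductSpace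

/-! ### Entanglement-breaking dilations -/

section Separable

variable {A A' B B' E E' H K F H' K' F' : QSystem}

/-- Finite sums `∑ᵢ aᵢ ⊗ bᵢ ⊗ eᵢ` with pairwise orthogonal `eᵢ`: purifications of separable
states of `A` and `B`. -/
def sepSums (A B E : QSystem) : Set (tensor A (tensor B E)) :=
  {z | ∃ (ι : Type) (_ : Fintype ι) (a : ι → A) (b : ι → B) (e : ι → E),
    (∀ i j, i ≠ j → inner ℂ (e i) (e j) = 0) ∧ z = ∑ i, tmul (a i) (tmul (b i) (e i))}

/-- A dilation is entanglement-breaking if all its outputs are limits of separable sums. -/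
def IsEB (V : H →L[ℂ] tensor K F) : Prop :=
  ∀ (A : QSystem) (u : tensor A H), tmap (.id ℂ A) V u ∈ closure (sepSums A K F)

/-- Local operations act term by term and leave the orthogonal environment vectors alone. -/
theorem tmap_mem_closure_sepSums (f : A →L[ℂ] A') (g : B →L[ℂ] B') {z : tensor A (tensor B E)}
    (hz : z ∈ closure (sepSums A B E)) :
    tmap f (tmap g (.id ℂ E)) z ∈ closure (sepSums A' B' E) := by
  refine map_mem_closure (ContinuousLinearMap.continuous _) hz ?_
  rintro _ ⟨ι, _, a, b, e, he, rfl⟩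
  refine ⟨ι, ‹_›, fun i => f (a i), fun i => g (b i), e, he, ?_⟩
  rw [map_sum]
  exact Finset.sum_congr rfl fun i _ => by simp -proj

/-- The environment vectors `f ⊗ e` of the combined sum are orthogonal: within one index `i` because
of `f`, between different indices because of `e`. -/
theorem sum_use_mem_closure {ι : Type} [Fintype ι] (b : ι → B) (e : ι → E)
    (he : ∀ i j, i ≠ j → inner ℂ (e i) (e j) = 0) (w : ι → tensor A (tensor K F))
    (hw : ∀ i, w i ∈ closure (sepSums A K F)) :
    ∑ i, tmap (.id ℂ A) (interL K F B E) (assocL A (tensor K F) (tensor B E)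
      (tmul (w i) (tmul (b i) (e i)))) ∈
      closure (sepSums A (tensor K B) (tensor F E)) := by
  -- All the finitely many `w i` must be approximated at the same time, hence the closure of a
  -- product set.
  have hw' : w ∈ closure (Set.univ.pi fun _ : ι => sepSums A K F) := by
    rw [closure_pi_set]
    exact fun i _ => hw i
  refine map_mem_closure (f := fun w : ι → tensor A (tensor K F) => ∑ i,
    tmap (.id ℂ A) (interL K F B E) (assocL A (tensor K F) (tensor B E)
      (tmul (w i) (tmul (b i) (e i))))) ?_ hw' ?_
  · refine continuous_finsetSum _ fun i _ => ?_
    exact (ContinuousLinearMap.continuous _).comp ((ContinuousLinearMap.continuous _).comp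
      ((tmulRight (tensor A (tensor K F)) (tmul (b i) (e i))).continuous.comp (continuous_apply i)))
  · intro w hw
    choose κ hκ a k f hf hz using fun i => hw i trivial
    refine ⟨Σ i, κ i, inferInstance, fun p => a p.1 p.2, fun p => tmul (k p.1 p.2) (b p.1),
      fun p => tmul (f p.1 p.2) (e p.1), ?_, ?_⟩
    · rintro ⟨i, x⟩ ⟨j, y⟩ h
      rw [inner_tmul]
      by_cases hij : i = j
      · subst hij
        rw [hf i x y (fun hxy => h (by rw [hxy])), zero_mul]
      · rw [he i j hij, mul_zero]
    · rw [Fintype.sum_sigma]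
      refine Finset.sum_congr rfl fun i _ => ?_
      rw [hz i, tmul_sum_left, map_sum, map_sum]
      exact Finset.sum_congr rfl fun x _ => by simp -proj [interL_tmul]

theorem IsEB.use_mem {V : H →L[ℂ] tensor K F} (hV : IsEB V) (U : A →L[ℂ] tensor A' H)
    {ψ : tensor A (tensor B E)} (hψ : ψ ∈ closure (sepSums A B E)) :
    tmap (.id ℂ A') (interL K F B E) (assocL A' (tensor K F) (tensor B E)
      (tmap (tmap (.id ℂ A') V ∘L U) (.id ℂ (tensor B E)) ψ)) ∈
      closure (sepSums A' (tensor K B) (tensor F E)) := by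
  rw [← closure_closure (s := sepSums A' (tensor K B) (tensor F E))]
  refine map_mem_closure (f := fun ψ => tmap (.id ℂ A') (interL K F B E)
    (assocL A' (tensor K F) (tensor B E)
      (tmap (tmap (.id ℂ A') V ∘L U) (.id ℂ (tensor B E)) ψ))) ?_ hψ ?_
  · exact (ContinuousLinearMap.continuous _).comp ((ContinuousLinearMap.continuous _).comp
      (ContinuousLinearMap.continuous _))
  · rintro _ ⟨ι, _, a, b, e, he, rfl⟩
    change tmap (.id ℂ A') (interL K F B E) (assocL A' (tensor K F) (tensor B E)
      (tmap (tmap (.id ℂ A') V ∘L U) (.id ℂ (tensor B E)) (∑ i, tmul (a i) (tmul (b i) (e i))))) ∈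
      closure (sepSums A' (tensor K B) (tensor F E))
    rw [map_sum, map_sum, map_sum]
    have h := sum_use_mem_closure b e he (fun i => tmap (.id ℂ A') V (U (a i)))
      fun i => hV A' (U (a i))
    convert h using 2
    rw [tmap_tmul]
    rfl

theorem isEB_unitDil : IsEB unitDil.toContinuousLinearMap := by
  intro A u
  have h : ∀ u : tensor A unit, tmul (sliceR A (1 : ℂ) u) (1 : ℂ) = u := fun u => by
    have : tmulRight A (1 : unit) ∘L sliceR A (1 : unit) = .id ℂ _ :=
      clm_ext_tmul fun a c => by
        change tmul (sliceR A (1 : unit) (tmul a c)) (1 : unit) = tmul a c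
        rw [sliceR_tmul, tmul_smul_left, ← tmul_smul_right]
        congr 1
        change (inner ℂ (1 : ℂ) (c : ℂ)) * (1 : ℂ) = c
        simp
    exact congrFun (congrArg DFunLike.coe this) u
  rw [← h u, tmap_tmul]
  refine subset_closure ⟨Unit, inferInstance, fun _ => sliceR A (1 : ℂ) u, fun _ => (1 : ℂ),
    fun _ => (1 : ℂ), fun i j hij => absurd rfl hij, ?_⟩
  rw [Fintype.sum_unique]
  rfl

/-- `G` is applied first, with reference `A ⊗ H`. The factor `H` of that reference is then the input
of `V`, so `IsEB.use_mem` applies with trivial splitting. -/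
theorem IsEB.interL_comp_tmap {V : H →L[ℂ] tensor K F} (hV : IsEB V) {G : H' →L[ℂ] tensor K' F'}
    (hG : IsEB G) : IsEB (interL K F K' F' ∘L tmap V G) := by
  intro A u
  obtain ⟨v, rfl⟩ := (QSystem.assoc A H H').surjective u
  have h := hV.use_mem (.id ℂ (tensor A H)) (hG (tensor A H) v)
  have e1 : tmap (.id ℂ A) (interL K F K' F') (tmap (.id ℂ A) (tmap V G) (assocL A H H' v)) =
      tmap (.id ℂ A) (interL K F K' F' ∘L tmap V G) (QSystem.assoc A H H' v) := by
    rw [tmap_tmap, id_comp]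
    rfl
  rw [← e1, assocL_tmap_apply]
  rw [tmap_tmap, comp_id, comp_id, id_comp] at h
  exact h

theorem isEB_dilationPow {V : H →ₗᵢ[ℂ] tensor K F} (hV : IsEB V.toContinuousLinearMap) (n : ℕ) :
    IsEB (dilationPow V n) := by
  induction n with
  | zero => exact isEB_unitDil
  | succ n ih => exact hV.interL_comp_tmap ih

/-! ### Quadratic functionals on separable sums -/

/-- If `X` is diagonal on the orthogonal vectors `e i`, all cross terms vanish and the label `i`
behaves like a classical random variable known to the environment. -/
theorem inner_sum_sepSum {ι : Type} [Fintype ι] {a : ι → A} {b : ι → B} {e : ι → E}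
    (he : ∀ i j, i ≠ j → inner ℂ (e i) (e j) = 0) {X : E →L[ℂ] E} {s : ι → ℂ}
    (hX : ∀ i, X (e i) = s i • e i) (Y : B →L[ℂ] B) :
    inner ℂ (∑ i, tmul (a i) (tmul (b i) (e i)))
      (tmap (.id ℂ A) (tmap Y X) (∑ i, tmul (a i) (tmul (b i) (e i)))) =
      ∑ i, s i * ((‖a i‖ ^ 2 * ‖e i‖ ^ 2 : ℝ) : ℂ) * inner ℂ (b i) (Y (b i)) := by
  rw [map_sum, sum_inner]
  refine Finset.sum_congr rfl fun i _ => ?_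
  rw [inner_sum, Finset.sum_eq_single i]
  · rw [tmap_tmul, tmap_tmul, hX, inner_tmul, inner_tmul, inner_smul_right,
      inner_self_eq_norm_sq_to_K, id_apply, inner_self_eq_norm_sq_to_K]
    push_cast
    change (‖a i‖ : ℂ) ^ 2 * (_ * (_ * (‖e i‖ : ℂ) ^ 2)) = _
    ring
  · intro j _ hj
    rw [tmap_tmul, tmap_tmul, hX, inner_tmul, inner_tmul, inner_smul_right, he i j hj.symm]
    simp
  · exact fun h => absurd (Finset.mem_univ i) h

theorem norm_sq_sepSum {ι : Type} [Fintype ι] {a : ι → A} {b : ι → B} {e : ι → E}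
    (he : ∀ i j, i ≠ j → inner ℂ (e i) (e j) = 0) :
    ‖∑ i, tmul (a i) (tmul (b i) (e i))‖ ^ 2 = ∑ i, ‖a i‖ ^ 2 * ‖b i‖ ^ 2 * ‖e i‖ ^ 2 := by
  have h := inner_sum_sepSum (a := a) (b := b) (s := fun _ => 1) he (X := .id ℂ E)
    (fun i => (one_smul _ _).symm) (.id ℂ B)
  rw [tmap_id, tmap_id, id_apply, inner_self_eq_norm_sq_to_K] at h
  refine Complex.ofReal_injective ((Complex.ofReal_pow _ _).trans (h.trans ?_))
  push_cast
  refine Finset.sum_congr rfl fun i _ => ?_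
  change _ * inner ℂ (b i) (b i) = _
  rw [inner_self_eq_norm_sq_to_K]
  change 1 * ((‖a i‖ : ℂ) ^ 2 * (‖e i‖ : ℂ) ^ 2) * (‖b i‖ : ℂ) ^ 2 = _
  ring

theorem norm_sq_sum_tmul {ι : Type} [Fintype ι] {b : ι → B} {e : ι → E}
    (he : ∀ i j, i ≠ j → inner ℂ (e i) (e j) = 0) :
    ‖∑ i, tmul (b i) (e i)‖ ^ 2 = ∑ i, ‖b i‖ ^ 2 * ‖e i‖ ^ 2 := by
  have h : inner ℂ (∑ i, tmul (b i) (e i)) (∑ i, tmul (b i) (e i)) =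
      ((∑ i, ‖b i‖ ^ 2 * ‖e i‖ ^ 2 : ℝ) : ℂ) := by
    rw [sum_inner, Complex.ofReal_sum]
    refine Finset.sum_congr rfl fun i _ => ?_
    rw [inner_sum, Finset.sum_eq_single i]
    · rw [inner_tmul, inner_self_eq_norm_sq_to_K, inner_self_eq_norm_sq_to_K]
      push_cast
      rfl
    · intro j _ hj
      rw [inner_tmul, he i j hj.symm, mul_zero]
    · exact fun h => absurd (Finset.mem_univ i) h
  rw [inner_self_eq_norm_sq_to_K] at h
  exact Complex.ofReal_injective ((Complex.ofReal_pow _ _).trans h)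

theorem exists_contraction_of_orthogonal {ι : Type} [Finite ι] (e : ι → E)
    (he : ∀ i j, i ≠ j → inner ℂ (e i) (e j) = 0) (s : Set ι) [DecidablePred (· ∈ s)] :
    ∃ X : E →L[ℂ] E, ‖X‖ ≤ 1 ∧ ∀ i, X (e i) = (if i ∈ s then 1 else -1 : ℂ) • e i := by
  let S : Submodule ℂ E := Submodule.span ℂ (e '' s)
  have : FiniteDimensional ℂ S := FiniteDimensional.span_of_finite ℂ (Set.toFinite _)
  -- The reflection in the span of the `e i` with `i ∈ s`; the other `e i` are orthogonal to that
  -- span and change sign.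
  refine ⟨S.reflection.toLinearIsometry.toContinuousLinearMap,
    LinearIsometry.norm_toContinuousLinearMap_le _, fun i => ?_⟩
  change S.reflection (e i) = _
  split_ifs with h
  · rw [one_smul]
    exact Submodule.reflection_mem_subspace_eq_self (Submodule.subset_span ⟨i, h, rfl⟩)
  · rw [neg_one_smul]
    refine Submodule.reflection_mem_subspace_orthogonalComplement_eq_neg ?_
    rw [Submodule.mem_orthogonal]
    intro u hu
    induction hu using Submodule.span_induction with
    | mem x hx =>
      obtain ⟨j, hj, rfl⟩ := hx
      exact he j i fun hji => h (hji ▸ hj)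
    | zero => exact inner_zero_left _
    | add x y _ _ hx hy => rw [inner_add_left, hx, hy, add_zero]
    | smul c x _ hx => rw [inner_smul_left, hx, mul_zero]

theorem norm_inner_sub_inner_le {T : H →L[ℂ] H} (hT : ‖T‖ ≤ 1) (x y : H) :
    ‖inner ℂ x (T x) - inner ℂ y (T y)‖ ≤ ‖x - y‖ * (‖x‖ + ‖y‖) := by
  have e : inner ℂ x (T x) - inner ℂ y (T y) = inner ℂ (x - y) (T x) + inner ℂ y (T (x - y)) := by
    rw [inner_sub_left, map_sub, inner_sub_right]
    ring
  have h : ∀ z, ‖T z‖ ≤ ‖z‖ := fun z => (le_of_opNorm_le _ hT z).trans_eq (one_mul _)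
  rw [e]
  calc _ ≤ ‖x - y‖ * ‖T x‖ + ‖y‖ * ‖T (x - y)‖ :=
        (norm_add_le _ _).trans (add_le_add (norm_inner_le_norm _ _) (norm_inner_le_norm _ _))
    _ ≤ ‖x - y‖ * ‖x‖ + ‖y‖ * ‖x - y‖ := by gcongr <;> exact h _
    _ = _ := by ring

theorem norm_tmap_id_le {X : E →L[ℂ] E} (hX : ‖X‖ ≤ 1) :
    ‖tmap (.id ℂ A) (tmap (.id ℂ B) X)‖ ≤ 1 := by
  have h1 : ∀ {C D : QSystem} {Z : D →L[ℂ] D}, ‖Z‖ ≤ 1 → ‖tmap (.id ℂ C) Z‖ ≤ 1 := fun hZ =>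
    (norm_tmap_le _ _).trans (mul_le_one₀ norm_id_le (norm_nonneg _) hZ)
  exact h1 (h1 hX)

/-! ### Two-way assisted protocols over entanglement-breaking channels -/

/-- Cauchy–Schwarz bounds the overlap of one product vector with `∑ᵢ |i⟩|i⟩`, and orthogonality of
the environment vectors lets the squares add up. The normalization `1/d` of the fidelity supplies
the separable bound. -/
theorem norm_sq_registers_le {ι : Type} [Fintype ι] {U : ι → A →L[ℂ] A'} {W : ι → B →L[ℂ] B'}
    (hU : ∀ x, ∑ i, ‖U i x‖ ^ 2 = ‖x‖ ^ 2) (hW : ∀ x, ∑ i, ‖W i x‖ ^ 2 = ‖x‖ ^ 2)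
    {ψ : tensor A (tensor B E)} (hψ : ψ ∈ closure (sepSums A B E)) :
    ‖∑ i, tmap (U i) (tmap (W i) (.id ℂ E)) ψ‖ ^ 2 ≤ ‖ψ‖ ^ 2 := by
  have hc : IsClosed {ψ : tensor A (tensor B E) |
      ‖∑ i, tmap (U i) (tmap (W i) (.id ℂ E)) ψ‖ ^ 2 ≤ ‖ψ‖ ^ 2} :=
    isClosed_le (((continuous_finsetSum _ fun i _ =>
      ContinuousLinearMap.continuous _).norm).pow 2) (continuous_norm.pow 2)
  refine (closure_minimal ?_ hc) hψ
  rintro _ ⟨κ, _, a, b, e, he, rfl⟩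
  change ‖∑ i, tmap (U i) (tmap (W i) (.id ℂ E)) (∑ k, tmul (a k) (tmul (b k) (e k)))‖ ^ 2 ≤ _
  have h1 : ∑ i, tmap (U i) (tmap (W i) (.id ℂ E)) (∑ k, tmul (a k) (tmul (b k) (e k))) =
      QSystem.assoc A' B' E (∑ k, tmul (∑ i, tmul (U i (a k)) (W i (b k))) (e k)) := by
    rw [map_sum]
    have : ∀ i, tmap (U i) (tmap (W i) (.id ℂ E)) (∑ k, tmul (a k) (tmul (b k) (e k))) =
        ∑ k, tmul (U i (a k)) (tmul (W i (b k)) (e k)) := fun i => by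
      rw [map_sum]
      exact Finset.sum_congr rfl fun k _ => by simp -proj
    rw [Finset.sum_congr rfl fun i _ => this i, Finset.sum_comm]
    refine Finset.sum_congr rfl fun k _ => ?_
    rw [tmul_sum_left, map_sum]
    exact Finset.sum_congr rfl fun i _ => (assoc_tmul _ _ _).symm
  rw [h1, LinearIsometryEquiv.norm_map, norm_sq_sum_tmul he, norm_sq_sepSum he]
  refine Finset.sum_le_sum fun k _ => ?_
  gcongr
  calc ‖∑ i, tmul (U i (a k)) (W i (b k))‖ ^ 2
      ≤ (∑ i, ‖U i (a k)‖ * ‖W i (b k)‖) ^ 2 := by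
        gcongr
        refine (norm_sum_le _ _).trans_eq (Finset.sum_congr rfl fun i _ => norm_tmul _ _)
    _ ≤ (∑ i, ‖U i (a k)‖ ^ 2) * ∑ i, ‖W i (b k)‖ ^ 2 := Finset.sum_mul_sq_le_sq_mul_sq _ _ _
    _ = _ := by rw [hU, hW]

theorem enorm_useVector (V : H →ₗᵢ[ℂ] tensor K F) (U : A →ₗᵢ[ℂ] tensor A' H)
    (ψ : tensor A (tensor B E)) : ‖useVector V U ψ‖ₑ = ‖ψ‖ₑ :=
  ((tmapIso (.id : A' →ₗᵢ[ℂ] A') (interchange K F B E).toLinearIsometry).comp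
    ((QSystem.assoc A' (tensor K F) (tensor B E)).toLinearIsometry.comp
      (tmapIso ((tmapIso (.id : A' →ₗᵢ[ℂ] A') V).comp U)
        (.id : tensor B E →ₗᵢ[ℂ] tensor B E)))).enorm_map ψ

theorem IsEB.useVector_mem {V : H →ₗᵢ[ℂ] tensor K F} (hV : IsEB V.toContinuousLinearMap)
    (U : A →ₗᵢ[ℂ] tensor A' H) {ψ : tensor A (tensor B E)} (hψ : ψ ∈ closure (sepSums A B E)) :
    useVector V U ψ ∈ closure (sepSums A' (tensor K B) (tensor F E)) :=
  hV.use_mem U.toContinuousLinearMap hψ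

theorem Protocol.fidelity_le {V : H →ₗᵢ[ℂ] tensor K F} (hV : IsEB V.toContinuousLinearMap)
    {d n : ℕ} (P : Protocol H K d n A B) (ψ : tensor A (tensor B E))
    (hψ : ψ ∈ closure (sepSums A B E)) :
    P.fidelity V E ψ ≤ ‖ψ‖ₑ ^ 2 * ENNReal.ofReal (d : ℝ)⁻¹ := by
  induction P generalizing E with
  | finish A' B' U W hU hW =>
    simp -proj only [fidelity, ofReal_norm_sq_div]
    gcongr
    have h := norm_sq_registers_le hU hW hψ
    rw [← ofReal_norm, ← ofReal_norm]
    exact ENNReal.ofReal_le_ofReal (le_of_sq_le_sq h (norm_nonneg _))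
  | alice ι A' M hM next ih =>
    simp -proj only [fidelity]
    rw [← tsum_tmap_right M (fun x => (hasSum_norm_sq_iff M x).1 (hM x)) ψ, ← ENNReal.tsum_mul_right]
    refine ENNReal.tsum_le_tsum fun k => ih k _ ?_
    have := tmap_mem_closure_sepSums (M k) (.id ℂ _) hψ
    rwa [tmap_id] at this
  | bob ι B' M hM next ih =>
    simp -proj only [fidelity]
    rw [← tsum_tmap_left (K := fun k => tensor (B' k) E) (fun k => tmap (M k) (.id ℂ E))
      (fun x => tsum_tmap_right M (fun x => (hasSum_norm_sq_iff M x).1 (hM x)) x) ψ,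
      ← ENNReal.tsum_mul_right]
    exact ENNReal.tsum_le_tsum fun k => ih k _ (tmap_mem_closure_sepSums (.id ℂ _) (M k) hψ)
  | use A' U next ih =>
    simp -proj only [fidelity]
    rw [← enorm_useVector V U ψ]
    exact ih _ (hV.useVector_mem U hψ)

/-- Independent keys cannot be both perfectly correlated and uniform: agreement forces the mass of
`β` onto one value, where uniformity fails. Adding the two estimates gives `A B (1 - 1/d) ≤ 2 D`. -/
theorem quarter_le_sum_abs {d : ℕ} (hd : 2 ≤ d) {α β : Fin d → ℝ} (hα : ∀ i, 0 ≤ α i)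
    (hβ : ∀ i, 0 ≤ β i) {A B : ℝ} (hA : ∑ i, α i = A) (hB : ∑ i, β i = B) :
    A * B / 4 ≤ ∑ i, ∑ j, |α i * β j - if i = j then A * B / d else 0| := by
  have hA0 : 0 ≤ A := hA ▸ Finset.sum_nonneg fun i _ => hα i
  have hB0 : 0 ≤ B := hB ▸ Finset.sum_nonneg fun i _ => hβ i
  have hd' : (2 : ℝ) ≤ d := by exact_mod_cast hd
  have : Nonempty (Fin d) := ⟨⟨0, by omega⟩⟩
  set D := ∑ i, ∑ j, |α i * β j - if i = j then A * B / d else 0| with hD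
  obtain ⟨m, hm⟩ := Finite.exists_max β
  -- The probability that the keys disagree.
  have h1 : A * B - ∑ i, α i * β i ≤ D := by
    have : A * B - ∑ i, α i * β i =
        ∑ i, ∑ j, (if i = j then 0 else α i * β j) := by
      rw [← hA, ← hB, Finset.sum_mul_sum, ← Finset.sum_sub_distrib]
      refine Finset.sum_congr rfl fun i _ => ?_
      have : α i * β i = ∑ j, if i = j then α i * β j else 0 := by simp
      rw [this, ← Finset.sum_sub_distrib]
      exact Finset.sum_congr rfl fun j _ => by split_ifs <;> simp
    rw [this]
    refine Finset.sum_le_sum fun i _ => Finset.sum_le_sum fun j _ => ?_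
    split_ifs
    · exact abs_nonneg _
    · rw [sub_zero]; exact le_abs_self _
  -- The excess over uniform of Bob's likeliest key `m`.
  have h2 : A * β m - A * B / d ≤ D := by
    have : A * β m - A * B / d = ∑ i, (α i * β m - if i = m then A * B / d else 0) := by
      rw [Finset.sum_sub_distrib, ← Finset.sum_mul, hA]
      simp
    rw [this]
    refine Finset.sum_le_sum fun i _ => (le_abs_self _).trans ?_
    exact Finset.single_le_sum (f := fun j => |α i * β j - if i = j then A * B / d else 0|)
      (fun j _ => abs_nonneg _) (Finset.mem_univ m)
  have h3 : ∑ i, α i * β i ≤ A * β m := by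
    rw [← hA, Finset.sum_mul]
    exact Finset.sum_le_sum fun i _ => mul_le_mul_of_nonneg_left (hm i) (hα i)
  have h4 : A * B / d ≤ A * B / 2 := by
    apply div_le_div_of_nonneg_left (mul_nonneg hA0 hB0) (by norm_num) hd'
  linarith

/-- Conditioned on the label `k` the two keys are independent, with weights `‖U i (a k)‖²` and `‖W j
(b k)‖²`. The tests `X i j` read `k` and apply the sign of the deviation, so the sum is bounded
label by label with `quarter_le_sum_abs`. -/
theorem exists_keyFunctional_le {d : ℕ} (hd : 2 ≤ d) {U : Fin d → A →L[ℂ] A'}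
    {W : Fin d → B →L[ℂ] B'} (hU : ∀ x, ∑ i, ‖U i x‖ ^ 2 = ‖x‖ ^ 2)
    (hW : ∀ x, ∑ i, ‖W i x‖ ^ 2 = ‖x‖ ^ 2) {ψ : tensor A (tensor B E)} (hψ : ψ ∈ sepSums A B E) :
    ∃ X : Fin d → Fin d → E →L[ℂ] E, (∀ i j, ‖X i j‖ ≤ 1) ∧ ‖ψ‖ ^ 2 / 4 ≤
      ∑ i, ∑ j, ‖keyFunctional (tmap (U i) (tmap (W j) (.id ℂ E)) ψ) ψ
        (if i = j then (d : ℂ)⁻¹ else 0) (X i j)‖ := by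
  classical
  obtain ⟨κ, _, a, b, e, he, rfl⟩ := hψ
  let q : Fin d → Fin d → κ → ℝ := fun i j k => ‖U i (a k)‖ ^ 2 * ‖W j (b k)‖ ^ 2 -
    if i = j then ‖a k‖ ^ 2 * ‖b k‖ ^ 2 / d else 0
  choose X hX1 hX using fun i j => exists_contraction_of_orthogonal e he {k | 0 ≤ q i j k}
  refine ⟨X, hX1, ?_⟩
  have key : ∀ i j, keyFunctional (tmap (U i) (tmap (W j) (.id ℂ E))
      (∑ k, tmul (a k) (tmul (b k) (e k)))) (∑ k, tmul (a k) (tmul (b k) (e k)))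
        (if i = j then (d : ℂ)⁻¹ else 0) (X i j) = ((∑ k, ‖e k‖ ^ 2 * |q i j k| : ℝ) : ℂ) := by
    intro i j
    have e1 : tmap (U i) (tmap (W j) (.id ℂ E)) (∑ k, tmul (a k) (tmul (b k) (e k))) =
        ∑ k, tmul (U i (a k)) (tmul (W j (b k)) (e k)) := by
      rw [map_sum]
      exact Finset.sum_congr rfl fun k _ => by simp -proj
    rw [keyFunctional_apply, e1, inner_sum_sepSum he (hX i j), inner_sum_sepSum he (hX i j),
      Finset.mul_sum, ← Finset.sum_sub_distrib, Complex.ofReal_sum]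
    refine Finset.sum_congr rfl fun k _ => ?_
    change _ * _ * inner ℂ (W j (b k)) (W j (b k)) - _ * (_ * _ * inner ℂ (b k) (b k)) = _
    rw [inner_self_eq_norm_sq_to_K, inner_self_eq_norm_sq_to_K]
    change _ * _ * (‖W j (b k)‖ : ℂ) ^ 2 - _ * (_ * _ * (‖b k‖ : ℂ) ^ 2) = _
    have hq : (if k ∈ {k | 0 ≤ q i j k} then 1 else -1 : ℂ) * (q i j k : ℂ) =
        ((|q i j k| : ℝ) : ℂ) := by
      simp only [Set.mem_ofPred_eq]
      split_ifs with h
      · rw [abs_of_nonneg h, one_mul]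
      · rw [abs_of_neg (not_le.1 h)]; push_cast; ring
    rw [Complex.ofReal_mul (‖e k‖ ^ 2) (|q i j k|), ← hq]
    generalize (if k ∈ {k | 0 ≤ q i j k} then 1 else -1 : ℂ) = σ
    simp only [q]
    split_ifs <;> push_cast <;> ring
  simp -proj only [key]
  rw [norm_sq_sepSum he]
  have h4 : ∀ k, ‖a k‖ ^ 2 * ‖b k‖ ^ 2 / 4 ≤ ∑ i, ∑ j, |q i j k| := fun k =>
    quarter_le_sum_abs hd (fun i => sq_nonneg _) (fun i => sq_nonneg _) (hU (a k)) (hW (b k))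
  calc (∑ k, ‖a k‖ ^ 2 * ‖b k‖ ^ 2 * ‖e k‖ ^ 2) / 4
      = ∑ k, ‖e k‖ ^ 2 * (‖a k‖ ^ 2 * ‖b k‖ ^ 2 / 4) := by
        rw [Finset.sum_div]; exact Finset.sum_congr rfl fun k _ => by ring
    _ ≤ ∑ k, ‖e k‖ ^ 2 * ∑ i, ∑ j, |q i j k| := by
        gcongr with k; exact h4 k
    _ = ∑ i, ∑ j, ∑ k, ‖e k‖ ^ 2 * |q i j k| := by
        simp_rw [Finset.mul_sum]
        rw [Finset.sum_comm]
        exact Finset.sum_congr rfl fun i _ => Finset.sum_comm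
    _ ≤ _ := by
        refine Finset.sum_le_sum fun i _ => Finset.sum_le_sum fun j _ => ?_
        rw [Complex.norm_real]
        exact le_abs_self _

theorem norm_keyFunctional_le (L : tensor A (tensor B E) →L[ℂ] tensor A' (tensor B' E)) (w : ℂ)
    {X : E →L[ℂ] E} (hX : ‖X‖ ≤ 1) (ψ φ : tensor A (tensor B E)) :
    ‖keyFunctional (L φ) φ w X‖ ≤ ‖keyFunctional (L ψ) ψ w X‖ +
      (‖L φ - L ψ‖ * (‖L φ‖ + ‖L ψ‖) + ‖w‖ * (‖φ - ψ‖ * (‖φ‖ + ‖ψ‖))) := by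
  have h1 := norm_inner_sub_inner_le (norm_tmap_id_le (A := A') (B := B') hX) (L φ) (L ψ)
  have h2 := norm_inner_sub_inner_le (norm_tmap_id_le (A := A) (B := B) hX) φ ψ
  rw [← sub_le_iff_le_add']
  refine (norm_sub_norm_le _ _).trans ?_
  rw [keyFunctional_apply, keyFunctional_apply, sub_sub_sub_comm, ← mul_sub]
  refine (norm_sub_le _ _).trans (add_le_add h1 ?_)
  rw [norm_mul]
  gcongr

theorem le_keyError_finish {d : ℕ} (hd : 2 ≤ d) {U : Fin d → A →L[ℂ] A'}
    {W : Fin d → B →L[ℂ] B'} (hU : ∀ x, ∑ i, ‖U i x‖ ^ 2 = ‖x‖ ^ 2)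
    (hW : ∀ x, ∑ i, ‖W i x‖ ^ 2 = ‖x‖ ^ 2) {ψ : tensor A (tensor B E)}
    (hψ : ψ ∈ closure (sepSums A B E)) :
    ENNReal.ofReal (‖ψ‖ ^ 2 / 4) ≤ ∑ i, ∑ j, ⨆ (X : E →L[ℂ] E) (_ : ‖X‖ ≤ 1), ENNReal.ofReal
      ‖keyFunctional (tmap (U i) (tmap (W j) (.id ℂ E)) ψ) ψ
        (if i = j then (d : ℂ)⁻¹ else 0) X‖ := by
  set D := ∑ i, ∑ j, ⨆ (X : E →L[ℂ] E) (_ : ‖X‖ ≤ 1), ENNReal.ofReal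
      ‖keyFunctional (tmap (U i) (tmap (W j) (.id ℂ E)) ψ) ψ
        (if i = j then (d : ℂ)⁻¹ else 0) X‖ with hD
  by_cases hT : D = ⊤
  · rw [hT]; exact le_top
  rw [ENNReal.ofReal_le_iff_le_toReal hT]
  let L : Fin d → Fin d → tensor A (tensor B E) →L[ℂ] tensor A' (tensor B' E) := fun i j =>
    tmap (U i) (tmap (W j) (.id ℂ E))
  let w : Fin d → Fin d → ℂ := fun i j => if i = j then (d : ℂ)⁻¹ else 0
  -- To pass to the closure, the supremum is frozen at its value `D` at `ψ`. Replacing `ψ` by a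
  -- nearby separable sum `φ` costs at most `lip φ`, uniformly in the contractions, and `lip`
  -- vanishes at `ψ`.
  let lip : tensor A (tensor B E) → ℝ := fun φ => ∑ i, ∑ j,
    (‖L i j φ - L i j ψ‖ * (‖L i j φ‖ + ‖L i j ψ‖) + ‖w i j‖ * (‖φ - ψ‖ * (‖φ‖ + ‖ψ‖)))
  have hlip : Continuous lip := by
    refine continuous_finsetSum _ fun i _ => continuous_finsetSum _ fun j _ => ?_
    have := (L i j).continuous
    fun_prop
  have hc : IsClosed {φ : tensor A (tensor B E) | ‖φ‖ ^ 2 / 4 ≤ D.toReal + lip φ} :=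
    isClosed_le ((continuous_norm.pow 2).div_const _) (continuous_const.add hlip)
  have hmem := (closure_minimal ?_ hc) hψ
  · have h0 : lip ψ = 0 := by simp -proj [lip]
    change ‖ψ‖ ^ 2 / 4 ≤ D.toReal + lip ψ at hmem
    rwa [h0, add_zero] at hmem
  · intro φ hφ
    obtain ⟨X, hX1, hX⟩ := exists_keyFunctional_le hd hU hW hφ
    change ‖φ‖ ^ 2 / 4 ≤ D.toReal + lip φ
    have h1 : ∑ i, ∑ j, ‖keyFunctional (L i j ψ) ψ (w i j) (X i j)‖ ≤ D.toReal := by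
      rw [← ENNReal.ofReal_le_iff_le_toReal hT, ENNReal.ofReal_sum_of_nonneg fun i _ =>
        Finset.sum_nonneg fun j _ => norm_nonneg _]
      refine Finset.sum_le_sum fun i _ => ?_
      rw [ENNReal.ofReal_sum_of_nonneg fun j _ => norm_nonneg _]
      exact Finset.sum_le_sum fun j _ => le_iSup₂_of_le (X i j) (hX1 i j) le_rfl
    refine hX.trans (le_trans ?_ (add_le_add_left h1 (lip φ)))
    simp -proj only [lip]
    rw [← Finset.sum_add_distrib]
    refine Finset.sum_le_sum fun i _ => ?_
    rw [← Finset.sum_add_distrib]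
    exact Finset.sum_le_sum fun j _ => norm_keyFunctional_le (L i j) (w i j) (hX1 i j) ψ φ

theorem Protocol.le_keyError {V : H →ₗᵢ[ℂ] tensor K F} (hV : IsEB V.toContinuousLinearMap)
    {d n : ℕ} (hd : 2 ≤ d) (P : Protocol H K d n A B) (ψ : tensor A (tensor B E))
    (hψ : ψ ∈ closure (sepSums A B E)) :
    ‖ψ‖ₑ ^ 2 * ENNReal.ofReal (4 : ℝ)⁻¹ ≤ P.keyError V E ψ := by
  induction P generalizing E with
  | finish A' B' U W hU hW =>
    have h := le_keyError_finish hd hU hW hψ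
    have h2 := ofReal_norm_sq_div _ ψ 4
    rw [Nat.cast_ofNat] at h2
    rw [h2] at h
    refine h.trans_eq ?_
    simp -proj only [keyError]
    refine Finset.sum_congr rfl fun i _ => Finset.sum_congr rfl fun j _ =>
      iSup_congr fun X => iSup_congr fun _ => ?_
    rw [keyFunctional_apply]
    congr 3
    split_ifs
    · rw [div_eq_inv_mul]
    · rw [zero_mul]
  | alice ι A' M hM next ih =>
    simp -proj only [keyError]
    rw [← tsum_tmap_right M (fun x => (hasSum_norm_sq_iff M x).1 (hM x)) ψ, ← ENNReal.tsum_mul_right]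
    refine ENNReal.tsum_le_tsum fun k => ih k _ ?_
    have := tmap_mem_closure_sepSums (M k) (.id ℂ _) hψ
    rwa [tmap_id] at this
  | bob ι B' M hM next ih =>
    simp -proj only [keyError]
    rw [← tsum_tmap_left (K := fun k => tensor (B' k) E) (fun k => tmap (M k) (.id ℂ E))
      (fun x => tsum_tmap_right M (fun x => (hasSum_norm_sq_iff M x).1 (hM x)) x) ψ,
      ← ENNReal.tsum_mul_right]
    exact ENNReal.tsum_le_tsum fun k => ih k _ (tmap_mem_closure_sepSums (.id ℂ _) (M k) hψ)
  | use A' U next ih =>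
    simp -proj only [keyError]
    rw [← enorm_useVector V U ψ]
    exact ih _ (hV.useVector_mem U hψ)

theorem initialVector_mem : initialVector ∈ closure (sepSums unit unit unit) :=
  subset_closure ⟨Unit, inferInstance, fun _ => (1 : ℂ), fun _ => (1 : ℂ), fun _ => (1 : ℂ),
    fun _ _ h => absurd rfl h, by rw [Fintype.sum_unique]; rfl⟩

theorem enorm_initialVector : ‖initialVector‖ₑ = 1 := by
  have h : ‖initialVector‖ = 1 := by
    rw [initialVector, norm_tmul, norm_tmul]
    change ‖(1 : ℂ)‖ * (‖(1 : ℂ)‖ * ‖(1 : ℂ)‖) = 1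
    simp
  rw [← ofReal_norm, h, ENNReal.ofReal_one]

/-- The fidelity is at most `1/d ≤ 1/2 < 7/8`. The error `1/8` also lies below the key-error bound
`1/4`, and it serves all four kinds of code. -/
theorem not_twoWayCode {Λ : QChannel H K} {V : H →ₗᵢ[ℂ] tensor K F} (hΛ : IsStinespring Λ F V)
    (hV : IsEB V.toContinuousLinearMap) {n d : ℕ} (hd : 2 ≤ d) : ¬ TwoWayCode Λ n d (1 / 8) := by
  rintro ⟨P, hP⟩
  have h := (hP F V hΛ).trans (P.fidelity_le hV _ initialVector_mem)
  rw [enorm_initialVector, one_pow, one_mul, ENNReal.ofReal_le_ofReal_iff (by positivity)] at h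
  have : (d : ℝ)⁻¹ ≤ 2⁻¹ := inv_anti₀ (by norm_num) (by exact_mod_cast hd)
  norm_num at h this
  linarith

theorem not_keyCode {Λ : QChannel H K} {V : H →ₗᵢ[ℂ] tensor K F} (hΛ : IsStinespring Λ F V)
    (hV : IsEB V.toContinuousLinearMap) {n d : ℕ} (hd : 2 ≤ d) : ¬ KeyCode Λ n d (1 / 8) := by
  rintro ⟨P, hP⟩
  have h := (P.le_keyError hV hd _ initialVector_mem).trans (hP F V hΛ)
  rw [enorm_initialVector, one_pow, one_mul, ENNReal.ofReal_le_ofReal_iff (by positivity)] at h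
  norm_num at h

theorem capacity_eq_zero {C : ℕ → ℕ → ℝ → Prop} {ε : ℝ} (hε : 0 < ε)
    (h : ∀ n d, 2 ≤ d → ¬ C n d ε) : capacity C = 0 := by
  refine le_antisymm (iSup₂_le fun R hR => ?_) bot_le
  rw [nonpos_iff_eq_zero, ENNReal.coe_eq_zero]
  by_contra hR0
  have hRpos : (0 : ℝ) < R := by positivity
  obtain ⟨n₀, hn⟩ := hR ε hε
  -- For a positive rate, `n ≥ 1/R` uses force `d ≥ 2`.
  obtain ⟨n, hn₁⟩ := exists_nat_ge (1 / (R : ℝ))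
  obtain ⟨d, hd, hC⟩ := hn (max n₀ n) (le_max_left _ _)
  refine h _ d ?_ hC
  have h1 : (1 : ℝ) ≤ ((max n₀ n : ℕ) : ℝ) * R := by
    rw [← div_le_iff₀ hRpos]
    exact hn₁.trans (by exact_mod_cast le_max_right _ _)
  have h2 : (2 : ℝ) ≤ d := by
    refine le_trans ?_ hd
    calc (2 : ℝ) = 2 ^ (1 : ℝ) := (Real.rpow_one _).symm
      _ ≤ _ := Real.rpow_le_rpow_of_exponent_le (by norm_num) h1
  exact_mod_cast h2

end Separable

end BosonicGaussian

end

noncomputable section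

namespace BosonicGaussian

open QSystem ContinuousLinearMap InnerProductSpace

/-! ### Unassisted codes over entanglement-breaking channels -/

section Unassisted

variable {A A' A₀ A₁ B E H K F L : QSystem}

/-- A purification of a positive trace-class operator. -/
theorem exists_purification {T : H →L[ℂ] H} (hT : IsTraceClass T) (hp : T.IsPositive) :
    ∃ (A : QSystem) (z : tensor A H), ∀ Y : H →L[ℂ] H,
      trace (Y ∘L T) = inner ℂ z (tmap (.id ℂ A) Y z) := by
  obtain ⟨ι, w, hw, hN⟩ := exists_nRep_of_isPositive hT hp
  -- The purification is `∑ bᵢ ⊗ wᵢ` over the standard basis of `ℓ²(ι)`; it converges because its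
  -- terms are orthogonal and `∑ ‖wᵢ‖²` is finite.
  let A : QSystem := ⟨lp (fun _ : ι => ℂ) 2⟩
  let b : HilbertBasis ι ℂ A := .ofRepr (.refl ℂ _)
  let V : ι → H →ₗᵢ[ℂ] tensor A H := fun i =>
    { (tmulLeft H (b i)).toLinearMap with
      norm_map' := fun x => by
        change ‖tmul (b i) x‖ = ‖x‖
        rw [norm_tmul, b.orthonormal.1 i, one_mul] }
  have hV : ∀ i x, V i x = tmul (b i) x := fun i x => rfl
  have horth : OrthogonalFamily ℂ (fun _ : ι => H) V := fun i j hij x y => by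
    rw [hV, hV, inner_tmul, b.orthonormal.2 hij, zero_mul]
  have hs : Summable fun i => V i (w i) := (horth.summable_iff_norm_sq_summable w).2 hw
  obtain ⟨z, hz⟩ := hs
  refine ⟨A, z, fun Y => ?_⟩
  have hsl : ∀ i, sliceL H (b i) z = w i := fun i => by
    have h1 : HasSum (fun j => sliceL H (b i) (V j (w j))) (sliceL H (b i) z) :=
      hz.map (sliceL H (b i)) (ContinuousLinearMap.continuous _)
    refine h1.unique ?_
    classical
    have h2 := hasSum_ite_eq i (w i)
    refine h2.congr_fun fun j => ?_
    rw [hV, sliceL_tmul, orthonormal_iff_ite.1 b.orthonormal]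
    by_cases hij : i = j
    · subst hij; simp
    · rw [if_neg hij, if_neg (Ne.symm hij), zero_smul]
  have h1 : HasSum (fun i => inner ℂ (V i (w i)) (tmap (.id ℂ A) Y z))
      (inner ℂ z (tmap (.id ℂ A) Y z)) := by
    have hc : Continuous fun x : tensor A H => inner ℂ x (tmap (.id ℂ A) Y z) := by fun_prop
    let f : tensor A H →+ ℂ :=
      { toFun := fun x => inner ℂ x (tmap (.id ℂ A) Y z)
        map_zero' := inner_zero_left _
        map_add' := fun x y => inner_add_left _ _ _ }
    exact hz.map f hc
  have h2 : HasSum (fun i => inner ℂ (w i) (Y (w i))) (trace (Y ∘L T)) :=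
    (hN.comp_left Y).hasSum_trace
  refine h2.unique (h1.congr_fun fun i => ?_)
  rw [hV, ← inner_sliceL, sliceL_tmap, hsl]

theorem inner_tmap_conj (G : H →L[ℂ] L) (Y : L →L[ℂ] L) (x y : tensor A H) :
    inner ℂ (tmap (.id ℂ A) G x) (tmap (.id ℂ A) Y (tmap (.id ℂ A) G y)) =
      inner ℂ x (tmap (.id ℂ A) (adjoint G ∘L Y ∘L G) y) := by
  rw [← adjoint_inner_right, adjoint_tmap, tmap_tmap, tmap_tmap, adjoint_id',
    id_comp, id_comp, ContinuousLinearMap.comp_assoc]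

theorem trace_comp_conj_eq {ρ : TraceClass H} {z : tensor A H}
    (hz : ∀ Y : H →L[ℂ] H, trace (Y ∘L op ρ) = inner ℂ z (tmap (.id ℂ A) Y z))
    (G : H →L[ℂ] L) (Y : L →L[ℂ] L) : trace (Y ∘L conj G ρ) =
      inner ℂ (tmap (.id ℂ A) G z) (tmap (.id ℂ A) Y (tmap (.id ℂ A) G z)) := by
  rw [trace_comp_conj, hz, inner_tmap_conj]

/-- The gain of distinguishing two branches by a measurement of `B` is bounded by the
distinguishability of the branches on `E`. -/
theorem measurement_le_of_sep (S₀ : A →L[ℂ] A₀) (S₁ : A →L[ℂ] A₁) {D₀ D₁ : B →L[ℂ] B}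
    (h₀ : ∀ b, 0 ≤ (inner ℂ b (D₀ b)).re) (h₁ : ∀ b, 0 ≤ (inner ℂ b (D₁ b)).re)
    (h₂ : ∀ b, (inner ℂ b (D₀ b)).re + (inner ℂ b (D₁ b)).re ≤ ‖b‖ ^ 2)
    {ζ : tensor A (tensor B E)} (hζ : ζ ∈ closure (sepSums A B E)) {ζ₀ : tensor A₀ (tensor B E)}
    {ζ₁ : tensor A₁ (tensor B E)} (e₀ : tmap S₀ (.id ℂ (tensor B E)) ζ = ζ₀)
    (e₁ : tmap S₁ (.id ℂ (tensor B E)) ζ = ζ₁) {ε : ℝ}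
    (hX : ∀ X : E →L[ℂ] E, ‖X‖ ≤ 1 → ‖inner ℂ ζ₀ (tmap (.id ℂ A₀) (tmap (.id ℂ B) X) ζ₀) -
      inner ℂ ζ₁ (tmap (.id ℂ A₁) (tmap (.id ℂ B) X) ζ₁)‖ ≤ ε) :
    (inner ℂ ζ₀ (tmap (.id ℂ A₀) (tmap D₀ (.id ℂ E)) ζ₀)).re +
      (inner ℂ ζ₁ (tmap (.id ℂ A₁) (tmap D₁ (.id ℂ E)) ζ₁)).re ≤
      (‖ζ₀‖ ^ 2 + ‖ζ₁‖ ^ 2 + ε) / 2 := by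
  classical
  subst e₀ e₁
  let L₀ : tensor A (tensor B E) →L[ℂ] tensor A₀ (tensor B E) := tmap S₀ (.id ℂ (tensor B E))
  let L₁ : tensor A (tensor B E) →L[ℂ] tensor A₁ (tensor B E) := tmap S₁ (.id ℂ (tensor B E))
  let T₀ : tensor A₀ (tensor B E) →L[ℂ] tensor A₀ (tensor B E) := tmap (.id ℂ A₀) (tmap D₀ (.id ℂ E))
  let T₁ : tensor A₁ (tensor B E) →L[ℂ] tensor A₁ (tensor B E) := tmap (.id ℂ A₁) (tmap D₁ (.id ℂ E))
  let lip : tensor A (tensor B E) → ℝ := fun φ =>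
    ‖L₀ φ - L₀ ζ‖ * (‖L₀ φ‖ + ‖L₀ ζ‖) + ‖L₁ φ - L₁ ζ‖ * (‖L₁ φ‖ + ‖L₁ ζ‖)
  have c₀ := L₀.continuous
  have c₁ := L₁.continuous
  have hc : IsClosed {φ : tensor A (tensor B E) |
      (inner ℂ (L₀ φ) (T₀ (L₀ φ))).re + (inner ℂ (L₁ φ) (T₁ (L₁ φ))).re ≤
        (‖L₀ φ‖ ^ 2 + ‖L₁ φ‖ ^ 2 + (ε + lip φ)) / 2} := by
    have d₀ := T₀.continuous
    have d₁ := T₁.continuous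
    refine isClosed_le ?_ ?_
    · exact (Complex.continuous_re.comp (c₀.inner (d₀.comp c₀))).add
        (Complex.continuous_re.comp (c₁.inner (d₁.comp c₁)))
    · simp -proj only [lip]
      fun_prop
  have hmem := (closure_minimal ?_ hc) hζ
  · have h0 : lip ζ = 0 := by simp -proj [lip]
    change (inner ℂ (L₀ ζ) (T₀ (L₀ ζ))).re + (inner ℂ (L₁ ζ) (T₁ (L₁ ζ))).re ≤
        (‖L₀ ζ‖ ^ 2 + ‖L₁ ζ‖ ^ 2 + (ε + lip ζ)) / 2 at hmem
    rwa [h0, add_zero] at hmem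
  · rintro _ ⟨κ, _, a, b, e, he, rfl⟩
    set φ := ∑ k, tmul (a k) (tmul (b k) (e k)) with hφ
    change (inner ℂ (L₀ φ) (T₀ (L₀ φ))).re + (inner ℂ (L₁ φ) (T₁ (L₁ φ))).re ≤
        (‖L₀ φ‖ ^ 2 + ‖L₁ φ‖ ^ 2 + (ε + lip φ)) / 2
    have f₀ : L₀ φ = ∑ k, tmul (S₀ (a k)) (tmul (b k) (e k)) := by
      rw [hφ, map_sum]
      exact Finset.sum_congr rfl fun k _ => tmap_tmul _ _ _ _
    have f₁ : L₁ φ = ∑ k, tmul (S₁ (a k)) (tmul (b k) (e k)) := by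
      rw [hφ, map_sum]
      exact Finset.sum_congr rfl fun k _ => tmap_tmul _ _ _ _
    -- The environment reads the label `k` and guesses the branch of larger weight. The output `b k`
    -- is determined by `k`, so the receiver cannot do better.
    obtain ⟨X, hX1, hXe⟩ := exists_contraction_of_orthogonal e he
      {k | ‖S₁ (a k)‖ ^ 2 ≤ ‖S₀ (a k)‖ ^ 2}
    have hid : ∀ k, ContinuousLinearMap.id ℂ E (e k) = (1 : ℂ) • e k := fun k => (one_smul _ _).symm
    have p₀ : (inner ℂ (L₀ φ) (T₀ (L₀ φ))).re =
        ∑ k, ‖S₀ (a k)‖ ^ 2 * ‖e k‖ ^ 2 * (inner ℂ (b k) (D₀ (b k))).re := by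
      rw [f₀, inner_sum_sepSum he hid, Complex.re_sum]
      exact Finset.sum_congr rfl fun k _ => by rw [one_mul, Complex.re_ofReal_mul]
    have p₁ : (inner ℂ (L₁ φ) (T₁ (L₁ φ))).re =
        ∑ k, ‖S₁ (a k)‖ ^ 2 * ‖e k‖ ^ 2 * (inner ℂ (b k) (D₁ (b k))).re := by
      rw [f₁, inner_sum_sepSum he hid, Complex.re_sum]
      exact Finset.sum_congr rfl fun k _ => by rw [one_mul, Complex.re_ofReal_mul]
    have hq : ∑ k, |‖S₀ (a k)‖ ^ 2 - ‖S₁ (a k)‖ ^ 2| * (‖b k‖ ^ 2 * ‖e k‖ ^ 2) ≤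
        ‖inner ℂ (L₀ φ) (tmap (.id ℂ A₀) (tmap (.id ℂ B) X) (L₀ φ)) -
          inner ℂ (L₁ φ) (tmap (.id ℂ A₁) (tmap (.id ℂ B) X) (L₁ φ))‖ := by
      have : inner ℂ (L₀ φ) (tmap (.id ℂ A₀) (tmap (.id ℂ B) X) (L₀ φ)) -
          inner ℂ (L₁ φ) (tmap (.id ℂ A₁) (tmap (.id ℂ B) X) (L₁ φ)) =
          ((∑ k, |‖S₀ (a k)‖ ^ 2 - ‖S₁ (a k)‖ ^ 2| * (‖b k‖ ^ 2 * ‖e k‖ ^ 2) : ℝ) : ℂ) := by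
        rw [f₀, f₁, inner_sum_sepSum he hXe, inner_sum_sepSum he hXe, ← Finset.sum_sub_distrib,
          Complex.ofReal_sum]
        refine Finset.sum_congr rfl fun k _ => ?_
        change _ * inner ℂ (b k) (b k) - _ * inner ℂ (b k) (b k) = _
        rw [inner_self_eq_norm_sq_to_K]
        change _ * (‖b k‖ : ℂ) ^ 2 - _ * (‖b k‖ : ℂ) ^ 2 = _
        simp only [Set.mem_ofPred_eq]
        split_ifs with h
        · rw [abs_of_nonneg (sub_nonneg.2 h)]; push_cast; ring
        · rw [abs_of_neg (sub_neg.2 (not_le.1 h))]; push_cast; ring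
      rw [this, Complex.norm_real]
      exact le_abs_self _
    have hlip : ‖inner ℂ (L₀ φ) (tmap (.id ℂ A₀) (tmap (.id ℂ B) X) (L₀ φ)) -
          inner ℂ (L₁ φ) (tmap (.id ℂ A₁) (tmap (.id ℂ B) X) (L₁ φ))‖ ≤ ε + lip φ := by
      have g₀ := norm_inner_sub_inner_le (norm_tmap_id_le (A := A₀) (B := B) hX1) (L₀ φ) (L₀ ζ)
      have g₁ := norm_inner_sub_inner_le (norm_tmap_id_le (A := A₁) (B := B) hX1) (L₁ φ) (L₁ ζ)
      rw [← sub_le_iff_le_add']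
      refine le_trans (sub_le_sub_left (hX X hX1) _) ?_
      refine (norm_sub_norm_le _ _).trans ?_
      rw [sub_sub_sub_comm]
      exact (norm_sub_le _ _).trans (add_le_add g₀ g₁)
    rw [p₀, p₁, f₀, f₁, norm_sq_sepSum he, norm_sq_sepSum he]
    refine le_trans ?_ (div_le_div_of_nonneg_right (add_le_add_right (hq.trans hlip) _) zero_le_two)
    rw [← Finset.sum_add_distrib, ← Finset.sum_add_distrib, ← Finset.sum_add_distrib,
      Finset.sum_div]
    refine Finset.sum_le_sum fun k _ => ?_
    -- The factor `(u + v + |u - v|) / 2` is `max u v`.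
    have hm : ∀ {u v p q r : ℝ}, 0 ≤ u → 0 ≤ v → 0 ≤ p → 0 ≤ q → p + q ≤ r →
        u * p + v * q ≤ (u + v + |u - v|) / 2 * r := by
      intro u v p q r hu hv hp hq hpq
      have hmax : (u + v + |u - v|) / 2 = max u v := by
        rcases le_total u v with h | h
        · rw [max_eq_right h, abs_of_nonpos (by linarith)]; ring
        · rw [max_eq_left h, abs_of_nonneg (by linarith)]; ring
      rw [hmax]
      calc u * p + v * q ≤ max u v * p + max u v * q := by
            gcongr
            · exact le_max_left _ _
            · exact le_max_right _ _
        _ = max u v * (p + q) := by ring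
        _ ≤ max u v * r := by
            gcongr
    have := mul_le_mul_of_nonneg_right (hm (sq_nonneg ‖S₀ (a k)‖) (sq_nonneg ‖S₁ (a k)‖) (h₀ (b k))
      (h₁ (b k)) (h₂ (b k))) (sq_nonneg ‖e k‖)
    refine le_of_eq_of_le ?_ (this.trans_eq ?_) <;> ring

theorem not_privateCode {Λ : QChannel H K} {V : H →ₗᵢ[ℂ] tensor K F} (hΛ : IsStinespring Λ F V)
    (hV : IsEB V.toContinuousLinearMap) {n d : ℕ} (hd : 2 ≤ d) : ¬ PrivateCode Λ n d (1 / 8) := by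
  classical
  rintro ⟨ρ, D, hρ, hD, hsum, h⟩
  obtain ⟨h1, h2⟩ := h F V hΛ
  let m₀ : Fin d := ⟨0, by omega⟩
  let m₁ : Fin d := ⟨1, by omega⟩
  have hm : m₀ ≠ m₁ := fun h => by simpa [m₀, m₁] using congrArg Fin.val h
  obtain ⟨A₀, z₀, hz₀⟩ := exists_purification (ρ m₀).2 (hρ m₀).1
  obtain ⟨A₁, z₁, hz₁⟩ := exists_purification (ρ m₁).2 (hρ m₁).1
  -- The purifications of two messages are put into one vector with reference `A₀ ⊕ A₁`, so that a
  -- single separable decomposition serves both; `S₀` and `S₁` select the branches.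
  let A : QSystem := ⟨WithLp 2 (A₀ × A₁)⟩
  let J : A ≃L[ℂ] A₀ × A₁ := WithLp.prodContinuousLinearEquiv 2 ℂ A₀ A₁
  let S₀ : A →L[ℂ] A₀ := .fst ℂ A₀ A₁ ∘L J.toContinuousLinearMap
  let S₁ : A →L[ℂ] A₁ := .snd ℂ A₀ A₁ ∘L J.toContinuousLinearMap
  let I₀ : A₀ →L[ℂ] A := J.symm.toContinuousLinearMap ∘L .inl ℂ A₀ A₁
  let I₁ : A₁ →L[ℂ] A := J.symm.toContinuousLinearMap ∘L .inr ℂ A₀ A₁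
  have s00 : S₀ ∘L I₀ = .id ℂ A₀ := ContinuousLinearMap.ext fun x => rfl
  have s11 : S₁ ∘L I₁ = .id ℂ A₁ := ContinuousLinearMap.ext fun x => rfl
  have s01 : S₀ ∘L I₁ = 0 := ContinuousLinearMap.ext fun x => rfl
  have s10 : S₁ ∘L I₀ = 0 := ContinuousLinearMap.ext fun x => rfl
  have hG := isEB_dilationPow hV n
  have hGG := adjoint_dilationPow_comp V n
  set G := dilationPow V n with hGdef
  let L₀ := K.pow n
  let E := F.pow n
  let z := tmap I₀ (.id ℂ (H.pow n)) z₀ + tmap I₁ (.id ℂ (H.pow n)) z₁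
  have e₀ : tmap S₀ (.id ℂ (tensor L₀ E)) (tmap (.id ℂ A) G z) = tmap (.id ℂ A₀) G z₀ := by
    rw [tmap_tmap, map_add, tmap_tmap, tmap_tmap, comp_id, comp_id, id_comp, s00, s01,
      tmap_zero_left, zero_apply, add_zero]
  have e₁ : tmap S₁ (.id ℂ (tensor L₀ E)) (tmap (.id ℂ A) G z) = tmap (.id ℂ A₁) G z₁ := by
    rw [tmap_tmap, map_add, tmap_tmap, tmap_tmap, comp_id, comp_id, id_comp, s11, s10,
      tmap_zero_left, zero_apply, zero_add]
  have hn : ∀ {A' : QSystem} {m : Fin d} {z' : tensor A' (H.pow n)} (_ : ∀ Y : H.pow n →L[ℂ] H.pow n,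
      trace (Y ∘L op (ρ m)) = inner ℂ z' (tmap (.id ℂ A') Y z')),
      ‖tmap (.id ℂ A') G z'‖ ^ 2 = 1 := by
    intro A' m z' hz'
    have h3 := hz' (adjoint G ∘L G)
    rw [hGG, id_comp, (hρ m).2] at h3
    have h4 : inner ℂ (tmap (.id ℂ A') G z') (tmap (.id ℂ A') G z') = 1 := by
      rw [← adjoint_inner_right, adjoint_tmap, tmap_tmap, adjoint_id', id_comp, h3, hGG]
    rw [inner_self_eq_norm_sq_to_K] at h4
    exact Complex.ofReal_injective ((Complex.ofReal_pow _ _).trans (h4.trans Complex.ofReal_one.symm))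
  have hle := measurement_le_of_sep S₀ S₁ (D₀ := D m₀) (D₁ := D m₁)
    (fun b => ((hD m₀).re_inner_nonneg_right b)) (fun b => ((hD m₁).re_inner_nonneg_right b))
    (fun b => ?_) (hG A z) e₀ e₁ (ε := 1 / 8) fun X hX => ?_
  · rw [← trace_comp_conj_eq hz₀, ← trace_comp_conj_eq hz₁, hn hz₀, hn hz₁] at hle
    -- Correct decoding gives at least `7/4` in total, while `hle` allows only `(1 + 1 + 1/8) / 2 =
    -- 17/16`.
    have h3 := h1 m₀
    have h4 := h1 m₁
    norm_num at h3 h4 hle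
    linarith
  · have hb : ∑ m, (inner ℂ b (D m b)).re = ‖b‖ ^ 2 := by
      rw [← Complex.re_sum, ← inner_sum, ← sum_apply, hsum, id_apply, inner_self_eq_norm_sq_to_K]
      change ((‖b‖ : ℂ) ^ 2).re = _
      rw [← Complex.ofReal_pow, Complex.ofReal_re]
    rw [← hb, ← Finset.sum_pair (f := fun m => (inner ℂ b (D m b)).re) hm]
    exact Finset.sum_le_sum_of_subset_of_nonneg (Finset.subset_univ _)
      fun m _ _ => (hD m).re_inner_nonneg_right b
  · rw [← trace_comp_conj_eq hz₀, ← trace_comp_conj_eq hz₁]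
    exact h2 m₀ m₁ X hX

/-! ### Quantum codes -/

theorem ofReal_le_of_sum_inner {a : Fin 2 → A} (c : Fin 2 → ℂ) :
    0 ≤ ∑ i, ∑ j, inner ℂ (a i) (a j) * (c i * starRingEnd ℂ (c j)) := by
  have : ∑ i, ∑ j, inner ℂ (a i) (a j) * (c i * starRingEnd ℂ (c j)) =
      inner ℂ (∑ i, starRingEnd ℂ (c i) • a i) (∑ i, starRingEnd ℂ (c i) • a i) := by
    rw [sum_inner]
    refine Finset.sum_congr rfl fun i _ => ?_
    rw [inner_sum]
    refine Finset.sum_congr rfl fun j _ => ?_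
    rw [inner_smul_left, inner_smul_right, Complex.conj_conj]
    ring
  rw [this, inner_self_eq_norm_sq_to_K]
  exact pow_nonneg (Complex.zero_le_real.2 (norm_nonneg (∑ i, starRingEnd ℂ (c i) • a i))) 2

/-- On a separable term the form is a Gram matrix of the `S i (a k)` against a rank-one matrix `cᵢ
c̄ⱼ`, and transposing the latter leaves it positive. This is where the partial transposition enters.
-/
theorem sum_inner_nonneg_of_sep (S : Fin 2 → A →L[ℂ] A₀) (y : Fin 2 → B)
    {ζ : tensor A (tensor B E)} (hζ : ζ ∈ closure (sepSums A B E)) :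
    0 ≤ ∑ i, ∑ j, inner ℂ (tmap (S i) (.id ℂ (tensor B E)) ζ) (tmap (.id ℂ A₀)
      (tmap (rankOne ℂ (y j) (y i)) (.id ℂ E)) (tmap (S j) (.id ℂ (tensor B E)) ζ)) := by
  have hc : IsClosed {ζ : tensor A (tensor B E) | 0 ≤ ∑ i, ∑ j,
      inner ℂ (tmap (S i) (.id ℂ (tensor B E)) ζ) (tmap (.id ℂ A₀)
      (tmap (rankOne ℂ (y j) (y i)) (.id ℂ E)) (tmap (S j) (.id ℂ (tensor B E)) ζ))} := by
    refine isClosed_le continuous_const (continuous_finsetSum _ fun i _ =>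
      continuous_finsetSum _ fun j _ => ?_)
    exact (ContinuousLinearMap.continuous _).inner ((ContinuousLinearMap.continuous _).comp
      (ContinuousLinearMap.continuous _))
  refine (closure_minimal ?_ hc) hζ
  rintro _ ⟨κ, _, a, b, e, he, rfl⟩
  have f : ∀ i, tmap (S i) (.id ℂ (tensor B E)) (∑ k, tmul (a k) (tmul (b k) (e k))) =
      ∑ k, tmul (S i (a k)) (tmul (b k) (e k)) := fun i => by
    rw [map_sum]
    exact Finset.sum_congr rfl fun k _ => tmap_tmul _ _ _ _
  have g : ∀ i j, inner ℂ (tmap (S i) (.id ℂ (tensor B E)) (∑ k, tmul (a k) (tmul (b k) (e k))))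
      (tmap (.id ℂ A₀) (tmap (rankOne ℂ (y j) (y i)) (.id ℂ E))
        (tmap (S j) (.id ℂ (tensor B E)) (∑ k, tmul (a k) (tmul (b k) (e k))))) =
      ∑ k, (‖e k‖ ^ 2 : ℝ) * (inner ℂ (S i (a k)) (S j (a k)) *
        (inner ℂ (y i) (b k) * starRingEnd ℂ (inner ℂ (y j) (b k)))) := by
    intro i j
    rw [f, f, map_sum, sum_inner]
    refine Finset.sum_congr rfl fun k _ => ?_
    rw [inner_sum, Finset.sum_eq_single k]
    · rw [tmap_tmul, tmap_tmul, inner_tmul, inner_tmul]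
      change inner ℂ (S i (a k)) (S j (a k)) * (inner ℂ (b k) (rankOne ℂ (y j) (y i) (b k)) *
        inner ℂ (e k) (e k)) = _
      rw [rankOne_apply, inner_smul_right, inner_self_eq_norm_sq_to_K, inner_conj_symm]
      push_cast
      change _ * (_ * (‖e k‖ : ℂ) ^ 2) = _
      ring
    · intro l _ hl
      rw [tmap_tmul, tmap_tmul, inner_tmul, inner_tmul]
      change _ * (_ * inner ℂ (e k) (e l)) = _
      rw [he k l hl.symm, mul_zero, mul_zero]
    · exact fun h => absurd (Finset.mem_univ k) h
  change 0 ≤ ∑ i, ∑ j, inner ℂ (tmap (S i) (.id ℂ (tensor B E)) (∑ k, tmul (a k) (tmul (b k) (e k))))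
      (tmap (.id ℂ A₀) (tmap (rankOne ℂ (y j) (y i)) (.id ℂ E))
        (tmap (S j) (.id ℂ (tensor B E)) (∑ k, tmul (a k) (tmul (b k) (e k)))))
  rw [Finset.sum_congr rfl fun i _ => Finset.sum_congr rfl fun j _ => g i j]
  rw [Finset.sum_congr rfl fun i _ => Finset.sum_comm, Finset.sum_comm]
  refine Finset.sum_nonneg fun k _ => ?_
  rw [Finset.sum_congr rfl fun i _ => (Finset.mul_sum _ _ _).symm, ← Finset.mul_sum]
  exact mul_nonneg (Complex.zero_le_real.2 (sq_nonneg _)) (ofReal_le_of_sum_inner _)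

/-- The rank-one operator `|u⟩⟨v|` as a trace-class operator. -/
def outer (u v : H) : TraceClass H :=
  ⟨rankOne ℂ u v, Unit, fun _ => u, fun _ => v, .of_finite, fun x => by simp⟩

theorem trace_op_outer_comp (u v : H) {T : H →L[ℂ] H} (hT : IsTraceClass T) :
    trace (op (outer u v) ∘L T) = inner ℂ v (T u) := trace_rankOne_comp hT u v

theorem outer_add_smul (u v : H) (ω : ℂ) : outer (u + ω • v) (u + ω • v) = outer u u +
    starRingEnd ℂ ω • outer u v + ω • outer v u + (ω * starRingEnd ℂ ω) • outer v v := by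
  refine Subtype.ext (ContinuousLinearMap.ext fun x => ?_)
  change rankOne ℂ (u + ω • v) (u + ω • v) x = rankOne ℂ u u x + starRingEnd ℂ ω • rankOne ℂ u v x +
    ω • rankOne ℂ v u x + (ω * starRingEnd ℂ ω) • rankOne ℂ v v x
  simp only [rankOne_apply, inner_add_left, inner_smul_left]
  module

theorem inner_tmap_outer (u v : A) (T : H →L[ℂ] H) (z : tensor A H) :
    inner ℂ z (tmap (rankOne ℂ u v) T z) = inner ℂ (sliceL H u z) (T (sliceL H v z)) := by
  have h : tmap (rankOne ℂ u v) T = tmulLeft H u ∘L T ∘L sliceL H v :=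
    clm_ext_tmul fun a b => by simp -proj [tmul_smul_left]
  rw [h]
  exact (adjoint_inner_left (tmulLeft H u) _ _).symm

/-- The blocks form a positive operator on `ℂ² ⊗ H`. Its purification is read with `ℂ²` moved into
the reference, and `S i` slices that qubit. The order `T j i` on the left is what yields the
transposed blocks later. -/
theorem exists_block_purification (T : Fin 2 → Fin 2 → TraceClass H)
    (hT : ∀ x : Fin 2 → H, 0 ≤ ∑ i, ∑ j, inner ℂ (x i) (op (T i j) (x j))) :
    ∃ (A₀ A : QSystem) (S : Fin 2 → A →L[ℂ] A₀) (z : tensor A H), ∀ (i j) (Y : H →L[ℂ] H),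
      trace (Y ∘L op (T j i)) = inner ℂ (tmap (S i) (.id ℂ H) z)
        (tmap (.id ℂ A₀) Y (tmap (S j) (.id ℂ H) z)) := by
  classical
  let q : Fin 2 → qudit 2 := fun i => EuclideanSpace.basisFun (Fin 2) ℂ i
  have hq : ∀ i j, inner ℂ (q i) (q j) = if i = j then 1 else 0 :=
    orthonormal_iff_ite.1 (EuclideanSpace.basisFun (Fin 2) ℂ).orthonormal
  let R : tensor (qudit 2) H →L[ℂ] tensor (qudit 2) H :=
    ∑ i, ∑ j, tmap (op (outer (q i) (q j))) (op (T i j))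
  have hterm : ∀ i j, IsTraceClass (tmap (op (outer (q i) (q j))) (op (T i j))) := fun i j =>
    (outer (q i) (q j)).2.tmap (T i j).2
  have hR : IsTraceClass R := (trace_sum _ _ fun i => (trace_sum _ _ fun j => hterm i j).1).1
  have hRp : R.IsPositive := by
    refine isPositive_of_inner_nonneg fun x => ?_
    refine (hT fun i => sliceL H (q i) x).trans_eq ?_
    rw [sum_apply, inner_sum]
    refine Finset.sum_congr rfl fun i _ => ?_
    rw [sum_apply, inner_sum]
    exact Finset.sum_congr rfl fun j _ => (inner_tmap_outer _ _ _ _).symm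
  obtain ⟨A₀, w, hz⟩ := exists_purification hR hRp
  refine ⟨A₀, tensor A₀ (qudit 2), fun i => sliceR A₀ (q i), (QSystem.assoc A₀ (qudit 2) H).symm w,
    fun i j Y => ?_⟩
  have hs : ∀ i, tmap (sliceR A₀ (q i)) (.id ℂ H) ((QSystem.assoc A₀ (qudit 2) H).symm w) =
      tmap (.id ℂ A₀) (sliceL H (q i)) w := fun i => by
    obtain ⟨v, rfl⟩ := (QSystem.assoc A₀ (qudit 2) H).surjective w
    rw [LinearIsometryEquiv.symm_apply_apply]
    have : tmap (sliceR A₀ (q i)) (.id ℂ H) =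
        tmap (.id ℂ A₀) (sliceL H (q i)) ∘L assocL A₀ (qudit 2) H :=
      clm_ext_tmul₃ fun a b c => by simp -proj [tmul_smul_left, tmul_smul_right]
    exact congrFun (congrArg DFunLike.coe this) v
  rw [hs, hs, ← adjoint_inner_right, adjoint_tmap, tmap_tmap, tmap_tmap, adjoint_id', id_comp,
    id_comp, adjoint_sliceL]
  have e : tmulLeft H (q i) ∘L (Y ∘L sliceL H (q j)) = tmap (op (outer (q i) (q j))) Y :=
    clm_ext_tmul fun a b => by
      rw [tmap_tmul]
      change tmul (q i) (Y (sliceL H (q j) (tmul a b))) = tmul (rankOne ℂ (q i) (q j) a) (Y b)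
      rw [sliceL_tmul, map_smul, rankOne_apply, tmul_smul_left, tmul_smul_right]
  rw [ContinuousLinearMap.comp_assoc, e, ← hz]
  have hcomp : tmap (op (outer (q i) (q j))) Y ∘L R = ∑ k, ∑ l,
      tmap (op (outer (q i) (q j)) ∘L op (outer (q k) (q l))) (Y ∘L op (T k l)) := by
    simp -proj only [R]
    rw [comp_finsetSum]
    refine Finset.sum_congr rfl fun k _ => ?_
    rw [comp_finsetSum]
    exact Finset.sum_congr rfl fun l _ => tmap_comp _ _ _ _
  have ht : ∀ k l, IsTraceClass
      (tmap (op (outer (q i) (q j)) ∘L op (outer (q k) (q l))) (Y ∘L op (T k l))) := fun k l =>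
    ((outer (q k) (q l)).2.comp_left _).tmap ((T k l).2.comp_left Y)
  have hv : ∀ k l, trace (tmap (op (outer (q i) (q j)) ∘L op (outer (q k) (q l))) (Y ∘L op (T k l))) =
      (if j = k then 1 else 0) * (if l = i then 1 else 0) * trace (Y ∘L op (T k l)) := fun k l => by
    rw [trace_tmap ((outer (q k) (q l)).2.comp_left _) ((T k l).2.comp_left Y),
      trace_op_outer_comp _ _ (outer (q k) (q l)).2]
    change inner ℂ (q j) (rankOne ℂ (q k) (q l) (q i)) * _ = _
    rw [rankOne_apply, inner_smul_right, hq, hq]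
    ring
  rw [hcomp, (trace_sum _ _ fun k => (trace_sum _ _ fun l => ht k l).1).2,
    Finset.sum_congr rfl fun k _ => (trace_sum _ _ fun l => ht k l).2]
  simp -proj only [hv]
  rw [Finset.sum_eq_single j, Finset.sum_eq_single i]
  · simp
  · intro l _ hl; simp [hl]
  · simp
  · intro k _ hk; simp [Ne.symm hk]
  · simp

/-- A channel with an entanglement-breaking dilation stays positive after a partial
transposition. -/
theorem sum_inner_swap_nonneg {Λ : QChannel H K} {V : H →ₗᵢ[ℂ] tensor K F}
    (hΛ : IsStinespring Λ F V) (hV : IsEB V.toContinuousLinearMap)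
    (T : Fin 2 → Fin 2 → TraceClass H)
    (hT : ∀ x : Fin 2 → H, 0 ≤ ∑ i, ∑ j, inner ℂ (x i) (op (T i j) (x j))) (y : Fin 2 → K) :
    0 ≤ ∑ i, ∑ j, inner ℂ (y i) (op (Λ.toLin (T j i)) (y j)) := by
  obtain ⟨A₀, A, S, z, hz⟩ := exists_block_purification T hT
  refine (sum_inner_nonneg_of_sep S y (hV A z)).trans_eq ?_
  refine Finset.sum_congr rfl fun i _ => Finset.sum_congr rfl fun j _ => ?_
  have e : ∀ i, tmap (S i) (.id ℂ (tensor K F)) (tmap (.id ℂ A) V.toContinuousLinearMap z) =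
      tmap (.id ℂ A₀) V.toContinuousLinearMap (tmap (S i) (.id ℂ H) z) := fun i => by
    rw [tmap_tmap, tmap_tmap, comp_id, id_comp, comp_id, id_comp]
  rw [← trace_rankOne_comp (Λ.toLin (T j i)).2, hΛ, trace_comp_conj, hz, e, e, inner_tmap_conj]

/-- Transmitting superpositions of `u` and `v` needs a large coherence, the matrix elements of
`Θ(|u⟩⟨v|)` between `u` and `v`. Positivity after transposition bounds the coherence by the
probabilities of confusing `u` with `v`, which are small for a good code. -/
theorem not_quantumCode {Λ : QChannel H K} {V : H →ₗᵢ[ℂ] tensor K F} (hΛ : IsStinespring Λ F V)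
    (hV : IsEB V.toContinuousLinearMap) {n d : ℕ} (hd : 2 ≤ d) : ¬ QuantumCode Λ n d (1 / 8) := by
  classical
  rintro ⟨enc, dec, h⟩
  have hΛₙ := hΛ.isTensorPower n
  have hst := isStinespring_chanOfIsometry (dilIso V n)
  have hEB : IsEB (dilIso V n).toContinuousLinearMap := by
    rw [toCLM_dilIso]; exact isEB_dilationPow hV n
  set Λₙ := chanOfIsometry (dilIso V n)
  specialize h Λₙ hΛₙ
  let q : Fin d → qudit d := fun i => EuclideanSpace.basisFun (Fin d) ℂ i
  have hq : ∀ i j, inner ℂ (q i) (q j) = if i = j then 1 else 0 :=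
    orthonormal_iff_ite.1 (EuclideanSpace.basisFun (Fin d) ℂ).orthonormal
  let u : qudit d := q ⟨0, by omega⟩
  let v : qudit d := q ⟨1, by omega⟩
  have huv : inner ℂ u v = (0 : ℂ) := (hq _ _).trans (if_neg (by simp))
  have huu : inner ℂ u u = (1 : ℂ) := (hq _ _).trans (if_pos rfl)
  have hvv : inner ℂ v v = (1 : ℂ) := (hq _ _).trans (if_pos rfl)
  have hvu : inner ℂ v u = (0 : ℂ) := (hq _ _).trans (if_neg (by simp))
  let Θ : QChannel (qudit d) (qudit d) := dec.comp (Λₙ.comp enc)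
  let f : Fin 2 → qudit d := ![u, v]
  let g : qudit d → qudit d → qudit d → qudit d → ℂ := fun a b c e =>
    inner ℂ a (op (Θ.toLin (outer b c)) e)
  -- positivity of the partial transpose
  have hpos : ∀ y : Fin 2 → qudit d, 0 ≤ ∑ i, ∑ j, g (y i) (f j) (f i) (y j) := by
    intro y
    refine dec.completelyPositive 2 (fun i j => Λₙ.toLin (enc.toLin (outer (f j) (f i)))) ?_ y
    intro x
    refine sum_inner_swap_nonneg hst hEB (fun i j => enc.toLin (outer (f i) (f j))) ?_ x
    refine enc.completelyPositive 2 (fun i j => outer (f i) (f j)) fun x => ?_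
    have : ∑ i, ∑ j, inner ℂ (x i) (op (outer (f i) (f j)) (x j)) =
        (∑ i, inner ℂ (x i) (f i)) * starRingEnd ℂ (∑ i, inner ℂ (x i) (f i)) := by
      rw [map_sum, Finset.sum_mul_sum]
      refine Finset.sum_congr rfl fun i _ => Finset.sum_congr rfl fun j _ => ?_
      change inner ℂ (x i) (rankOne ℂ (f i) (f j) (x j)) = _
      rw [rankOne_apply, inner_smul_right, inner_conj_symm, mul_comm]
    rw [this, Complex.mul_conj]
    exact Complex.zero_le_real.2 (Complex.normSq_nonneg _)
  have hswap : (g u u v v).re + (g v v u u).re ≤ (g v u u v).re + (g u v v u).re := by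
    -- The antisymmetric choice gives the two coherence terms a minus sign and the two confusion
    -- probabilities a plus sign.
    have h1 := (Complex.le_def.1 (hpos ![v, -u])).1
    have e : ∑ i, ∑ j, g (![v, -u] i) (f j) (f i) (![v, -u] j) =
        g v u u v + g u v v u - g v v u u - g u u v v := by
      simp only [Fin.sum_univ_two, f, g, Matrix.cons_val_zero, Matrix.cons_val_one]
      simp only [map_neg, inner_neg_left, inner_neg_right]
      abel
    rw [e] at h1
    simp only [Complex.sub_re, Complex.add_re, Complex.zero_re] at h1
    linarith
  -- the trace bounds
  have htr : ∀ b : qudit d, ‖b‖ = 1 → (g u b b u).re + (g v b b v).re ≤ 1 := by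
    intro b hb
    have hΘ : (op (Θ.toLin (outer b b))).IsPositive := by
      refine isPositive_of_inner_nonneg fun x => ?_
      have := Θ.completelyPositive 1 (fun _ _ => outer b b) (fun x => ?_) fun _ => x
      · simpa using this
      · simp only [Fin.sum_univ_one]
        change 0 ≤ inner ℂ (x 0) (rankOne ℂ b b (x 0))
        rw [rankOne_apply, inner_smul_right, ← inner_conj_symm, mul_comm, Complex.mul_conj]
        exact Complex.zero_le_real.2 (Complex.normSq_nonneg _)
    have ht : trace (op (Θ.toLin (outer b b))) = 1 := by
      have : NRep (op (outer b b)) (fun _ : Unit => b) (fun _ => b) :=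
        ⟨.of_finite, fun x => by
          change HasSum (fun _ : Unit => inner ℂ b x • b) (rankOne ℂ b b x)
          rw [rankOne_apply]
          exact hasSum_unique _⟩
      rw [Θ.tracePreserving, this.trace_eq, tsum_eq_single () (by simp),
        inner_self_eq_norm_sq_to_K, hb]
      simp
    have hsum := hasSum_trace_basis (Θ.toLin (outer b b)).2
      (EuclideanSpace.basisFun (Fin d) ℂ).toHilbertBasis
    have h2 := (hasSum_fintype _).unique hsum
    rw [ht] at h2
    have h3 := congrArg Complex.re h2
    rw [Complex.re_sum, Complex.one_re] at h3
    rw [← h3]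
    have hne : (⟨0, by omega⟩ : Fin d) ≠ ⟨1, by omega⟩ := by simp
    refine le_of_eq_of_le ?_ (Finset.sum_le_sum_of_subset_of_nonneg
      (Finset.subset_univ {(⟨0, by omega⟩ : Fin d), ⟨1, by omega⟩})
      fun m _ _ => hΘ.re_inner_nonneg_right _)
    rw [Finset.sum_pair hne]
    simp only [OrthonormalBasis.coe_toHilbertBasis]
    rfl
  -- Since `‖u + ω v‖² = 2`, the unnormalized form is four times the fidelity, and `7/2 = 4 · 7/8`.
  have hfid : ∀ ω : ℂ, ‖ω‖ = 1 → 7 / 2 ≤ (g (u + ω • v) (u + ω • v) (u + ω • v) (u + ω • v)).re := by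
    intro ω hω
    set w := u + ω • v with hw
    have hww : inner ℂ w w = (2 : ℂ) := by
      rw [hw, inner_add_left, inner_add_right, inner_add_right, inner_smul_left, inner_smul_left,
        inner_smul_right, inner_smul_right, huu, huv, hvu, hvv, mul_one, ← mul_comm ω,
        Complex.mul_conj, Complex.normSq_eq_norm_sq, hω]
      norm_num
    let c : ℂ := ((√2)⁻¹ : ℝ)
    have hc : starRingEnd ℂ c * c = 1 / 2 := by
      simp only [c, Complex.conj_ofReal]
      rw [← Complex.ofReal_mul, ← mul_inv, Real.mul_self_sqrt zero_le_two]
      norm_num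
    have hψ : ‖c • w‖ = 1 := by
      have h1 : inner ℂ (c • w) (c • w) = (1 : ℂ) := by
        rw [inner_smul_left, inner_smul_right, hww, ← mul_assoc, hc]
        norm_num
      rw [inner_self_eq_norm_sq_to_K] at h1
      have h2 : ‖c • w‖ ^ 2 = 1 :=
        Complex.ofReal_injective ((Complex.ofReal_pow _ _).trans (h1.trans Complex.ofReal_one.symm))
      exact (pow_eq_one_iff_of_nonneg (norm_nonneg _) two_ne_zero).1 h2
    have h3 := h (c • w) hψ
    have h4 : ketbra (c • w) = (1 / 2 : ℂ) • outer w w := by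
      rw [← hc]
      refine Subtype.ext (ContinuousLinearMap.ext fun x => ?_)
      change rankOne ℂ (c • w) (c • w) x = (starRingEnd ℂ c * c) • rankOne ℂ w w x
      rw [rankOne_apply, rankOne_apply, inner_smul_left]
      module
    have h5 : inner ℂ (c • w) (op (Θ.toLin (ketbra (c • w))) (c • w)) = (1 / 4 : ℂ) * g w w w w := by
      rw [h4, LinearMap.map_smul]
      change inner ℂ (c • w) ((1 / 2 : ℂ) • op (Θ.toLin (outer w w)) (c • w)) = _
      rw [map_smul, inner_smul_left, inner_smul_right, inner_smul_right]
      change _ = 1 / 4 * inner ℂ w (op (Θ.toLin (outer w w)) w)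
      rw [show (1 / 4 : ℂ) = 1 / 2 * (starRingEnd ℂ c * c) by rw [hc]; norm_num]
      ring
    change 1 - 1 / 8 ≤ (inner ℂ (c • w) (op (Θ.toLin (ketbra (c • w))) (c • w))).re at h3
    rw [h5, show (1 / 4 : ℂ) = ((1 / 4 : ℝ) : ℂ) by norm_num, Complex.re_ofReal_mul] at h3
    linarith
  have hexp : ∀ ω : ℂ, g (u + ω • v) (u + ω • v) (u + ω • v) (u + ω • v) =
      (g u u u u + starRingEnd ℂ ω * g u u v u + ω * g u v u u +
        ω * starRingEnd ℂ ω * g u v v u) +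
      ω * (g u u u v + starRingEnd ℂ ω * g u u v v + ω * g u v u v +
        ω * starRingEnd ℂ ω * g u v v v) +
      starRingEnd ℂ ω * (g v u u u + starRingEnd ℂ ω * g v u v u + ω * g v v u u +
        ω * starRingEnd ℂ ω * g v v v u) +
      starRingEnd ℂ ω * ω * (g v u u v + starRingEnd ℂ ω * g v u v v + ω * g v v u v +
        ω * starRingEnd ℂ ω * g v v v v) := by
    intro ω
    simp only [g]
    rw [outer_add_smul]
    have hop : ∀ x, op (Θ.toLin (outer u u + starRingEnd ℂ ω • outer u v + ω • outer v u +
        (ω * starRingEnd ℂ ω) • outer v v)) x = op (Θ.toLin (outer u u)) x +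
        starRingEnd ℂ ω • op (Θ.toLin (outer u v)) x + ω • op (Θ.toLin (outer v u)) x +
        (ω * starRingEnd ℂ ω) • op (Θ.toLin (outer v v)) x := fun x => by
      rw [map_add, map_add, map_add, map_smul, map_smul, map_smul]
      rfl
    rw [hop]
    simp only [map_add, map_smul, inner_add_left, inner_add_right, inner_smul_left,
      inner_smul_right]
    ring
  have h1 := hfid 1 (by simp)
  have h2 := hfid (-1) (by simp)
  have h3 := hfid Complex.I (by simp)
  have h4 := hfid (-Complex.I) (by simp)
  -- Summing over the four phases `±1, ±i` removes every term with unbalanced powers of `ω` and its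
  -- conjugate.
  have hsum : g (u + (1 : ℂ) • v) (u + (1 : ℂ) • v) (u + (1 : ℂ) • v) (u + (1 : ℂ) • v) +
      g (u + (-1 : ℂ) • v) (u + (-1 : ℂ) • v) (u + (-1 : ℂ) • v) (u + (-1 : ℂ) • v) +
      g (u + Complex.I • v) (u + Complex.I • v) (u + Complex.I • v) (u + Complex.I • v) +
      g (u + (-Complex.I) • v) (u + (-Complex.I) • v) (u + (-Complex.I) • v) (u + (-Complex.I) • v) =
      (4 : ℝ) * (g u u u u + g v u u v + g u v v u + g v v v v + g u u v v + g v v u u) := by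
    rw [hexp, hexp, hexp, hexp]
    simp only [map_neg, map_one, Complex.conj_I]
    push_cast
    linear_combination (2 * g v u v u + 2 * g u v u v - 2 * g u v v u - 2 * g u u v v -
      2 * g v v u u - 2 * g v u u v + (2 * Complex.I ^ 2 - 2) * g v v v v) * Complex.I_sq
  have h5 := congrArg Complex.re hsum
  rw [Complex.re_ofReal_mul] at h5
  simp only [Complex.add_re] at h5
  have hu1 : ‖u‖ = 1 := (EuclideanSpace.basisFun (Fin d) ℂ).orthonormal.1 _
  have hv1 : ‖v‖ = 1 := (EuclideanSpace.basisFun (Fin d) ℂ).orthonormal.1 _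
  have h6 := htr u hu1
  have h7 := htr v hv1
  have h8 : 1 - 1 / 8 ≤ (g u u u u).re := h u hu1
  have h9 : 1 - 1 / 8 ≤ (g v v v v).re := h v hv1
  -- The surviving six terms must add up to at least `7/2`. The four diagonal ones are at most `2`
  -- by trace preservation, and the coherences at most `1/8 + 1/8`.
  linarith

/-! ### Vanishing of the capacities -/

theorem IsCapacity.eq_zero {𝒦 : QChannel H K → ℝ≥0∞} (h𝒦 : IsCapacity 𝒦) {Λ : QChannel H K}
    {V : H →ₗᵢ[ℂ] tensor K F} (hΛ : IsStinespring Λ F V) (hV : IsEB V.toContinuousLinearMap) :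
    𝒦 Λ = 0 := by
  have h8 : (0 : ℝ) < 1 / 8 := by norm_num
  rcases h𝒦 with rfl | rfl | rfl | rfl
  · exact capacity_eq_zero h8 fun n d hd => not_quantumCode hΛ hV hd
  · exact capacity_eq_zero h8 fun n d hd => not_privateCode hΛ hV hd
  · exact capacity_eq_zero h8 fun n d hd => not_twoWayCode hΛ hV hd
  · exact capacity_eq_zero h8 fun n d hd => not_keyCode hΛ hV hd

end Unassisted

end BosonicGaussian

end

noncomputable section

namespace BosonicGaussian

open QSystem ContinuousLinearMap InnerProductSpace

/-! ### Tensor products of `L²` spaces -/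

section LinearIsometry

variable {A B Z : QSystem}

/-- The isometry `A ⊗ B → Z` induced by a bilinear map that preserves inner products. -/
theorem exists_tensorLift (φ : A →ₗ[ℂ] B →ₗ[ℂ] Z)
    (h : ∀ a a' b b', inner ℂ (φ a b) (φ a' b') = inner ℂ a a' * inner ℂ b b') :
    ∃ J : tensor A B →ₗᵢ[ℂ] Z, ∀ a b, J (tmul a b) = φ a b := by
  let ψ : A ⊗[ℂ] B →ₗ[ℂ] Z := TensorProduct.lift φ
  have hψ : ∀ x y, inner ℂ (ψ x) (ψ y) = inner ℂ x y := fun x y => by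
    induction x using TensorProduct.induction_on with
    | zero => simp
    | add x x' hx hx' => rw [map_add, inner_add_left, inner_add_left, hx, hx']
    | tmul a b =>
      induction y using TensorProduct.induction_on with
      | zero => simp
      | add y y' hy hy' => rw [map_add, inner_add_right, inner_add_right, hy, hy']
      | tmul a' b' =>
        rw [TensorProduct.lift.tmul, TensorProduct.lift.tmul, h, TensorProduct.inner_tmul]
  have hn : ∀ x, ‖ψ x‖ = ‖x‖ := fun x => by
    rw [@norm_eq_sqrt_re_inner ℂ, @norm_eq_sqrt_re_inner ℂ, hψ]
  let ψ' : A ⊗[ℂ] B →L[ℂ] Z := (⟨ψ, hn⟩ : A ⊗[ℂ] B →ₗᵢ[ℂ] Z).toContinuousLinearMap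
  let Ψ : tensor A B →L[ℂ] Z :=
    ψ'.extend (Completion.toComplL : A ⊗[ℂ] B →L[ℂ] Completion (A ⊗[ℂ] B))
  have hΨ : ∀ x : A ⊗[ℂ] B, Ψ (x : Completion (A ⊗[ℂ] B)) = ψ x := fun x => by
    have := ContinuousLinearMap.extend_eq ψ' (denseRange_toComplL (A ⊗[ℂ] B))
      (by rw [Completion.coe_toComplL]; exact Completion.isUniformInducing_coe _) x
    rw [Completion.coe_toComplL] at this
    exact this
  refine ⟨{ Ψ.toLinearMap with
    norm_map' := fun z => ?_ }, fun a b => (hΨ _).trans (TensorProduct.lift.tmul a b)⟩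
  refine (denseRange_toComplL (A ⊗[ℂ] B)).induction_on (p := fun z => ‖Ψ z‖ = ‖z‖) z
    (isClosed_eq Ψ.continuous.norm continuous_norm) fun x => ?_
  change ‖Ψ (x : Completion (A ⊗[ℂ] B))‖ = ‖(x : Completion (A ⊗[ℂ] B))‖
  rw [hΨ, hn, Completion.norm_coe]

theorem surjective_of_orthogonal {H : QSystem} (J : H →ₗᵢ[ℂ] Z)
    (h : ∀ z, (∀ x, inner ℂ (J x) z = 0) → z = 0) : Function.Surjective J := by
  have hc : IsClosed (J.toLinearMap.range : Set Z) := by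
    have := J.isometry.isClosedEmbedding.isClosed_range
    simpa using! this
  have : J.toLinearMap.range = ⊤ := by
    have : CompleteSpace J.toLinearMap.range := hc.completeSpace_coe
    rw [← Submodule.orthogonal_eq_bot_iff, Submodule.eq_bot_iff]
    intro z hz
    exact h z fun x => (Submodule.mem_orthogonal _ _).1 hz _ ⟨x, rfl⟩
  exact LinearMap.range_eq_top.1 this

end LinearIsometry

/-- The system with Hilbert space `L²(μ)`. -/
abbrev L2 {X : Type} [MeasurableSpace X] (μ : Measure X) : QSystem := ⟨Lp ℂ 2 μ⟩

section LTwo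

variable {X Y : Type} [MeasurableSpace X] [MeasurableSpace Y] {μ : Measure X} {ν : Measure Y}
  [SigmaFinite μ] [SigmaFinite ν]

omit [SigmaFinite μ] [SigmaFinite ν] in
theorem memLp_mul_prod {f : X → ℂ} {g : Y → ℂ} (hf : MemLp f 2 μ) (hg : MemLp g 2 ν) :
    MemLp (fun p : X × Y => f p.1 * g p.2) 2 (μ.prod ν) := by
  have hm : AEStronglyMeasurable (fun p : X × Y => f p.1 * g p.2) (μ.prod ν) :=
    hf.1.comp_fst.mul hg.1.comp_snd
  rw [memLp_two_iff_integrable_sq_norm hm]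
  have h1 := (memLp_two_iff_integrable_sq_norm hf.1).1 hf
  have h2 := (memLp_two_iff_integrable_sq_norm hg.1).1 hg
  refine (h1.mul_prod h2).congr (.of_forall fun p => ?_)
  simp only [norm_mul, mul_pow]

omit [SigmaFinite μ] [SigmaFinite ν] in
theorem ae_prod_of_ae {p : X → Prop} {q : Y → Prop} (hp : ∀ᵐ x ∂μ, p x) (hq : ∀ᵐ y ∂ν, q y) :
    ∀ᵐ z ∂μ.prod ν, p z.1 ∧ q z.2 := by
  filter_upwards [Measure.quasiMeasurePreserving_fst.ae hp,
    Measure.quasiMeasurePreserving_snd.ae hq] with z h1 h2 using ⟨h1, h2⟩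

variable (μ ν) in
/-- The product function `f(x) g(y)`, as a bilinear map of `L²` spaces. -/
def mulL2 : L2 μ →ₗ[ℂ] L2 ν →ₗ[ℂ] L2 (μ.prod ν) :=
  LinearMap.mk₂ ℂ (fun f g => (memLp_mul_prod (Lp.memLp f) (Lp.memLp g)).toLp)
    (fun f f' g => by
      rw [← MemLp.toLp_add]
      refine MemLp.toLp_congr _ _ ?_
      filter_upwards [ae_prod_of_ae (ν := ν) (q := fun _ => True) (Lp.coeFn_add f f')
        (.of_forall fun _ => trivial)] with z hz
      rw [hz.1]
      exact add_mul _ _ _)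
    (fun c f g => by
      rw [← MemLp.toLp_const_smul]
      refine MemLp.toLp_congr _ _ ?_
      filter_upwards [ae_prod_of_ae (ν := ν) (q := fun _ => True) (Lp.coeFn_smul c f)
        (.of_forall fun _ => trivial)] with z hz
      rw [hz.1]
      exact mul_assoc _ _ _)
    (fun f g g' => by
      rw [← MemLp.toLp_add]
      refine MemLp.toLp_congr _ _ ?_
      filter_upwards [ae_prod_of_ae (μ := μ) (p := fun _ => True) (.of_forall fun _ => trivial)
        (Lp.coeFn_add g g')] with z hz
      rw [hz.2]
      exact mul_add _ _ _)
    (fun c f g => by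
      rw [← MemLp.toLp_const_smul]
      refine MemLp.toLp_congr _ _ ?_
      filter_upwards [ae_prod_of_ae (μ := μ) (p := fun _ => True) (.of_forall fun _ => trivial)
        (Lp.coeFn_smul c g)] with z hz
      rw [hz.2]
      exact mul_left_comm _ _ _)

omit [SigmaFinite μ] [SigmaFinite ν] in
theorem coeFn_mulL2 (f : L2 μ) (g : L2 ν) :
    mulL2 μ ν f g =ᵐ[μ.prod ν] fun p => f p.1 * g p.2 :=
  MemLp.coeFn_toLp (memLp_mul_prod (Lp.memLp f) (Lp.memLp g))

theorem inner_mulL2 (f f' : L2 μ) (g g' : L2 ν) :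
    inner ℂ (mulL2 μ ν f g) (mulL2 μ ν f' g') = inner ℂ f f' * inner ℂ g g' := by
  rw [L2.inner_def, L2.inner_def, L2.inner_def, ← integral_prod_mul]
  refine integral_congr_ae ?_
  filter_upwards [coeFn_mulL2 f g, coeFn_mulL2 f' g'] with p h1 h2
  rw [h1, h2]
  simp only [RCLike.inner_apply, map_mul]
  ring

omit [SigmaFinite μ] [SigmaFinite ν] in
theorem mulL2_toLp {f : X → ℂ} {g : Y → ℂ} (hf : MemLp f 2 μ) (hg : MemLp g 2 ν) :
    mulL2 μ ν hf.toLp hg.toLp = (memLp_mul_prod hf hg).toLp := by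
  refine MemLp.toLp_congr (memLp_mul_prod (Lp.memLp _) (Lp.memLp _)) (memLp_mul_prod hf hg) ?_
  filter_upwards [ae_prod_of_ae hf.coeFn_toLp hg.coeFn_toLp] with z hz
  rw [hz.1, hz.2]

/-- Indicators of finite rectangles are products, so `F` integrates to zero over them. A π-λ
argument inside one finite rectangle, where `F` is integrable, covers all measurable subsets, and
exhaustion by spanning sets removes the restriction. -/
theorem eq_zero_of_inner_mulL2 (F : L2 (μ.prod ν))
    (h : ∀ f g, inner ℂ (mulL2 μ ν f g) F = 0) : F = 0 := by
  have hint : ∀ s, μ.prod ν s < ∞ → IntegrableOn F s (μ.prod ν) := fun s hs =>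
    integrableOn_Lp_of_measure_ne_top F (by norm_num) hs.ne
  have hrect : ∀ s t, MeasurableSet s → MeasurableSet t → μ s < ∞ → ν t < ∞ →
      ∫ z in s ×ˢ t, F z ∂(μ.prod ν) = 0 := by
    intro s t hs ht hμ hν
    have hst : μ.prod ν (s ×ˢ t) ≠ ∞ := by
      rw [Measure.prod_prod]; exact ENNReal.mul_ne_top hμ.ne hν.ne
    rw [← L2.inner_indicatorConstLp_one (𝕜 := ℂ) (hs.prod ht) hst F,
      ← h (indicatorConstLp 2 hs hμ.ne 1) (indicatorConstLp 2 ht hν.ne 1)]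
    congr 1
    rw [indicatorConstLp, indicatorConstLp, indicatorConstLp, mulL2_toLp]
    refine MemLp.toLp_congr _ _ (.of_forall fun z => ?_)
    classical
    simp only [Set.indicator_apply, Set.mem_prod]
    split_ifs <;> simp_all
  have hmeas : ∀ S T, MeasurableSet S → MeasurableSet T → μ S < ∞ → ν T < ∞ →
      ∀ s, MeasurableSet s → ∫ z in s ∩ S ×ˢ T, F z ∂(μ.prod ν) = 0 := by
    intro S T hS hT hμ hν s hs
    have hST : μ.prod ν (S ×ˢ T) < ∞ := by
      rw [Measure.prod_prod]; exact ENNReal.mul_lt_top hμ hν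
    induction s, hs using MeasurableSpace.induction_on_inter generateFrom_prod.symm
      isPiSystem_prod with
    | empty => simp
    | basic s hs =>
      obtain ⟨A, hA, B, hB, rfl⟩ := hs
      rw [Set.prod_inter_prod]
      exact hrect _ _ (hA.inter hS) (hB.inter hT) ((measure_mono Set.inter_subset_right).trans_lt hμ)
        ((measure_mono Set.inter_subset_right).trans_lt hν)
    | compl s hs ih =>
      have h1 := integral_inter_add_sdiff (f := F) (s := S ×ˢ T) hs (hint _ hST)
      rw [Set.inter_comm, ih, zero_add, hrect S T hS hT hμ hν] at h1
      rw [← h1]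
      congr 2
      ext z
      simp only [Set.mem_inter_iff, Set.mem_compl_iff, Set.mem_sdiff]
      tauto
    | iUnion f hd hf ih =>
      rw [Set.iUnion_inter, integral_iUnion (fun i => (hf i).inter (hS.prod hT))
        (fun i j hij => (hd hij).mono Set.inter_subset_left Set.inter_subset_left)]
      · simp [ih]
      · exact hint _ ((measure_mono (Set.iUnion_subset fun i => Set.inter_subset_right)).trans_lt hST)
  rw [Lp.eq_zero_iff_ae_eq_zero]
  refine ae_eq_zero_of_forall_setIntegral_eq_of_sigmaFinite (fun s _ hs => hint s hs) ?_
  intro s hs hfin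
  let R : ℕ → Set (X × Y) := fun n => s ∩ spanningSets μ n ×ˢ spanningSets ν n
  have hR : ∀ n, MeasurableSet (R n) := fun n =>
    hs.inter ((measurableSet_spanningSets μ n).prod (measurableSet_spanningSets ν n))
  have hmono : Monotone R := fun m n hmn => Set.inter_subset_inter_right _
    (Set.prod_mono (monotone_spanningSets μ hmn) (monotone_spanningSets ν hmn))
  have hU : ⋃ n, R n = s := by
    rw [← Set.inter_iUnion]
    refine Set.inter_eq_left.2 fun z _ => ?_
    have h1 : z.1 ∈ ⋃ n, spanningSets μ n := by rw [iUnion_spanningSets]; trivial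
    have h2 : z.2 ∈ ⋃ n, spanningSets ν n := by rw [iUnion_spanningSets]; trivial
    obtain ⟨m, hm⟩ := Set.mem_iUnion.1 h1
    obtain ⟨n, hn⟩ := Set.mem_iUnion.1 h2
    exact Set.mem_iUnion.2 ⟨max m n, monotone_spanningSets μ (le_max_left _ _) hm,
      monotone_spanningSets ν (le_max_right _ _) hn⟩
  have ht := tendsto_setIntegral_of_monotone hR hmono (f := F) (μ := μ.prod ν)
    (by rw [hU]; exact hint s hfin)
  rw [hU] at ht
  refine tendsto_nhds_unique ht ?_
  have h0 : ∀ n, ∫ z in R n, F z ∂(μ.prod ν) = 0 := fun n =>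
    hmeas _ _ (measurableSet_spanningSets μ n) (measurableSet_spanningSets ν n)
      (measure_spanningSets_lt_top μ n) (measure_spanningSets_lt_top ν n) s hs
  simp only [h0]
  exact tendsto_const_nhds

theorem exists_tensorL2 (μ : Measure X) (ν : Measure Y) [SigmaFinite μ] [SigmaFinite ν] :
    ∃ J : tensor (L2 μ) (L2 ν) ≃ₗᵢ[ℂ] L2 (μ.prod ν), ∀ f g, J (tmul f g) = mulL2 μ ν f g := by
  obtain ⟨J, hJ⟩ := exists_tensorLift (mulL2 μ ν) inner_mulL2
  exact ⟨LinearIsometryEquiv.ofSurjective J (surjective_of_orthogonal _ fun F hF =>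
    eq_zero_of_inner_mulL2 F fun f g => by rw [← hJ]; exact hF _), hJ⟩

variable (μ ν) in
/-- The unitary `L²(μ) ⊗ L²(ν) ≃ L²(μ × ν)`. -/
def tensorL2 : tensor (L2 μ) (L2 ν) ≃ₗᵢ[ℂ] L2 (μ.prod ν) := (exists_tensorL2 μ ν).choose

@[simp] theorem tensorL2_tmul (f : L2 μ) (g : L2 ν) :
    tensorL2 μ ν (tmul f g) = mulL2 μ ν f g := (exists_tensorL2 μ ν).choose_spec f g

/-! ### Weighted composition operators -/

omit [SigmaFinite μ] [SigmaFinite ν] in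
theorem memLp_wcomp {τ : X → Y} (hτ : MeasurePreserving τ μ ν) {ρ : X → ℂ} (hρ : Measurable ρ)
    (hρ1 : ∀ x, ‖ρ x‖ = 1) {f : Y → ℂ} (hf : MemLp f 2 ν) :
    MemLp (fun x => ρ x * f (τ x)) 2 μ :=
  (hf.comp_measurePreserving hτ).of_le
    (hρ.aestronglyMeasurable.mul (hf.1.comp_measurePreserving hτ))
    (.of_forall fun x => by simp [hρ1])

/-- The isometry `Ψ ↦ ρ · (Ψ ∘ τ)` for a measure-preserving map `τ` and a phase factor `ρ`. -/
def wcomp (τ : X → Y) (hτ : MeasurePreserving τ μ ν) (ρ : X → ℂ) (hρ : Measurable ρ)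
    (hρ1 : ∀ x, ‖ρ x‖ = 1) : L2 ν →ₗᵢ[ℂ] L2 μ where
  toFun f := (memLp_wcomp hτ hρ hρ1 (Lp.memLp f)).toLp
  map_add' f g := by
    rw [← MemLp.toLp_add]
    refine MemLp.toLp_congr _ _ ?_
    filter_upwards [hτ.quasiMeasurePreserving.ae (Lp.coeFn_add f g)] with x hx
    rw [hx]
    exact mul_add _ _ _
  map_smul' c f := by
    rw [RingHom.id_apply, ← MemLp.toLp_const_smul]
    refine MemLp.toLp_congr _ _ ?_
    filter_upwards [hτ.quasiMeasurePreserving.ae (Lp.coeFn_smul c f)] with x hx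
    rw [hx]
    exact mul_left_comm _ _ _
  norm_map' f := by
    change ‖(memLp_wcomp hτ hρ hρ1 (Lp.memLp f)).toLp‖ = ‖f‖
    rw [Lp.norm_toLp, Lp.norm_def, ← eLpNorm_comp_measurePreserving (Lp.memLp f).1 hτ]
    congr 1
    exact eLpNorm_congr_norm_ae (.of_forall fun x => by simp [hρ1])

omit [SigmaFinite μ] [SigmaFinite ν] in
theorem coeFn_wcomp {τ : X → Y} {hτ : MeasurePreserving τ μ ν} {ρ : X → ℂ} {hρ : Measurable ρ}
    {hρ1 : ∀ x, ‖ρ x‖ = 1} (f : L2 ν) :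
    wcomp τ hτ ρ hρ hρ1 f =ᵐ[μ] fun x => ρ x * f (τ x) :=
  MemLp.coeFn_toLp (memLp_wcomp hτ hρ hρ1 (Lp.memLp f))

end LTwo

end BosonicGaussian

end

noncomputable section

namespace BosonicGaussian

open QSystem ContinuousLinearMap InnerProductSpace

/-! ### Operator identities from pointwise identities of maps and phases -/

section IsWComp

variable {X Y Z X' Y' : Type} [MeasurableSpace X] [MeasurableSpace Y] [MeasurableSpace Z]
  [MeasurableSpace X'] [MeasurableSpace Y']
  {μ : Measure X} {ν : Measure Y} {κ : Measure Z} {μ' : Measure X'} {ν' : Measure Y'}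

/-- `U` is the weighted composition operator `f ↦ ρ · (f ∘ τ)`. -/
structure IsWComp (U : L2 ν →L[ℂ] L2 μ) (τ : X → Y) (ρ : X → ℂ) : Prop where
  mp : MeasurePreserving τ μ ν
  meas : Measurable ρ
  coeFn : ∀ f, U f =ᵐ[μ] fun x => ρ x * f (τ x)

theorem isWComp_wcomp {τ : X → Y} (hτ : MeasurePreserving τ μ ν) {ρ : X → ℂ} (hρ : Measurable ρ)
    (hρ1 : ∀ x, ‖ρ x‖ = 1) : IsWComp (wcomp τ hτ ρ hρ hρ1).toContinuousLinearMap τ ρ :=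
  ⟨hτ, hρ, fun f => coeFn_wcomp (hτ := hτ) (hρ := hρ) (hρ1 := hρ1) f⟩

theorem isWComp_id : IsWComp (.id ℂ (L2 μ)) id fun _ => 1 :=
  ⟨.id μ, measurable_const, fun _ => .of_forall fun _ => (one_mul _).symm⟩

theorem isWComp_weyl (a b : ℝ) : IsWComp (weyl a b) (fun x => x + b)
    fun x => Complex.exp (Complex.I * ((a * x + a * b / 2 : ℝ) : ℂ)) :=
  ⟨measurePreserving_add_right volume b, (by fun_prop : Continuous _).measurable,
    fun f => MemLp.coeFn_toLp (memLp_weylFun a b f)⟩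

theorem IsWComp.comp {U : L2 ν →L[ℂ] L2 μ} {W : L2 κ →L[ℂ] L2 ν} {τ : X → Y} {σ : Y → Z}
    {ρ : X → ℂ} {θ : Y → ℂ} (hU : IsWComp U τ ρ) (hW : IsWComp W σ θ) :
    IsWComp (U ∘L W) (σ ∘ τ) fun x => ρ x * θ (τ x) := by
  refine ⟨hW.mp.comp hU.mp, hU.meas.mul (hW.meas.comp hU.mp.measurable), fun f => ?_⟩
  filter_upwards [hU.coeFn (W f), hU.mp.quasiMeasurePreserving.ae (hW.coeFn f)] with x h1 h2
  rw [ContinuousLinearMap.comp_apply, h1, h2, mul_assoc]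
  rfl

theorem IsWComp.ext {U U' : L2 ν →L[ℂ] L2 μ} {τ τ' : X → Y} {ρ ρ' : X → ℂ} (h : IsWComp U τ ρ)
    (h' : IsWComp U' τ' ρ') (hτ : ∀ x, τ x = τ' x) (hρ : ∀ x, ρ x = ρ' x) : U = U' := by
  refine ContinuousLinearMap.ext fun f => Lp.ext ?_
  filter_upwards [h.coeFn f, h'.coeFn f] with x h1 h2
  rw [h1, h2, hτ, hρ]

variable [SigmaFinite μ] [SigmaFinite ν] [SigmaFinite μ'] [SigmaFinite ν']

variable (μ ν) in
/-- The unitary `tensorL2` as a bounded operator. -/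
def tensorL2L : tensor (L2 μ) (L2 ν) →L[ℂ] L2 (μ.prod ν) :=
  (tensorL2 μ ν).toLinearIsometry.toContinuousLinearMap

variable (μ ν) in
/-- The inverse of `tensorL2` as a bounded operator. -/
def tensorL2Inv : L2 (μ.prod ν) →L[ℂ] tensor (L2 μ) (L2 ν) :=
  (tensorL2 μ ν).symm.toLinearIsometry.toContinuousLinearMap

@[simp] theorem tensorL2L_inv (f : L2 (μ.prod ν)) : tensorL2L μ ν (tensorL2Inv μ ν f) = f :=
  (tensorL2 μ ν).apply_symm_apply f

@[simp] theorem tensorL2Inv_L (z : tensor (L2 μ) (L2 ν)) : tensorL2Inv μ ν (tensorL2L μ ν z) = z :=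
  (tensorL2 μ ν).symm_apply_apply z

theorem tensorL2L_tmul (f : L2 μ) (g : L2 ν) : tensorL2L μ ν (tmul f g) = mulL2 μ ν f g :=
  tensorL2_tmul f g

/-- Intertwining relations are verified for functions of two variables, where both sides are
weighted compositions, and transported back to the tensor product. -/
theorem comp_eq_of_conj {X₁ : tensor (L2 μ) (L2 ν) →L[ℂ] tensor (L2 μ) (L2 ν)}
    {X₂ : tensor (L2 μ') (L2 ν') →L[ℂ] tensor (L2 μ') (L2 ν')}
    {U : L2 (μ'.prod ν') →L[ℂ] L2 (μ.prod ν)}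
    (h : (tensorL2L μ ν ∘L X₁ ∘L tensorL2Inv μ ν) ∘L U =
      U ∘L (tensorL2L μ' ν' ∘L X₂ ∘L tensorL2Inv μ' ν')) :
    X₁ ∘L (tensorL2Inv μ ν ∘L U ∘L tensorL2L μ' ν') =
      (tensorL2Inv μ ν ∘L U ∘L tensorL2L μ' ν') ∘L X₂ := by
  refine ContinuousLinearMap.ext fun z => ?_
  have h4 := congrArg (tensorL2Inv μ ν)
    (congrFun (congrArg DFunLike.coe h) (tensorL2L μ' ν' z))
  refine (tensorL2Inv_L _).symm.trans (h4.trans ?_)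
  exact congrArg (fun w => tensorL2Inv μ ν (U (tensorL2L μ' ν' (X₂ w)))) (tensorL2Inv_L z)

theorem isWComp_tmap {U : L2 ν →L[ℂ] L2 μ} {W : L2 ν' →L[ℂ] L2 μ'} {τ : X → Y}
    {σ : X' → Y'} {ρ : X → ℂ} {θ : X' → ℂ} (hU : IsWComp U τ ρ) (hW : IsWComp W σ θ)
    (hρ1 : ∀ x, ‖ρ x‖ = 1) (hθ1 : ∀ x, ‖θ x‖ = 1) :
    IsWComp (tensorL2L μ μ' ∘L tmap U W ∘L tensorL2Inv ν ν') (Prod.map τ σ)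
      fun z => ρ z.1 * θ z.2 := by
  have hmp := hU.mp.prod hW.mp
  have hm : Measurable fun z : X × X' => ρ z.1 * θ z.2 :=
    (hU.meas.comp measurable_fst).mul (hW.meas.comp measurable_snd)
  have h1 : ∀ z : X × X', ‖ρ z.1 * θ z.2‖ = 1 := fun z => by rw [norm_mul, hρ1, hθ1, one_mul]
  have key : tensorL2L μ μ' ∘L tmap U W =
      (wcomp _ hmp _ hm h1).toContinuousLinearMap ∘L tensorL2L ν ν' := by
    refine clm_ext_tmul fun a b => ?_
    rw [ContinuousLinearMap.comp_apply, ContinuousLinearMap.comp_apply, tmap_tmul, tensorL2L_tmul,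
      tensorL2L_tmul]
    refine Lp.ext ?_
    filter_upwards [coeFn_mulL2 (μ := μ) (ν := μ') (U a) (W b),
      (isWComp_wcomp hmp hm h1).coeFn (mulL2 ν ν' a b),
      hmp.quasiMeasurePreserving.ae (coeFn_mulL2 (μ := ν) (ν := ν') a b),
      ae_prod_of_ae (hU.coeFn a) (hW.coeFn b)] with z e1 e2 e3 e4
    rw [e1, e2, e3, e4.1, e4.2, Prod.map_fst, Prod.map_snd]
    ring
  have : tensorL2L μ μ' ∘L tmap U W ∘L tensorL2Inv ν ν' =
      (wcomp _ hmp _ hm h1).toContinuousLinearMap := by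
    refine ContinuousLinearMap.ext fun f => ?_
    have := congrFun (congrArg DFunLike.coe key) (tensorL2Inv ν ν' f)
    rw [ContinuousLinearMap.comp_apply, ContinuousLinearMap.comp_apply, tensorL2L_inv] at this
    exact this
  rw [this]
  exact isWComp_wcomp hmp hm h1

theorem norm_weylPhase (a b x : ℝ) :
    ‖Complex.exp (Complex.I * ((a * x + a * b / 2 : ℝ) : ℂ))‖ = 1 := by
  rw [mul_comm Complex.I, Complex.norm_exp_ofReal_mul_I]

end IsWComp

/-! ### The vacuum -/

/-- The wave function of the vacuum. -/
def vacFun (x : ℝ) : ℂ := ((Real.pi ^ (-(1 / 4 : ℝ)) * Real.exp (-x ^ 2 / 2) : ℝ) : ℂ)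

theorem continuous_vacFun : Continuous vacFun := by unfold vacFun; fun_prop

theorem vacFun_mul (x y : ℝ) : vacFun x * vacFun y =
    ((Real.pi ^ (-(1 / 2 : ℝ)) : ℝ) : ℂ) * Complex.exp (-x ^ 2 / 2 - y ^ 2 / 2) := by
  have h : Real.pi ^ (-(1 / 2 : ℝ)) = Real.pi ^ (-(1 / 4 : ℝ)) * Real.pi ^ (-(1 / 4 : ℝ)) := by
    rw [← Real.rpow_add Real.pi_pos]; norm_num
  rw [vacFun, vacFun, h, sub_eq_add_neg, Complex.exp_add]
  push_cast
  rw [neg_div]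
  ring_nf

theorem conj_vacFun (x : ℝ) : (starRingEnd ℂ) (vacFun x) = vacFun x := Complex.conj_ofReal _

theorem memLp_vacFun : MemLp vacFun 2 volume := by
  rw [memLp_two_iff_integrable_sq_norm continuous_vacFun.aestronglyMeasurable]
  have h : (fun x => ‖vacFun x‖ ^ 2) =
      fun x => Real.pi ^ (-(1 / 2 : ℝ)) * Real.exp (-1 * x ^ 2) := by
    ext x
    have := vacFun_mul x x
    rw [vacFun, Complex.norm_real, Real.norm_eq_abs, sq_abs, pow_two]
    apply Complex.ofReal_injective
    rw [Complex.ofReal_mul, ← vacFun, this]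
    push_cast
    congr 2
    ring
  rw [h]
  exact (integrable_exp_neg_mul_sq one_pos).const_mul _

/-- The vacuum state vector. -/
def vac : mode := memLp_vacFun.toLp

/-- A Gaussian integral: the characteristic function of the vacuum. All Gaussian noise factors below
come from it. -/
theorem inner_vac_weyl (s t : ℝ) :
    inner ℂ vac (weyl s t vac) = (Real.exp (-(s ^ 2 + t ^ 2) / 4) : ℂ) := by
  have h0 : (vac : ℝ → ℂ) =ᵐ[volume] vacFun := memLp_vacFun.coeFn_toLp
  have h1 : inner ℂ vac (weyl s t vac) = ∫ x : ℝ, ((Real.pi ^ (-(1 / 2 : ℝ)) : ℝ) : ℂ) *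
      Complex.exp (-1 * x ^ 2 + (Complex.I * s - t) * x + (-t ^ 2 / 2 + Complex.I * s * t / 2)) := by
    rw [L2.inner_def]
    refine integral_congr_ae ?_
    filter_upwards [h0, (isWComp_weyl s t).coeFn vac,
      (measurePreserving_add_right volume t).quasiMeasurePreserving.ae h0] with x e1 e2 e3
    rw [RCLike.inner_apply, e1, e2, e3, conj_vacFun, mul_assoc, mul_comm (vacFun (x + t)),
      vacFun_mul, mul_left_comm, ← Complex.exp_add]
    congr 2
    push_cast
    ring
  rw [h1, integral_const_mul, integral_cexp_quadratic (by simp)]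
  have h2 : ((Real.pi : ℂ) / -(-1)) ^ (1 / 2 : ℂ) = ((Real.pi ^ (1 / 2 : ℝ) : ℝ) : ℂ) := by
    rw [Complex.ofReal_cpow Real.pi_pos.le]; norm_num
  rw [h2, ← mul_assoc, ← Complex.ofReal_mul, ← Real.rpow_add Real.pi_pos]
  norm_num
  congr 1
  have : Complex.I ^ 2 = -1 := Complex.I_sq
  linear_combination (s ^ 2 / 4 : ℂ) * this

theorem norm_vac : ‖vac‖ = 1 := by
  have h : weyl 0 0 vac = vac := by
    refine Lp.ext ?_
    filter_upwards [(isWComp_weyl 0 0).coeFn vac] with x hx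
    rw [hx]; simp
  have := inner_vac_weyl 0 0
  rw [h, inner_self_eq_norm_sq_to_K] at this
  have h2 : ‖vac‖ ^ 2 = 1 :=
    Complex.ofReal_injective ((Complex.ofReal_pow _ _).trans (this.trans (by norm_num)))
  nlinarith [norm_nonneg vac]

/-! ### Beam splitters and two-mode squeezers -/

theorem measurePreserving_linear (a b c d : ℝ) (h : a * d - b * c = 1) :
    MeasurePreserving (fun z : ℝ × ℝ => (a * z.1 + b * z.2, c * z.1 + d * z.2))
      (volume.prod volume) (volume.prod volume) := by
  let L := Matrix.toLin (Module.Basis.finTwoProd ℝ) (Module.Basis.finTwoProd ℝ) !![a, b; c, d]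
  have hL : (L : ℝ × ℝ → ℝ × ℝ) = fun z => (a * z.1 + b * z.2, c * z.1 + d * z.2) := by
    ext z <;> simp [L, Matrix.toLin_finTwoProd_apply]
  have hdet : LinearMap.det L = 1 := by
    rw [LinearMap.det_toLin, Matrix.det_fin_two_of, h]
  rw [← hL]
  refine ⟨L.continuous_of_finiteDimensional.measurable, ?_⟩
  have := Measure.map_linearMap_addHaar_eq_smul_addHaar (volume.prod volume : Measure (ℝ × ℝ))
    (f := L) (by rw [hdet]; exact one_ne_zero)
  rw [this, hdet]
  simp

/-- Moving `X` through `R` turns it into `A ⊗ B`; the ancilla prepared in `g` then contributes only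
the number `⟨g, B g⟩`. -/
theorem adjoint_comp_of_intertwine {H F K : QSystem} (R : tensor H F →L[ℂ] K)
    (hR : ∀ z, ‖R z‖ = ‖z‖) (g : F) (X : K →L[ℂ] K) (A : H →L[ℂ] H)
    (B : F →L[ℂ] F) (h : X ∘L R = R ∘L tmap A B) :
    adjoint (R ∘L tmulRight H g) ∘L X ∘L (R ∘L tmulRight H g) = inner ℂ g (B g) • A := by
  have hRR := adjoint_comp_self_of_isometry R hR
  refine ContinuousLinearMap.ext fun f => ext_inner_left ℂ fun f' => ?_
  have e1 : X (R (tmul f g)) = R (tmul (A f) (B g)) := by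
    rw [← tmap_tmul]
    exact congrFun (congrArg DFunLike.coe h) (tmul f g)
  have e2 : inner ℂ (R (tmul f' g)) (R (tmul (A f) (B g))) =
      inner ℂ (tmul f' g) (tmul (A f) (B g)) := by
    rw [← ContinuousLinearMap.adjoint_inner_right]
    congr 1
    exact congrFun (congrArg DFunLike.coe hRR) _
  rw [ContinuousLinearMap.comp_apply, ContinuousLinearMap.adjoint_inner_right,
    smul_apply, inner_smul_right, mul_comm, ← inner_tmul, ← e2, ← e1]
  rfl

/-- The channel acts on characteristic functions by
`χ (ξ) ↦ χ (√x ξ) exp (- y |ξ|² / 4)`. -/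
def IsPI (x y : ℝ) (Λ : QChannel mode mode) : Prop :=
  ∀ (T : TraceClass mode) (a b : ℝ),
    trace (weyl a b ∘L op (Λ.toLin T)) =
      (Real.exp (-y * (a ^ 2 + b ^ 2) / 4) : ℂ) * trace (weyl (√x * a) (√x * b) ∘L op T)

theorem isPI_of_dilation {E : QSystem} {x y : ℝ} {Λ : QChannel mode mode}
    {V : mode →ₗᵢ[ℂ] tensor mode E} (hV : IsStinespring Λ E V)
    (h : ∀ a b, adjoint V.toContinuousLinearMap ∘L tmap (weyl a b) (.id ℂ E) ∘L
      V.toContinuousLinearMap =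
        (Real.exp (-y * (a ^ 2 + b ^ 2) / 4) : ℂ) • weyl (√x * a) (√x * b)) : IsPI x y Λ := by
  intro T a b
  have h2 := trace_smul (Real.exp (-y * (a ^ 2 + b ^ 2) / 4) : ℂ)
    (T.2.comp_left (weyl (√x * a) (√x * b)))
  rw [hV, trace_comp_conj, h, smul_comp]
  exact h2

/-- A linear change of the two position variables permutes Weyl operators. The determinant condition
makes it unitary and also matches the phases. -/
theorem exists_linear_dilation (a b c d : ℝ) (h : a * d - b * c = 1) :
    ∃ R : tensor mode mode →ₗᵢ[ℂ] tensor mode mode, ∀ s t,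
      tmap (weyl s t) (.id ℂ mode) ∘L R.toContinuousLinearMap = R.toContinuousLinearMap ∘L
        tmap (weyl (d * s) (a * t)) (weyl (-b * s) (c * t)) := by
  let U := wcomp _ (measurePreserving_linear a b c d h) (fun _ => 1) measurable_const
    fun _ => norm_one
  have hU := isWComp_wcomp (measurePreserving_linear a b c d h) (measurable_const (a := (1 : ℂ)))
    fun _ => norm_one
  suffices h0 : ∀ s t, tmap (weyl s t) (.id ℂ mode) ∘L (tensorL2Inv volume volume ∘L
      U.toContinuousLinearMap ∘L tensorL2L volume volume) = (tensorL2Inv volume volume ∘L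
        U.toContinuousLinearMap ∘L tensorL2L volume volume) ∘L
          tmap (weyl (d * s) (a * t)) (weyl (-b * s) (c * t)) from
    ⟨(tensorL2 volume volume).symm.toLinearIsometry.comp
      (U.comp (tensorL2 volume volume).toLinearIsometry), h0⟩
  intro s t
  have h1 := (isWComp_tmap (isWComp_weyl s t) (isWComp_id (μ := (volume : Measure ℝ)))
    (norm_weylPhase s t) fun _ => norm_one).comp hU
  have h2 := hU.comp (isWComp_tmap (isWComp_weyl (d * s) (a * t)) (isWComp_weyl (-b * s) (c * t))
    (norm_weylPhase _ _) (norm_weylPhase _ _))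
  have h3 := h1.ext h2 (fun z => by ext <;> simp <;> ring) fun z => by
    dsimp only
    rw [← Complex.exp_add, mul_one, mul_one, one_mul]
    congr 1
    push_cast
    have h' : (a : ℂ) * d - b * c = 1 := by exact_mod_cast h
    linear_combination (-Complex.I * s * z.1 - Complex.I * s * t / 2) * h'
  exact comp_eq_of_conj h3

/-- With a vacuum ancilla, `c = -b` is a rotation, i.e. a beam splitter, and `c = b` is hyperbolic,
i.e. a two-mode squeezer. The condition `c² = b²` gives both quadratures the same noise. -/
theorem exists_isPI_linear (a b c : ℝ) (h : a * a - b * c = 1) (ha : 0 ≤ a) (hbc : c ^ 2 = b ^ 2) :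
    ∃ (Λ : QChannel mode mode) (E : QSystem) (V : mode →ₗᵢ[ℂ] tensor mode E),
      IsStinespring Λ E V ∧ IsPI (a ^ 2) (b ^ 2) Λ := by
  obtain ⟨R, hR⟩ := exists_linear_dilation a b c a h
  let V : mode →ₗᵢ[ℂ] tensor mode mode := R.comp
    ⟨(tmulRight mode vac).toLinearMap, fun f => by
      change ‖tmul f vac‖ = ‖f‖
      rw [norm_tmul, norm_vac, mul_one]⟩
  refine ⟨chanOfIsometry V, mode, V, isStinespring_chanOfIsometry V,
    isPI_of_dilation (isStinespring_chanOfIsometry V) fun s t => ?_⟩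
  have h1 := adjoint_comp_of_intertwine R.toContinuousLinearMap R.norm_map vac _ _ _ (hR s t)
  rw [inner_vac_weyl] at h1
  rw [Real.sqrt_sq ha]
  have h2 : -((-b * s) ^ 2 + (c * t) ^ 2) / 4 = -b ^ 2 * (s ^ 2 + t ^ 2) / 4 := by
    rw [mul_pow c, hbc]; ring
  rw [h2] at h1
  exact h1

/-- The quantum-limited attenuator. -/
theorem exists_isPI_loss {x : ℝ} (h0 : 0 ≤ x) (h1 : x ≤ 1) :
    ∃ (Λ : QChannel mode mode) (E : QSystem) (V : mode →ₗᵢ[ℂ] tensor mode E),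
      IsStinespring Λ E V ∧ IsPI x (1 - x) Λ := by
  have e0 := Real.sq_sqrt h0
  have e1 := Real.sq_sqrt (sub_nonneg.2 h1)
  have := exists_isPI_linear √x √(1 - x) (-√(1 - x)) (by nlinarith) (Real.sqrt_nonneg _)
    (by ring)
  rwa [e0, e1] at this

/-- The quantum-limited amplifier. -/
theorem exists_isPI_amp {x : ℝ} (h1 : 1 ≤ x) :
    ∃ (Λ : QChannel mode mode) (E : QSystem) (V : mode →ₗᵢ[ℂ] tensor mode E),
      IsStinespring Λ E V ∧ IsPI x (x - 1) Λ := by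
  have e0 := Real.sq_sqrt (zero_le_one.trans h1)
  have e1 := Real.sq_sqrt (sub_nonneg.2 h1)
  have := exists_isPI_linear √x √(x - 1) √(x - 1) (by nlinarith) (Real.sqrt_nonneg _) rfl
  rwa [e0, e1] at this

/-- The second channel evaluates the output of the first at `√x' ξ`, which multiplies the first
noise by `x'`. -/
theorem IsPI.comp {x y x' y' : ℝ} {Λ Λ' : QChannel mode mode} (hx' : 0 ≤ x')
    (h' : IsPI x' y' Λ') (h : IsPI x y Λ) : IsPI (x' * x) (x' * y + y') (Λ'.comp Λ) := by
  intro T a b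
  refine (h' (Λ.toLin T) a b).trans ?_
  rw [h, ← mul_assoc, ← Complex.ofReal_mul, ← Real.exp_add, Real.sqrt_mul hx']
  congr 3
  · rw [mul_pow, mul_pow, Real.sq_sqrt hx']; ring
  · congr 1 <;> ring

end BosonicGaussian


end

noncomputable section

namespace BosonicGaussian

open QSystem ContinuousLinearMap InnerProductSpace

/-! ### Criteria for entanglement breaking -/

section Criteria

variable {A H H' K F : QSystem}

theorem IsEB.comp_right {V : H →L[ℂ] tensor K F} (hV : IsEB V) (S : H' →L[ℂ] H) :
    IsEB (V ∘L S) := by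
  intro A u
  have h : tmap (.id ℂ A) (V ∘L S) u = tmap (.id ℂ A) V (tmap (.id ℂ A) S u) := by
    rw [tmap_tmap, id_comp]
  rw [h]
  exact hV A _

theorem isEB_of_dense {V : H →L[ℂ] tensor K F}
    (h : ∀ (A : QSystem) (x : A ⊗[ℂ] H), tmap (.id ℂ A) V ((x : Completion (A ⊗[ℂ] H))) ∈
      closure (sepSums A K F)) : IsEB V := by
  intro A u
  refine (denseRange_toComplL (A ⊗[ℂ] H)).induction_on
    (p := fun u => tmap (.id ℂ A) V u ∈ closure (sepSums A K F)) u
    (isClosed_closure.preimage (tmap (.id ℂ A) V).continuous) (h A)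

/-- Strong convergence on `H` gives convergence on algebraic tensors, where membership in the closed
set passes to the limit; continuity of `V` extends it to the completion. No uniform bound on `W n`
is needed. -/
theorem isEB_of_tendsto {V : H →L[ℂ] tensor K F} {W : ℕ → H →L[ℂ] tensor K F}
    (hW : ∀ n, IsEB (W n)) (hV : ∀ f, Filter.Tendsto (fun n => W n f) .atTop (nhds (V f))) :
    IsEB V := by
  refine isEB_of_dense fun A x => ?_
  have ht : Filter.Tendsto (fun n => tmap (.id ℂ A) (W n) ((x : Completion (A ⊗[ℂ] H)))) .atTop
      (nhds (tmap (.id ℂ A) V ((x : Completion (A ⊗[ℂ] H))))) := by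
    induction x using TensorProduct.induction_on with
    | zero =>
      rw [Completion.coe_zero, map_zero]
      simp only [map_zero]
      exact tendsto_const_nhds
    | add x y hx hy =>
      rw [Completion.coe_add, map_add]
      simp only [map_add]
      exact hx.add hy
    | tmul a f =>
      have h1 : ∀ U : H →L[ℂ] tensor K F, tmap (.id ℂ A) U
          ((a ⊗ₜ[ℂ] f : A ⊗[ℂ] H) : Completion (A ⊗[ℂ] H)) = tmul a (U f) := fun U =>
        tmap_tmul (.id ℂ A) U a f
      rw [h1]
      simp only [h1]
      exact ((tmulLeft (tensor K F) a).continuous.tendsto _).comp (hV f)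
  exact isClosed_closure.mem_of_tendsto ht (.of_forall fun n => hW n A _)

/-- The prepared vector `k l` depends only on the label `l`, which the environment knows. For a
finite tensor, expanding the vectors `P l φ` in orthonormal bases of their finite-dimensional spans
displays the separable sum. -/
theorem isEB_sum_tmulLeft {ι : Type} (s : Finset ι) (k : ι → K) (P : ι → H →L[ℂ] F)
    (hP : ∀ l l', l ≠ l' → ∀ x y, inner ℂ (P l x) (P l' y) = 0) :
    IsEB (∑ l ∈ s, tmulLeft F (k l) ∘L P l) := by
  refine isEB_of_dense fun A x => subset_closure ?_
  obtain ⟨S, rfl⟩ := TensorProduct.exists_finset x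
  let φ : S → H := fun m => m.1.2
  let W : ι → Submodule ℂ F := fun l => Submodule.span ℂ (Set.range fun m : S => P l (φ m))
  have hfin : ∀ l, FiniteDimensional ℂ (W l) := fun l =>
    FiniteDimensional.span_of_finite ℂ (Set.finite_range _)
  let e := fun l => stdOrthonormalBasis ℂ (W l)
  -- Each basis vector of `W l` lies in the range of `P l`, so `hP` makes vectors with different
  -- labels orthogonal.
  have hrange : ∀ l (w : W l), ∃ y, (w : F) = P l y := fun l w => by
    have : W l ≤ (P l).toLinearMap.range := Submodule.span_le.2 (by
      rintro _ ⟨m, rfl⟩; exact ⟨φ m, rfl⟩)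
    obtain ⟨y, hy⟩ := this w.2
    exact ⟨y, hy.symm⟩
  let v : ∀ l, S → W l := fun l m => ⟨P l (φ m), Submodule.subset_span ⟨m, rfl⟩⟩
  refine ⟨Σ l : s, Fin (Module.finrank ℂ (W l)), inferInstance,
    fun p => ∑ m : S, inner ℂ (e p.1 p.2) (v p.1 m) • m.1.1, fun p => k p.1,
    fun p => (e p.1 p.2 : W p.1), ?_, ?_⟩
  · rintro ⟨l, i⟩ ⟨l', j⟩ hne
    by_cases hl : l = l'
    · subst hl
      have hij : i ≠ j := fun h => hne (by rw [h])
      exact (e l).orthonormal.2 hij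
    · obtain ⟨y, hy⟩ := hrange l (e l i)
      obtain ⟨y', hy'⟩ := hrange l' (e l' j)
      dsimp only
      rw [hy, hy']
      exact hP _ _ (fun h => hl (Subtype.ext h)) _ _
  · have h1 : ((∑ p ∈ S, p.1 ⊗ₜ[ℂ] p.2 : A ⊗[ℂ] H) : Completion (A ⊗[ℂ] H)) =
        ∑ m : S, tmul m.1.1 (φ m) := by
      have h2 := map_sum (Completion.toComplL : A ⊗[ℂ] H →L[ℂ] Completion (A ⊗[ℂ] H))
        (fun p : A × H => p.1 ⊗ₜ[ℂ] p.2) S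
      exact h2.trans (Finset.sum_coe_sort S fun p : A × H => tmul p.1 p.2).symm
    have h3 : ∀ l m, P l (φ m) = ∑ i, inner ℂ (e l i) (v l m) • (e l i : F) := fun l m => by
      have := congrArg (Subtype.val : W l → F) ((e l).sum_repr' (v l m))
      rw [Submodule.coe_sum] at this
      exact this.symm
    rw [h1, map_sum, Fintype.sum_sigma]
    have h4 : ∀ m : S, tmap (.id ℂ A) (∑ l ∈ s, tmulLeft F (k l) ∘L P l) (tmul m.1.1 (φ m)) =
        ∑ l : s, ∑ i, inner ℂ (e l i) (v l m) • tmul m.1.1 (tmul (k l) (e l i : F)) := fun m => by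
      rw [tmap_tmul, sum_apply, tmul_sum_right, ← Finset.sum_coe_sort]
      refine Finset.sum_congr rfl fun l _ => ?_
      rw [ContinuousLinearMap.comp_apply, tmulLeft_apply, h3, tmul_sum_right, tmul_sum_right]
      refine Finset.sum_congr rfl fun i _ => ?_
      rw [tmul_smul_right, tmul_smul_right]
      rfl
    rw [Finset.sum_congr rfl fun m _ => h4 m, Finset.sum_comm]
    refine Finset.sum_congr rfl fun l _ => ?_
    rw [Finset.sum_comm]
    refine Finset.sum_congr rfl fun i _ => ?_
    rw [tmul_sum_left]
    refine Finset.sum_congr rfl fun m _ => ?_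
    rw [tmul_smul_left]

end Criteria

/-! ### Strong continuity of the Weyl operators on the vacuum -/

theorem norm_weyl (a b : ℝ) (φ : mode) : ‖weyl a b φ‖ = ‖φ‖ := by
  change ‖(memLp_weylFun a b φ).toLp‖ = ‖φ‖
  rw [Lp.norm_toLp, eLpNorm_weylFun, Lp.norm_def]

theorem weyl_add_apply (a b c d : ℝ) (φ : mode) : weyl (a + c) (b + d) φ =
    Complex.exp (-(Complex.I * ((b * c - a * d) / 2 : ℝ))) • weyl a b (weyl c d φ) := by
  refine Lp.ext ?_
  filter_upwards [(isWComp_weyl (a + c) (b + d)).coeFn φ,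
    ((isWComp_weyl a b).comp (isWComp_weyl c d)).coeFn φ,
    Lp.coeFn_smul (Complex.exp (-(Complex.I * ((b * c - a * d) / 2 : ℝ))))
      (weyl a b (weyl c d φ))] with x h1 h2 h3
  rw [h1, h3, Pi.smul_apply, ← ContinuousLinearMap.comp_apply, h2, smul_eq_mul, ← mul_assoc,
    ← mul_assoc, ← Complex.exp_add, ← Complex.exp_add, Function.comp_apply]
  congr 2
  · push_cast
    ring
  · rw [add_assoc]

theorem norm_weyl_sub_sq (l m : ℝ × ℝ) : ‖weyl l.1 l.2 vac - weyl m.1 m.2 vac‖ ^ 2 =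
    2 - 2 * (Complex.exp (-(Complex.I * ((l.2 * (m.1 - l.1) - l.1 * (m.2 - l.2)) / 2 : ℝ))) *
      (Real.exp (-((m.1 - l.1) ^ 2 + (m.2 - l.2) ^ 2) / 4) : ℂ)).re := by
  have h := weyl_add_apply l.1 l.2 (m.1 - l.1) (m.2 - l.2) vac
  rw [add_sub_cancel, add_sub_cancel] at h
  have hU : ∀ φ ψ : mode, inner ℂ (weyl l.1 l.2 φ) (weyl l.1 l.2 ψ) = inner ℂ φ ψ := fun φ ψ =>
    LinearIsometry.inner_map_map (⟨(weyl l.1 l.2).toLinearMap, norm_weyl l.1 l.2⟩ :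
      mode →ₗᵢ[ℂ] mode) φ ψ
  rw [norm_sub_sq (𝕜 := ℂ), norm_weyl, norm_weyl, norm_vac, h, inner_smul_right, hU, inner_vac_weyl]
  change 1 ^ 2 - 2 * (_ : ℂ).re + 1 ^ 2 = _
  ring

/-- By the Weyl relations the distance of two displaced vacua is an explicit continuous function.
Only displaced vacua are ever prepared, so this much continuity is enough. -/
theorem continuous_weyl_vac : Continuous fun l : ℝ × ℝ => weyl l.1 l.2 vac := by
  rw [continuous_iff_continuousAt]
  intro l
  rw [ContinuousAt, tendsto_iff_norm_sub_tendsto_zero]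
  have h : Filter.Tendsto (fun m : ℝ × ℝ => ‖weyl m.1 m.2 vac - weyl l.1 l.2 vac‖ ^ 2) (nhds l)
      (nhds 0) := by
    have hc : Continuous fun m : ℝ × ℝ => 2 - 2 *
      (Complex.exp (-(Complex.I * ((m.2 * (l.1 - m.1) - m.1 * (l.2 - m.2)) / 2 : ℝ))) *
        (Real.exp (-((l.1 - m.1) ^ 2 + (l.2 - m.2) ^ 2) / 4) : ℂ)).re := by fun_prop
    have := hc.tendsto l
    refine (this.congr fun m => (norm_weyl_sub_sq m l).symm).trans_eq ?_
    norm_num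
  have h2 := h.sqrt
  simpa using! h2

theorem coeFn_weyl_vac (l : ℝ × ℝ) : weyl l.1 l.2 vac =ᵐ[volume] weylFun l.1 l.2 vacFun := by
  filter_upwards [(isWComp_weyl l.1 l.2).coeFn vac,
    (measurePreserving_add_right volume l.2).quasiMeasurePreserving.ae
      (memLp_vacFun.coeFn_toLp)] with x h1 h2
  rw [h1]
  exact congrArg _ h2

end BosonicGaussian

end

noncomputable section

namespace BosonicGaussian

open QSystem ContinuousLinearMap InnerProductSpace

/-! ### Displacements controlled by the environment -/

section Controlled

variable {Y : Type} [MeasurableSpace Y] {ν : Measure Y} [SigmaFinite ν]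

theorem measurePreserving_shear {b : Y → ℝ} (hb : Measurable b) :
    MeasurePreserving (fun z : ℝ × Y => (z.1 + b z.2, z.2)) (volume.prod ν) (volume.prod ν) := by
  have h : MeasurePreserving (fun z : Y × ℝ => (z.1, z.2 + b z.1)) (ν.prod volume)
      (ν.prod volume) := by
    refine (MeasurePreserving.id ν).skew_product (g := fun y x => x + b y) ?_
      (.of_forall fun y => (measurePreserving_add_right volume (b y)).map_eq)
    exact measurable_snd.add (hb.comp measurable_fst)
  exact (Measure.measurePreserving_swap.comp h).comp Measure.measurePreserving_swap

/-- The phase factor of the Weyl operator `weyl l.1 l.2`. -/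
def weylPhase (l : ℝ × ℝ) (x : ℝ) : ℂ :=
  Complex.exp (Complex.I * ((l.1 * x + l.1 * l.2 / 2 : ℝ) : ℂ))

theorem norm_weylPhase' (l : ℝ × ℝ) (x : ℝ) : ‖weylPhase l x‖ = 1 := norm_weylPhase _ _ _

theorem measurable_weylPhase {s : Y → ℝ × ℝ} (hs : Measurable s) :
    Measurable fun z : ℝ × Y => weylPhase (s z.2) z.1 := by
  have hc : Continuous fun p : (ℝ × ℝ) × ℝ => weylPhase p.1 p.2 := by unfold weylPhase; fun_prop
  exact hc.measurable.comp ((hs.comp measurable_snd).prodMk measurable_fst)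

variable (ν) in
/-- The operator that applies `weyl (s y)` to the first factor, where `y` is the coordinate of the
second one. -/
def ctrlWeyl {s : Y → ℝ × ℝ} (hs : Measurable s) :
    L2 ((volume : Measure ℝ).prod ν) →ₗᵢ[ℂ] L2 ((volume : Measure ℝ).prod ν) :=
  wcomp (fun z : ℝ × Y => (z.1 + (s z.2).2, z.2)) (measurePreserving_shear hs.snd)
    (fun z => weylPhase (s z.2) z.1) (measurable_weylPhase hs) fun _ => norm_weylPhase' _ _

theorem isWComp_ctrlWeyl {s : Y → ℝ × ℝ} (hs : Measurable s) :
    IsWComp (ctrlWeyl ν hs).toContinuousLinearMap (fun z => (z.1 + (s z.2).2, z.2))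
      fun z => weylPhase (s z.2) z.1 :=
  isWComp_wcomp (measurePreserving_shear hs.snd) (measurable_weylPhase hs)
    fun _ => norm_weylPhase' _ _

variable (ν) in
/-- The isometry `φ ↦ ∫ (weyl (s y) vac) ⊗ φ (y) |y⟩ dy`. -/
def ctrlVac {s : Y → ℝ × ℝ} (hs : Measurable s) : L2 ν →ₗᵢ[ℂ] tensor mode (L2 ν) :=
  ((tensorL2 volume ν).symm.toLinearIsometry.comp
    ((ctrlWeyl ν hs).comp (tensorL2 volume ν).toLinearIsometry)).comp
    ⟨(tmulLeft (L2 ν) vac).toLinearMap, fun f => by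
      change ‖tmul vac f‖ = ‖f‖
      rw [norm_tmul, norm_vac, one_mul]⟩

theorem tensorL2L_ctrlVac {s : Y → ℝ × ℝ} (hs : Measurable s) (φ : L2 ν) :
    tensorL2L volume ν (ctrlVac ν hs φ) =
      ctrlWeyl ν hs (mulL2 volume ν vac φ) :=
  (tensorL2L_inv _).trans (congrArg (ctrlWeyl ν hs) (tensorL2L_tmul vac φ))

theorem coeFn_ctrlVac {s : Y → ℝ × ℝ} (hs : Measurable s) (φ : L2 ν) :
    tensorL2L volume ν (ctrlVac ν hs φ) =ᵐ[volume.prod ν] fun z =>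
      weylFun (s z.2).1 (s z.2).2 vacFun z.1 * φ z.2 := by
  rw [tensorL2L_ctrlVac]
  filter_upwards [(isWComp_ctrlWeyl hs).coeFn (mulL2 volume ν vac φ),
    (measurePreserving_shear (ν := ν) hs.snd).quasiMeasurePreserving.ae
      ((coeFn_mulL2 vac φ).and (ae_prod_of_ae memLp_vacFun.coeFn_toLp
        (.of_forall fun _ => trivial : ∀ᵐ y ∂ν, True)))] with z h1 h2
  have h3 := h2.2.1
  refine h1.trans ?_
  change weylPhase (s z.2) z.1 * _ = weylPhase (s z.2) z.1 * vacFun (z.1 + (s z.2).2) * φ z.2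
  rw [h2.1, mul_assoc]
  exact congrArg (fun w => weylPhase (s z.2) z.1 * (w * φ z.2)) h3

/-! ### Finitely many displacements and passage to the limit -/

variable (ν) in
/-- The restriction of a function to a measurable set. -/
def restr {t : Set Y} (ht : MeasurableSet t) : L2 ν →L[ℂ] L2 ν :=
  LinearMap.mkContinuous
    { toFun := fun φ => ((Lp.memLp φ).indicator ht).toLp
      map_add' := fun φ χ => by
        rw [← MemLp.toLp_add]
        refine MemLp.toLp_congr _ _ ?_
        filter_upwards [Lp.coeFn_add φ χ] with y hy
        by_cases h : y ∈ t
        · rw [Pi.add_apply, Set.indicator_of_mem h, Set.indicator_of_mem h, Set.indicator_of_mem h]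
          exact hy
        · simp [h]
      map_smul' := fun c φ => by
        rw [RingHom.id_apply, ← MemLp.toLp_const_smul]
        refine MemLp.toLp_congr _ _ ?_
        filter_upwards [Lp.coeFn_smul c φ] with y hy
        by_cases h : y ∈ t
        · rw [Pi.smul_apply, Set.indicator_of_mem h, Set.indicator_of_mem h]
          exact hy
        · simp [h] }
    1 (fun φ => by
      rw [one_mul]
      change ‖((Lp.memLp φ).indicator ht).toLp‖ ≤ ‖φ‖
      rw [Lp.norm_toLp, Lp.norm_def]
      exact ENNReal.toReal_mono (Lp.eLpNorm_ne_top φ) (eLpNorm_indicator_le _))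

omit [SigmaFinite ν] in
theorem coeFn_restr {t : Set Y} (ht : MeasurableSet t) (φ : L2 ν) :
    restr ν ht φ =ᵐ[ν] t.indicator (φ : Y → ℂ) := by
  have h : restr ν ht φ = ((Lp.memLp φ).indicator ht).toLp := rfl
  rw [h]
  exact MemLp.coeFn_toLp _

omit [SigmaFinite ν] in
theorem inner_restr {t t' : Set Y} (ht : MeasurableSet t) (ht' : MeasurableSet t')
    (h : Disjoint t t') (φ χ : L2 ν) : inner ℂ (restr ν ht φ) (restr ν ht' χ) = 0 := by
  rw [L2.inner_def]
  refine integral_eq_zero_of_ae ?_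
  filter_upwards [coeFn_restr ht φ, coeFn_restr ht' χ] with y h1 h2
  rw [h1, h2]
  by_cases hy : y ∈ t
  · simp [Set.disjoint_left.1 h hy]
  · simp [hy]

/-- With finitely many displacements, the restrictions to the level sets are operators with
orthogonal ranges, each followed by the preparation of one coherent state. -/
theorem isEB_ctrlVac_simpleFunc (s : SimpleFunc Y (ℝ × ℝ)) :
    IsEB (ctrlVac ν s.measurable).toContinuousLinearMap := by
  have h : (ctrlVac ν s.measurable).toContinuousLinearMap =
      ∑ l ∈ s.range, tmulLeft (L2 ν) (weyl l.1 l.2 vac) ∘L restr ν (s.measurableSet_fiber l) := by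
    refine ContinuousLinearMap.ext fun φ => (tensorL2 volume ν).injective ?_
    change tensorL2L volume ν (ctrlVac ν s.measurable φ) = tensorL2L volume ν _
    rw [sum_apply, map_sum]
    refine Lp.ext ?_
    have h1 : ∀ l ∈ s.range, ∀ᵐ z ∂(volume.prod ν : Measure (ℝ × Y)), tensorL2L volume ν
        ((tmulLeft (L2 ν) (weyl l.1 l.2 vac) ∘L restr ν (s.measurableSet_fiber l)) φ) z =
          weylFun l.1 l.2 vacFun z.1 * (s ⁻¹' {l}).indicator (φ : Y → ℂ) z.2 := fun l _ => by
      have e := tensorL2L_tmul (weyl l.1 l.2 vac) (restr ν (s.measurableSet_fiber l) φ)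
      rw [ContinuousLinearMap.comp_apply, tmulLeft_apply, e]
      filter_upwards [coeFn_mulL2 (weyl l.1 l.2 vac) (restr ν (s.measurableSet_fiber l) φ),
        ae_prod_of_ae (coeFn_weyl_vac l) (coeFn_restr (s.measurableSet_fiber l) φ)] with z h1 h2
      rw [h1, h2.2, h2.1]
    have h2 := (Filter.eventually_all_finset s.range).2 h1
    filter_upwards [coeFn_ctrlVac s.measurable φ, h2, Lp.coeFn_finsetSum s.range fun l =>
      tensorL2L volume ν
        ((tmulLeft (L2 ν) (weyl l.1 l.2 vac) ∘L restr ν (s.measurableSet_fiber l)) φ)]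
      with z e1 e2 e3
    rw [e1, e3, Finset.sum_apply, Finset.sum_congr rfl e2,
      Finset.sum_eq_single_of_mem (s z.2) (s.mem_range_self _)]
    · simp
    · intro l _ hl
      simp [Ne.symm hl]
  rw [h]
  exact isEB_sum_tmulLeft _ _ _ fun l l' hl => inner_restr _ _
    ((Set.disjoint_singleton.2 hl).preimage s)

theorem enorm_sq_L2 {X : Type} [MeasurableSpace X] {μ : Measure X} (F : L2 μ) :
    ‖F‖ₑ ^ 2 = ∫⁻ x, ‖F x‖ₑ ^ 2 ∂μ := by
  rw [Lp.enorm_def, eLpNorm_eq_lintegral_rpow_enorm_toReal (by norm_num) (by norm_num)]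
  rw [← ENNReal.rpow_natCast, ← ENNReal.rpow_mul]
  norm_num

theorem measurable_weylFun_vacFun :
    Measurable fun p : (ℝ × ℝ) × ℝ => weylFun p.1.1 p.1.2 vacFun p.2 := by
  have := continuous_vacFun
  refine Continuous.measurable ?_
  unfold weylFun
  fun_prop

theorem measurable_weylFun_sub (l m : ℝ × ℝ) : Measurable fun x : ℝ =>
    ‖weylFun l.1 l.2 vacFun x - weylFun m.1 m.2 vacFun x‖ₑ ^ 2 := by
  have h : ∀ l : ℝ × ℝ, Measurable (weylFun l.1 l.2 vacFun) := fun l => by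
    have := measurable_weylFun_vacFun.comp (measurable_const (a := l) |>.prodMk measurable_id)
    exact this
  exact ((h l).sub (h m)).enorm.pow_const 2

omit [SigmaFinite ν] in
theorem aemeasurable_weylFun_sub {s s' : Y → ℝ × ℝ} (hs : Measurable s) (hs' : Measurable s')
    (φ : L2 ν) : AEMeasurable (fun z : ℝ × Y => ‖weylFun (s z.2).1 (s z.2).2 vacFun z.1 -
      weylFun (s' z.2).1 (s' z.2).2 vacFun z.1‖ₑ ^ 2 * ‖φ z.2‖ₑ ^ 2)
      ((volume : Measure ℝ).prod ν) := by
  have h : ∀ {r : Y → ℝ × ℝ}, Measurable r →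
      Measurable fun z : ℝ × Y => weylFun (r z.2).1 (r z.2).2 vacFun z.1 := fun hr => by
    have := measurable_weylFun_vacFun.comp ((hr.comp measurable_snd).prodMk
      (measurable_fst (α := ℝ)))
    exact this
  exact AEMeasurable.mul (((h hs).sub (h hs')).enorm.pow_const 2).aemeasurable
    (((Lp.aestronglyMeasurable φ).comp_snd.enorm).pow_const 2)

theorem enorm_sq_ctrlVac_sub {s s' : Y → ℝ × ℝ} (hs : Measurable s) (hs' : Measurable s')
    (φ : L2 ν) : ‖ctrlVac ν hs φ - ctrlVac ν hs' φ‖ₑ ^ 2 =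
      ∫⁻ y, ‖weyl (s y).1 (s y).2 vac - weyl (s' y).1 (s' y).2 vac‖ₑ ^ 2 * ‖φ y‖ₑ ^ 2 ∂ν := by
  have h1 : ‖ctrlVac ν hs φ - ctrlVac ν hs' φ‖ₑ =
      ‖tensorL2L volume ν (ctrlVac ν hs φ) - tensorL2L volume ν (ctrlVac ν hs' φ)‖ₑ := by
    rw [← map_sub, ← ofReal_norm, ← ofReal_norm]
    exact congrArg _ ((tensorL2 volume ν).norm_map _).symm
  rw [h1, enorm_sq_L2]
  have h2 : ∫⁻ z, ‖(tensorL2L volume ν (ctrlVac ν hs φ) -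
      tensorL2L volume ν (ctrlVac ν hs' φ) : L2 (volume.prod ν)) z‖ₑ ^ 2 ∂(volume.prod ν) =
      ∫⁻ z : ℝ × Y, ‖weylFun (s z.2).1 (s z.2).2 vacFun z.1 -
        weylFun (s' z.2).1 (s' z.2).2 vacFun z.1‖ₑ ^ 2 * ‖φ z.2‖ₑ ^ 2 ∂(volume.prod ν) := by
    refine lintegral_congr_ae ?_
    filter_upwards [Lp.coeFn_sub (tensorL2L volume ν (ctrlVac ν hs φ))
      (tensorL2L volume ν (ctrlVac ν hs' φ)), coeFn_ctrlVac hs φ, coeFn_ctrlVac hs' φ]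
      with z e1 e2 e3
    rw [e1, Pi.sub_apply, e2, e3, ← sub_mul, enorm_mul, mul_pow]
  rw [h2, lintegral_prod_symm _ (aemeasurable_weylFun_sub hs hs' φ)]
  refine lintegral_congr fun y => ?_
  dsimp only
  rw [lintegral_mul_const _ (measurable_weylFun_sub (s y) (s' y)), enorm_sq_L2]
  congr 1
  refine lintegral_congr_ae ?_
  filter_upwards [Lp.coeFn_sub (weyl (s y).1 (s y).2 vac) (weyl (s' y).1 (s' y).2 vac),
    coeFn_weyl_vac (s y), coeFn_weyl_vac (s' y)] with x e1 e2 e3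
  rw [e1, Pi.sub_apply, e2, e3]

theorem isEB_ctrlVac {s : Y → ℝ × ℝ} (hs : Measurable s) :
    IsEB (ctrlVac ν hs).toContinuousLinearMap := by
  let σ : ℕ → SimpleFunc Y (ℝ × ℝ) := SimpleFunc.approxOn s hs Set.univ 0 trivial
  have hσ : ∀ y, Filter.Tendsto (fun n => σ n y) .atTop (nhds (s y)) := fun y =>
    SimpleFunc.tendsto_approxOn hs _ (by simp)
  refine isEB_of_tendsto (W := fun n => (ctrlVac ν (σ n).measurable).toContinuousLinearMap)
    (fun n => isEB_ctrlVac_simpleFunc _) fun φ => ?_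
  have key : Filter.Tendsto
      (fun n => ‖ctrlVac ν (σ n).measurable φ - ctrlVac ν hs φ‖ₑ ^ 2) .atTop (nhds 0) := by
    refine Filter.Tendsto.congr (fun n => (enorm_sq_ctrlVac_sub (σ n).measurable hs φ).symm) ?_
    have h0 : ∫⁻ _ : Y, (0 : ℝ≥0∞) ∂ν = 0 := lintegral_zero
    rw [← h0]
    -- Two unit vectors are at distance at most `2`; pointwise convergence comes from continuity of
    -- the displaced vacuum.
    refine tendsto_lintegral_of_dominated_convergence' (fun y => 2 ^ 2 * ‖φ y‖ₑ ^ 2) (fun n => ?_)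
      (fun n => .of_forall fun y => ?_) ?_ (.of_forall fun y => ?_)
    · refine AEMeasurable.mul ?_ ((Lp.aestronglyMeasurable φ).enorm.pow_const 2)
      have hc : Continuous fun p : (ℝ × ℝ) × (ℝ × ℝ) =>
          ‖weyl p.1.1 p.1.2 vac - weyl p.2.1 p.2.2 vac‖ₑ :=
        ((continuous_weyl_vac.comp continuous_fst).sub
          (continuous_weyl_vac.comp continuous_snd)).enorm
      exact ((hc.measurable.comp ((σ n).measurable.prodMk hs)).pow_const 2).aemeasurable
    · dsimp only
      gcongr
      refine (enorm_sub_le).trans ?_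
      rw [← ofReal_norm, ← ofReal_norm, norm_weyl, norm_weyl, norm_vac]
      norm_num
    · rw [lintegral_const_mul' _ _ (by norm_num), ← enorm_sq_L2]
      exact ENNReal.mul_ne_top (by norm_num) (ENNReal.pow_ne_top enorm_ne_top)
    · have h1 : Filter.Tendsto (fun n => ‖weyl (σ n y).1 (σ n y).2 vac -
          weyl (s y).1 (s y).2 vac‖ₑ ^ 2) .atTop (nhds 0) := by
        have h2 := (((continuous_weyl_vac.tendsto (s y)).comp (hσ y)).sub_const
          (weyl (s y).1 (s y).2 vac)).enorm
        rw [sub_self, enorm_zero] at h2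
        have h3 := ENNReal.Tendsto.pow (n := 2) h2
        rwa [zero_pow two_ne_zero] at h3
      have h4 := ENNReal.Tendsto.mul_const (b := ‖φ y‖ₑ ^ 2) h1
        (.inr (ENNReal.pow_ne_top enorm_ne_top))
      rwa [zero_mul] at h4
  rw [tendsto_iff_norm_sub_tendsto_zero]
  have h5 : Filter.Tendsto (fun n => ‖ctrlVac ν (σ n).measurable φ - ctrlVac ν hs φ‖ ^ 2) .atTop
      (nhds 0) := by
    have := (ENNReal.tendsto_toReal ENNReal.zero_ne_top).comp key
    refine (this.congr fun n => ?_)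
    rw [Function.comp_apply, ENNReal.toReal_pow, toReal_enorm]
  have h6 := h5.sqrt
  simpa using! h6

end Controlled

end BosonicGaussian

end

noncomputable section

namespace BosonicGaussian

open QSystem ContinuousLinearMap InnerProductSpace

/-! ### The measure-and-prepare channel -/

open scoped FourierTransform in
theorem fourier_shift (f : ℝ → ℂ) (t w : ℝ) :
    𝓕 (fun x => f (x + t)) w = Complex.exp (2 * Real.pi * Complex.I * (t * w)) * 𝓕 f w := by
  have h := congrFun (VectorFourier.fourierIntegral_comp_add_right Real.fourierChar volume
    (innerₗ ℝ) f t) w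
  refine h.trans ?_
  rw [Circle.smul_def, Real.fourierChar_apply, smul_eq_mul]
  congr 2
  simp
  ring

/-- The Fourier transform on `L²(ℝ)`. -/
def fourierL2 : mode →ₗᵢ[ℂ] mode := (Lp.fourierTransformₗᵢ ℝ ℂ).toLinearIsometry

theorem fourierL2_weyl (t : ℝ) : fourierL2.toContinuousLinearMap ∘L weyl 0 t =
    weyl (2 * Real.pi * t) 0 ∘L fourierL2.toContinuousLinearMap := by
  refine ContinuousLinearMap.ext fun φ => ?_
  refine (SchwartzMap.denseRange_toLpCLM (E := ℝ) (F := ℂ) (p := 2) (μ := volume)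
    ENNReal.ofNat_ne_top).induction_on
    (p := fun φ => (fourierL2.toContinuousLinearMap ∘L weyl 0 t) φ =
      (weyl (2 * Real.pi * t) 0 ∘L fourierL2.toContinuousLinearMap) φ) φ
    (isClosed_eq (ContinuousLinearMap.continuous _) (ContinuousLinearMap.continuous _))
    fun f => ?_
  let g := SchwartzMap.compSubConstCLM ℂ (-t) f
  have h1 : weyl 0 t (f.toLp 2) = g.toLp 2 := by
    refine Lp.ext ?_
    filter_upwards [(isWComp_weyl 0 t).coeFn (f.toLp 2), g.coeFn_toLp 2,
      (measurePreserving_add_right volume t).quasiMeasurePreserving.ae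
        (f.coeFn_toLp 2 volume)]
      with x e1 e2 e3
    rw [e1, e2, e3]
    simp [g]
  have h2 : ∀ f : SchwartzMap ℝ ℂ, fourierL2 (f.toLp 2) = (FourierTransform.fourier f).toLp 2 :=
    fun f => SchwartzMap.toLp_fourier_eq f
  change fourierL2 (weyl 0 t (f.toLp 2)) = weyl (2 * Real.pi * t) 0 (fourierL2 (f.toLp 2))
  rw [h1, h2, h2]
  refine Lp.ext ?_
  filter_upwards [(isWComp_weyl (2 * Real.pi * t) 0).coeFn ((FourierTransform.fourier f).toLp 2),
    (FourierTransform.fourier g).coeFn_toLp 2, (FourierTransform.fourier f).coeFn_toLp 2]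
    with x e1 e2 e3
  rw [e1, e2, add_zero, e3, SchwartzMap.fourier_coe, SchwartzMap.fourier_coe]
  have h3 : (g : ℝ → ℂ) = fun x => f (x + t) := by
    ext x
    simp [g]
  rw [h3, fourier_shift]
  congr 2
  push_cast
  ring

section Mul

variable {Y : Type} [MeasurableSpace Y] {ν : Measure Y} [SigmaFinite ν]

theorem adjoint_comp_of_intertwine_left {H F K : QSystem} (R : tensor F H →L[ℂ] K)
    (hR : ∀ z, ‖R z‖ = ‖z‖) (g : F) (X : K →L[ℂ] K) (A : F →L[ℂ] F)
    (B : H →L[ℂ] H) (h : X ∘L R = R ∘L tmap A B) :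
    adjoint (R ∘L tmulLeft H g) ∘L X ∘L (R ∘L tmulLeft H g) = inner ℂ g (A g) • B := by
  have hRR := adjoint_comp_self_of_isometry R hR
  refine ContinuousLinearMap.ext fun f => ext_inner_left ℂ fun f' => ?_
  have e1 : X (R (tmul g f)) = R (tmul (A g) (B f)) := by
    rw [← tmap_tmul]
    exact congrFun (congrArg DFunLike.coe h) (tmul g f)
  have e2 : inner ℂ (R (tmul g f')) (R (tmul (A g) (B f))) =
      inner ℂ (tmul g f') (tmul (A g) (B f)) := by
    rw [← ContinuousLinearMap.adjoint_inner_right]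
    congr 1
    exact congrFun (congrArg DFunLike.coe hRR) _
  rw [ContinuousLinearMap.comp_apply, ContinuousLinearMap.adjoint_inner_right,
    smul_apply, inner_smul_right, ← inner_tmul, ← e2, ← e1]
  rfl

/-- Commuting `weyl a b` past the controlled displacement leaves a phase linear in `s y`, and the
vacuum contributes its Gaussian. This is the Heisenberg picture of preparing a coherent state at `s
y`. -/
theorem adjoint_ctrlVac {s : Y → ℝ × ℝ} (hs : Measurable s) (a b : ℝ) {U : L2 ν →L[ℂ] L2 ν}
    (hU : IsWComp U id fun y => Complex.exp (Complex.I * ((s y).1 * b - a * (s y).2 : ℝ))) :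
    adjoint (ctrlVac ν hs).toContinuousLinearMap ∘L tmap (weyl a b) (.id ℂ (L2 ν)) ∘L
      (ctrlVac ν hs).toContinuousLinearMap = (Real.exp (-(a ^ 2 + b ^ 2) / 4) : ℂ) • U := by
  have h1 : ∀ y, ‖Complex.exp (Complex.I * ((s y).1 * b - a * (s y).2 : ℝ))‖ = 1 := fun y => by
    rw [mul_comm Complex.I, Complex.norm_exp_ofReal_mul_I]
  have h2 := (isWComp_tmap (isWComp_weyl a b) (isWComp_id (μ := ν)) (norm_weylPhase a b)
    fun _ => norm_one).comp (isWComp_ctrlWeyl hs)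
  have h3 := (isWComp_ctrlWeyl hs).comp
    (isWComp_tmap (isWComp_weyl a b) hU (norm_weylPhase a b) h1)
  have h4 := comp_eq_of_conj (h2.ext h3 (fun z => by ext <;> simp; ring) fun z => by
    dsimp only [weylPhase, Prod.map, id]
    rw [mul_one, ← Complex.exp_add, ← Complex.exp_add, ← Complex.exp_add]
    congr 1
    push_cast
    ring)
  have h5 := adjoint_comp_of_intertwine_left (tensorL2Inv volume ν ∘L
    (ctrlWeyl ν hs).toContinuousLinearMap ∘L tensorL2L volume ν) (fun z => by
      refine ((tensorL2 volume ν).symm.norm_map _).trans (((ctrlWeyl ν hs).norm_map _).trans ?_)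
      exact (tensorL2 volume ν).norm_map z) vac _ _ _ h4
  rw [inner_vac_weyl] at h5
  exact h5

end Mul

theorem comp_comp_eq_of_comp_eq {H K L : QSystem} {X : L →L[ℂ] L} {Y : K →L[ℂ] K} {Z : H →L[ℂ] H}
    {A : K →L[ℂ] L} {B : H →L[ℂ] K} (hA : X ∘L A = A ∘L Y) (hB : Y ∘L B = B ∘L Z) :
    X ∘L (A ∘L B) = (A ∘L B) ∘L Z := by
  rw [← comp_assoc, hA, comp_assoc, hB, comp_assoc]

/-- The shear `(x, q) ↦ (x, q - x)` as a unitary. -/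
def shear : L2 ((volume : Measure ℝ).prod (volume : Measure ℝ)) →ₗᵢ[ℂ]
    L2 ((volume : Measure ℝ).prod (volume : Measure ℝ)) :=
  wcomp _ (measurePreserving_linear 1 0 (-1) 1 (by norm_num)) (fun _ => 1) measurable_const
    fun _ => norm_one

/-- The isometry which maps `f` to its short-time Fourier transform with respect to the vacuum. -/
def stft : mode →ₗᵢ[ℂ] L2 ((volume : Measure ℝ).prod (volume : Measure ℝ)) :=
  (tensorL2 volume volume).toLinearIsometry.comp
    ((tmapIso fourierL2 .id).comp ((tensorL2 volume volume).symm.toLinearIsometry.comp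
      (shear.comp ((tensorL2 volume volume).toLinearIsometry.comp
        ⟨(tmulRight mode vac).toLinearMap, fun f => by
          change ‖tmul f vac‖ = ‖f‖
          rw [norm_tmul, norm_vac, mul_one]⟩))))

/-- The operators on the right are the exponentials of `a (x̂ + x̂') + b (p̂ - p̂')`, built from
commuting quadratures of signal and ancilla. The shear separates the two over the two factors, ready
for a joint measurement. -/
theorem tmap_shear (a b : ℝ) : tmap (weyl 0 b) (weyl a 0) ∘L (tensorL2Inv volume volume ∘L
    shear.toContinuousLinearMap ∘L tensorL2L volume volume) = (tensorL2Inv volume volume ∘L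
      shear.toContinuousLinearMap ∘L tensorL2L volume volume) ∘L
        tmap (weyl a b) (weyl a (-b)) := by
  have hU := isWComp_wcomp (measurePreserving_linear 1 0 (-1) 1 (by norm_num))
    (measurable_const (a := (1 : ℂ))) fun _ => norm_one
  have h1 := (isWComp_tmap (isWComp_weyl 0 b) (isWComp_weyl a 0) (norm_weylPhase _ _)
    (norm_weylPhase _ _)).comp hU
  have h2 := hU.comp (isWComp_tmap (isWComp_weyl a b) (isWComp_weyl a (-b))
    (norm_weylPhase _ _) (norm_weylPhase _ _))
  refine comp_eq_of_conj (h1.ext h2 (fun z => by ext <;> simp; ring) fun z => ?_)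
  dsimp only
  rw [← Complex.exp_add, ← Complex.exp_add, mul_one, one_mul]
  congr 1
  push_cast
  ring

/-- After the shear and a Fourier transform the two commuting quadratures are multiplication
operators. Compression to the vacuum ancilla returns `weyl a b` with one unit of vacuum noise, as in
heterodyne detection. -/
theorem adjoint_stft (a b : ℝ) {U : L2 ((volume : Measure ℝ).prod (volume : Measure ℝ)) →L[ℂ]
      L2 ((volume : Measure ℝ).prod (volume : Measure ℝ))}
    (hU : IsWComp U id fun y => Complex.exp (Complex.I * (2 * Real.pi * b * y.1 + a * y.2 : ℝ))) :
    adjoint stft.toContinuousLinearMap ∘L U ∘L stft.toContinuousLinearMap =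
      (Real.exp (-(a ^ 2 + b ^ 2) / 4) : ℂ) • weyl a b := by
  let G := tmap fourierL2.toContinuousLinearMap (.id ℂ mode)
  let R : tensor mode mode →L[ℂ] tensor mode mode := tensorL2Inv volume volume ∘L
    shear.toContinuousLinearMap ∘L tensorL2L volume volume
  let J : tensor mode mode →L[ℂ] L2 ((volume : Measure ℝ).prod (volume : Measure ℝ)) :=
    tensorL2L (volume : Measure ℝ) (volume : Measure ℝ)
  have h1 : U ∘L J = J ∘L tmap (weyl (2 * Real.pi * b) 0) (weyl a 0) := by
    have h := hU.ext (isWComp_tmap (isWComp_weyl (2 * Real.pi * b) 0) (isWComp_weyl a 0)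
      (norm_weylPhase _ _) (norm_weylPhase _ _)) (fun z => by ext <;> simp) fun z => by
        rw [← Complex.exp_add]
        congr 1
        push_cast
        ring
    refine ContinuousLinearMap.ext fun z => ?_
    rw [h]
    exact congrArg (fun w => J (tmap (weyl (2 * Real.pi * b) 0) (weyl a 0) w)) (tensorL2Inv_L z)
  have h2 : tmap (weyl (2 * Real.pi * b) 0) (weyl a 0) ∘L G =
      G ∘L tmap (weyl 0 b) (weyl a 0) := by
    rw [tmap_comp, tmap_comp, fourierL2_weyl, id_comp, comp_id]
  have h3 : U ∘L (J ∘L G ∘L R) = (J ∘L G ∘L R) ∘L tmap (weyl a b) (weyl a (-b)) := by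
    have h4 : tmap (weyl 0 b) (weyl a 0) ∘L R = R ∘L tmap (weyl a b) (weyl a (-b)) :=
      tmap_shear a b
    clear_value G R J
    exact comp_comp_eq_of_comp_eq h1 (comp_comp_eq_of_comp_eq h2 h4)
  have h5 := adjoint_comp_of_intertwine (J ∘L G ∘L R) (fun z => by
    refine ((tensorL2 volume volume).norm_map _).trans
      (((tmapIso fourierL2 (.id : mode →ₗᵢ[ℂ] mode)).norm_map _).trans
      (((tensorL2 volume volume).symm.norm_map _).trans ((shear.norm_map _).trans ?_)))
    exact (tensorL2 volume volume).norm_map z) vac _ _ _ h3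
  rw [inner_vac_weyl, neg_sq] at h5
  exact h5

/-- An entanglement-breaking phase-insensitive Gaussian channel. -/
theorem exists_isPI_eb {x : ℝ} (hx : 0 ≤ x) :
    ∃ (Λ : QChannel mode mode) (E : QSystem) (V : mode →ₗᵢ[ℂ] tensor mode E),
      IsStinespring Λ E V ∧ IsEB V.toContinuousLinearMap ∧ IsPI x (1 + x) Λ := by
  -- The displacements are chosen so that the phase of `adjoint_ctrlVac` at `(a, b)` is the one of
  -- `adjoint_stft` at `√x (a, b)`. Preparation then adds noise `1` and measurement adds `x`.
  have hs : Measurable fun y : ℝ × ℝ => (2 * Real.pi * √x * y.1, -√x * y.2) := by fun_prop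
  let D := ctrlVac ((volume : Measure ℝ).prod (volume : Measure ℝ)) hs
  let V := D.comp stft
  refine ⟨chanOfIsometry V, _, V, isStinespring_chanOfIsometry V,
    (isEB_ctrlVac hs).comp_right stft.toContinuousLinearMap,
    isPI_of_dilation (isStinespring_chanOfIsometry V) fun a b => ?_⟩
  have hm : Measurable fun y : ℝ × ℝ => Complex.exp
      (Complex.I * (2 * Real.pi * √x * y.1 * b - a * (-√x * y.2) : ℝ)) :=
    (by fun_prop : Continuous _).measurable
  have hU := isWComp_wcomp (.id ((volume : Measure ℝ).prod (volume : Measure ℝ))) hm fun y => by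
    rw [mul_comm Complex.I, Complex.norm_exp_ofReal_mul_I]
  have h1 := adjoint_ctrlVac hs a b hU
  have h2 := adjoint_stft (√x * a) (√x * b) (U := _) (by
    convert hU using 5 with y
    ring)
  have h3 : V.toContinuousLinearMap = D.toContinuousLinearMap ∘L stft.toContinuousLinearMap := rfl
  rw [h3, adjoint_comp, comp_assoc, ← comp_assoc _ _ stft.toContinuousLinearMap,
    ← comp_assoc (adjoint D.toContinuousLinearMap), h1, smul_comp, comp_smul, h2, smul_smul,
    ← Complex.ofReal_mul, ← Real.exp_add, mul_pow, mul_pow, Real.sq_sqrt hx]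
  congr 3
  ring

end BosonicGaussian

end

noncomputable section

namespace BosonicGaussian

open QSystem ContinuousLinearMap InnerProductSpace

/-! ### Trace-class operators are determined by their characteristic functions -/

open scoped FourierTransform ContDiff in
theorem ae_eq_zero_of_integral_exp {h : ℝ → ℂ} (hi : Integrable h)
    (h0 : ∀ a : ℝ, ∫ x, Complex.exp (Complex.I * ((a * x : ℝ) : ℂ)) * h x = 0) :
    ∀ᵐ x, h x = 0 := by
  have hF : ∀ w, 𝓕 h w = 0 := fun w => by
    rw [← h0 (-(2 * Real.pi * w)), Real.fourier_eq]
    refine integral_congr_ae (.of_forall fun x => ?_)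
    dsimp only
    rw [Circle.smul_def, Real.fourierChar_apply, smul_eq_mul]
    congr 2
    simp
    ring
  refine ae_eq_zero_of_integral_contDiff_smul_eq_zero hi.locallyIntegrable fun g hg hgc => ?_
  have hg1 : HasCompactSupport (Complex.ofRealCLM ∘ g) := hgc.comp_left rfl
  have hg2 : ContDiff ℝ ∞ (Complex.ofRealCLM ∘ g) := by fun_prop
  let φ : SchwartzMap ℝ ℂ := hg1.toSchwartzMap hg2
  -- A test function is the Fourier transform of a Schwartz function, so moving the transform onto
  -- `h` shows that its integral against `h` is zero.
  let ψ : SchwartzMap ℝ ℂ := 𝓕⁻ φ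
  have h1 := VectorFourier.integral_fourierIntegral_smul_eq_flip (L := innerₗ ℝ) (μ := volume)
    (ν := volume) Real.continuous_fourierChar continuous_inner ψ.integrable hi
  have h2 : ∀ x, VectorFourier.fourierIntegral Real.fourierChar volume (innerₗ ℝ) ψ x = φ x :=
    fun x => by
      have := congrArg (fun f : SchwartzMap ℝ ℂ => f x)
        (FourierTransform.fourier_fourierInv_eq φ : 𝓕 (𝓕⁻ φ) = φ)
      exact this
  have h3 : ∀ x, VectorFourier.fourierIntegral Real.fourierChar volume (innerₗ ℝ).flip h x = 0 :=
    fun x => by rw [flip_innerₗ]; exact hF x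
  simp only [h2, h3, smul_zero, integral_zero] at h1
  rw [← h1]
  refine integral_congr_ae (.of_forall fun x => ?_)
  exact (Complex.real_smul (x := g x) (z := h x)).trans rfl

theorem lintegral_enorm_inner_le (f g : mode) :
    ∫⁻ x, ‖inner ℂ (f x) (g x)‖ₑ ≤ ‖f‖ₑ * ‖g‖ₑ := by
  have h1 : ∫⁻ x, ‖inner ℂ (f x) (g x)‖ₑ = ∫⁻ x, ‖f x‖ₑ * ‖g x‖ₑ := by
    refine lintegral_congr fun x => ?_
    rw [RCLike.inner_apply, enorm_mul, mul_comm, ← ofReal_norm, RCLike.norm_conj, ofReal_norm]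
  rw [h1]
  have h2 := ENNReal.lintegral_mul_le_Lp_mul_Lq volume Real.HolderConjugate.two_two
    (Lp.aestronglyMeasurable f).enorm (Lp.aestronglyMeasurable g).enorm
  refine h2.trans_eq ?_
  rw [Lp.enorm_def, Lp.enorm_def, eLpNorm_eq_lintegral_rpow_enorm_toReal (by norm_num)
    (by norm_num), eLpNorm_eq_lintegral_rpow_enorm_toReal (by norm_num) (by norm_num)]
  norm_num

theorem integral_inner_mode (f g : mode) : inner ℂ f g = ∫ x, inner ℂ (f x) (g x) := L2.inner_def f g

/-- A summable family has countably many nonzero terms. Countability is required to integrate the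
sum term by term. -/
theorem NRep.exists_nat {H : QSystem} {ι : Type} {T : H →L[ℂ] H} {u v : ι → H} (h : NRep T u v) :
    ∃ (κ : Type) (_ : Countable κ) (u v : κ → H), NRep T u v := by
  let S : Set ι := Function.support fun i => ‖u i‖ * ‖v i‖
  refine ⟨S, h.summable.countable_support, fun i => u i, fun i => v i,
    h.summable.subtype S, fun x => ?_⟩
  refine (hasSum_subtype_iff_of_support_subset (f := fun i => inner ℂ (v i) x • u i) ?_).2
    (h.hasSum x)
  intro i hi
  contrapose! hi
  replace hi : i ∉ S := fun h => hi h
  rw [Function.notMem_support]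
  rcases mul_eq_zero.1 (Function.notMem_support.1 hi) with h0 | h0
  · rw [norm_eq_zero.1 h0, smul_zero]
  · rw [norm_eq_zero.1 h0, inner_zero_left, zero_smul]

theorem NRep.tsum_enorm_ne_top {H : QSystem} {ι : Type} {T : H →L[ℂ] H} {u v : ι → H}
    (h : NRep T u v) : ∑' i, ‖u i‖ₑ * ‖v i‖ₑ ≠ ∞ := by
  have h1 : ∀ i, ‖u i‖ₑ * ‖v i‖ₑ = ENNReal.ofReal (‖u i‖ * ‖v i‖) := fun i => by
    rw [ENNReal.ofReal_mul (norm_nonneg _), ofReal_norm, ofReal_norm]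
  simp only [h1]
  exact h.summable.tsum_ofReal_ne_top

section CharFun

variable {ι : Type} {T : mode →L[ℂ] mode} {u v : ι → mode}

theorem lintegral_enorm_inner_shift_le (f g : mode) (b : ℝ) :
    ∫⁻ x, ‖inner ℂ (f x) (g (x + b))‖ₑ ≤ ‖f‖ₑ * ‖g‖ₑ := by
  have h1 : ∫⁻ x, ‖inner ℂ (f x) (g (x + b))‖ₑ = ∫⁻ x, ‖inner ℂ (f x) (weyl 0 b g x)‖ₑ := by
    refine lintegral_congr_ae ?_
    filter_upwards [(isWComp_weyl 0 b).coeFn g] with x hx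
    rw [hx]
    simp
  rw [h1]
  refine (lintegral_enorm_inner_le f (weyl 0 b g)).trans_eq ?_
  rw [← ofReal_norm (weyl 0 b g), norm_weyl, ofReal_norm]

theorem measurable_inner_shift_right (f g : mode) (b : ℝ) :
    Measurable fun x : ℝ => inner ℂ (f x) (g (x + b)) :=
  (Lp.stronglyMeasurable f).measurable.inner
    ((Lp.stronglyMeasurable g).measurable.comp (measurable_id.add_const b))

/-- For fixed `b`, the trace as a function of `a` is up to a phase the Fourier transform of the
kernel of `T` along a line parallel to the diagonal. -/
theorem NRep.tsum_inner_shift_eq_zero [Countable ι] (h : NRep T u v)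
    (h0 : ∀ a b, trace (weyl a b ∘L T) = 0) (b : ℝ) :
    ∀ᵐ x, ∑' i, inner ℂ (v i x) (u i (x + b)) = 0 := by
  have hm := fun i => measurable_inner_shift_right (v i) (u i) b
  have hfin : ∑' i, ∫⁻ x, ‖inner ℂ (v i x) (u i (x + b))‖ₑ ≠ ∞ := by
    refine ne_top_of_le_ne_top h.tsum_enorm_ne_top (ENNReal.tsum_le_tsum fun i => ?_)
    rw [mul_comm]
    exact lintegral_enorm_inner_shift_le _ _ b
  refine ae_eq_zero_of_integral_exp ⟨(Measurable.tsum hm).aestronglyMeasurable, ?_⟩ fun a => ?_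
  · refine lt_of_le_of_lt (lintegral_mono fun x => enorm_tsum_le_tsum_enorm) ?_
    rw [lintegral_tsum fun i => (hm i).enorm.aemeasurable]
    exact hfin.lt_top
  · have hc : Measurable fun x : ℝ => Complex.exp (Complex.I * ((a * x : ℝ) : ℂ)) :=
      (by fun_prop : Continuous _).measurable
    have h1 : ∀ x : ℝ, ‖Complex.exp (Complex.I * ((a * x : ℝ) : ℂ))‖ₑ = 1 := fun x => by
      rw [← ofReal_norm, mul_comm Complex.I, Complex.norm_exp_ofReal_mul_I, ENNReal.ofReal_one]
    have h2 : ∫ x, ∑' i, Complex.exp (Complex.I * ((a * x : ℝ) : ℂ)) *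
        inner ℂ (v i x) (u i (x + b)) =
        ∑' i, ∫ x, Complex.exp (Complex.I * ((a * x : ℝ) : ℂ)) *
          inner ℂ (v i x) (u i (x + b)) := by
      refine integral_tsum (fun i => (hc.mul (hm i)).aestronglyMeasurable) ?_
      simp only [enorm_mul, h1, one_mul]
      exact hfin
    simp only [← tsum_mul_left]
    rw [h2]
    have h3 := (h.comp_left (weyl a b)).hasSum_trace
    rw [h0] at h3
    have h4 : ∀ i, ∫ x, Complex.exp (Complex.I * ((a * x : ℝ) : ℂ)) *
        inner ℂ (v i x) (u i (x + b)) = Complex.exp (-(Complex.I * ((a * b / 2 : ℝ) : ℂ))) *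
          inner ℂ (v i) (weyl a b (u i)) := fun i => by
      rw [integral_inner_mode, ← integral_const_mul]
      refine integral_congr_ae ?_
      filter_upwards [(isWComp_weyl a b).coeFn (u i)] with x hx
      rw [hx, RCLike.inner_apply, RCLike.inner_apply, ← mul_assoc, ← mul_assoc, ← mul_assoc,
        ← Complex.exp_add]
      congr 3
      push_cast
      ring
    simp only [h4]
    rw [tsum_mul_left, h3.tsum_eq, mul_zero]

/-- The integral kernel of `T` vanishes almost everywhere on each line parallel to the diagonal; a
measure-preserving change of variables and Fubini make it vanish almost everywhere on the plane. -/
theorem NRep.eq_zero_of_trace_weyl [Countable ι] (h : NRep T u v)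
    (h0 : ∀ a b, trace (weyl a b ∘L T) = 0) : T = 0 := by
  refine ContinuousLinearMap.ext fun f => ext_inner_left ℂ fun k => ?_
  rw [zero_apply, inner_zero_right]
  let F : ι → ℝ × ℝ → ℂ := fun i z => inner ℂ (v i z.1) (f z.1) * inner ℂ (k z.2) (u i z.2)
  have hmi : ∀ f g : mode, Measurable fun x : ℝ => inner ℂ (f x) (g x) := fun f g =>
    (Lp.stronglyMeasurable f).measurable.inner (Lp.stronglyMeasurable g).measurable
  have hF : ∀ i, Measurable (F i) := fun i =>
    ((hmi (v i) f).comp measurable_fst).mul ((hmi k (u i)).comp measurable_snd)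
  have hS : Measurable fun z => ∑' i, F i z := Measurable.tsum hF
  have h1 : ∫ z, ∑' i, F i z ∂((volume : Measure ℝ).prod volume) =
      ∑' i, ∫ z, F i z ∂((volume : Measure ℝ).prod volume) := by
    refine integral_tsum (fun i => (hF i).aestronglyMeasurable) ?_
    have h2 : ∀ i, ∫⁻ z, ‖F i z‖ₑ ∂((volume : Measure ℝ).prod volume) ≤
        (‖f‖ₑ * ‖k‖ₑ) * (‖u i‖ₑ * ‖v i‖ₑ) := fun i => by
      simp only [F, enorm_mul]
      rw [lintegral_prod_mul (hmi (v i) f).enorm.aemeasurable (hmi k (u i)).enorm.aemeasurable]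
      refine (mul_le_mul' (lintegral_enorm_inner_le _ _) (lintegral_enorm_inner_le _ _)).trans_eq ?_
      ring
    refine ne_top_of_le_ne_top ?_ (ENNReal.tsum_le_tsum h2)
    rw [ENNReal.tsum_mul_left]
    exact ENNReal.mul_ne_top (ENNReal.mul_ne_top enorm_ne_top enorm_ne_top) h.tsum_enorm_ne_top
  have h3 : inner ℂ k (T f) = ∫ z, ∑' i, F i z ∂((volume : Measure ℝ).prod volume) := by
    rw [h1, ← (h.hasSum_inner f k).tsum_eq]
    refine tsum_congr fun i => ?_
    rw [integral_inner_mode, integral_inner_mode, ← integral_prod_mul]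
  have hmp := measurePreserving_linear 0 1 (-1) 1 (by norm_num)
  have h4 : ∫ z, ∑' i, F i z ∂((volume : Measure ℝ).prod volume) =
      ∫ z, ∑' i, F i (0 * z.1 + 1 * z.2, -1 * z.1 + 1 * z.2)
        ∂((volume : Measure ℝ).prod volume) := by
    rw [← integral_map (f := fun z => ∑' i, F i z) hmp.measurable.aemeasurable
      hS.aestronglyMeasurable, hmp.map_eq]
  rw [h3, h4]
  refine integral_eq_zero_of_ae ?_
  refine (Measure.ae_prod_iff_ae_ae
    (measurableSet_eq_fun (hS.comp hmp.measurable) measurable_const)).2 (.of_forall fun b => ?_)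
  filter_upwards [h.tsum_inner_shift_eq_zero h0 (-b)] with y hy
  have h5 : ∀ i, F i (0 * b + 1 * y, -1 * b + 1 * y) =
      (f y * (starRingEnd ℂ) (k (y + -b))) * inner ℂ (v i y) (u i (y + -b)) := fun i => by
    have e1 : 0 * b + 1 * y = y := by ring
    have e2 : -1 * b + 1 * y = y + -b := by ring
    simp only [F]
    rw [e1, e2, RCLike.inner_apply, RCLike.inner_apply, RCLike.inner_apply]
    ring
  change ∑' i, F i (0 * b + 1 * y, -1 * b + 1 * y) = 0
  simp only [h5]
  rw [tsum_mul_left, hy, mul_zero]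

theorem eq_of_trace_weyl {S T : mode →L[ℂ] mode} (hS : IsTraceClass S) (hT : IsTraceClass T)
    (h : ∀ a b, trace (weyl a b ∘L S) = trace (weyl a b ∘L T)) : S = T := by
  have hT' := hT.smul (-1)
  obtain ⟨ι, u, v, hr⟩ := isTraceClass_iff.1 (hS.add hT')
  obtain ⟨κ, _, u, v, hr⟩ := hr.exists_nat
  have h0 := hr.eq_zero_of_trace_weyl fun a b => by
    have h1 := trace_add (hS.comp_left (weyl a b)) (hT'.comp_left (weyl a b))
    have h2 := trace_smul (-1) (hT.comp_left (weyl a b))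
    rw [comp_smul] at h1
    rw [comp_add, comp_smul, h1, h2, h]
    ring
  rw [neg_one_smul, ← sub_eq_add_neg] at h0
  exact sub_eq_zero.1 h0

end CharFun

theorem IsPI.unique {x y : ℝ} {Λ Λ' : QChannel mode mode} (h : IsPI x y Λ) (h' : IsPI x y Λ') :
    Λ = Λ' :=
  QChannel.ext_trace fun T X => by
    have : op (Λ.toLin T) = op (Λ'.toLin T) :=
      eq_of_trace_weyl (Λ.toLin T).2 (Λ'.toLin T).2 fun a b => (h T a b).trans (h' T a b).symm
    rw [this]

end BosonicGaussian

end

noncomputable section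

namespace BosonicGaussian

open QSystem ContinuousLinearMap InnerProductSpace

/-! ### Phase-insensitive channels and their orderings -/

/-- Attenuation by `x/g` followed by gain `g` has noise `2g - 1 - x`, which fixes `g`. The condition
on `y` says exactly that `1 ≤ g` and `x ≤ g`. -/
theorem exists_isPI {x y : ℝ} (hx : 0 ≤ x) (hy : |1 - x| ≤ y) :
    ∃ Λ : QChannel mode mode, IsPI x y Λ := by
  obtain ⟨h1, h2⟩ := abs_le.1 hy
  obtain ⟨g, rfl⟩ : ∃ g, y = 2 * g - 1 - x := ⟨(y + 1 + x) / 2, by ring⟩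
  have hg : 1 ≤ g := by linarith
  have hg0 : 0 < g := by linarith
  obtain ⟨Δ, -, -, -, hΔ⟩ := exists_isPI_loss (div_nonneg hx hg0.le)
    ((div_le_one hg0).2 (by linarith))
  obtain ⟨Θ, -, -, -, hΘ⟩ := exists_isPI_amp hg
  have hc := hΘ.comp hg0.le hΔ
  rw [mul_sub, mul_div_cancel₀ _ hg0.ne'] at hc
  have e : g * 1 - x + (g - 1) = 2 * g - 1 - x := by ring
  rw [e] at hc
  exact ⟨_, hc⟩

theorem isPI_phaseInsensitive {x M : ℝ} (hx : 0 ≤ x) (hM : 0 ≤ M) :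
    IsPI x (2 * M + |1 - x|) (phaseInsensitive x M) :=
  Classical.epsilon_spec (p := IsPhaseInsensitive x M)
    (exists_isPI hx (le_add_of_nonneg_left (by positivity)))

theorem isPI_attenuator {η N : ℝ} (h0 : 0 ≤ η) (h1 : η ≤ 1) (hN : 0 ≤ N) :
    IsPI η (2 * ((1 - η) * N) + (1 - η)) (attenuator η N) := by
  have h := isPI_phaseInsensitive h0 (mul_nonneg (sub_nonneg.2 h1) hN)
  rwa [abs_of_nonneg (sub_nonneg.2 h1)] at h

theorem isPI_amplifier {g N : ℝ} (h1 : 1 ≤ g) (hN : 0 ≤ N) :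
    IsPI g (2 * ((g - 1) * N) + (g - 1)) (amplifier g N) := by
  have h := isPI_phaseInsensitive (zero_le_one.trans h1) (mul_nonneg (sub_nonneg.2 h1) hN)
  rwa [abs_of_nonpos (sub_nonpos.2 h1), neg_sub] at h

/-- The noise minus `1` is proportional to `t`: a line through `(0, 1)`, preserved by later
attenuation. -/
theorem isPI_attCurve₁ {η N t : ℝ} (hη : 0 < η) (hη1 : η ≤ 1) (hN : 0 ≤ N)
    (ht : t ∈ Set.Ico (0 : ℝ) 1) :
    IsPI t (2 * (N * ((1 - η) / η)) * t + (1 - t)) (attenuator t (attCurve₁ η N t)) := by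
  have ht1 := sub_pos.2 ht.2
  have h := isPI_attenuator (N := attCurve₁ η N t) ht.1 ht.2.le (mul_nonneg
    (mul_nonneg hN (div_nonneg (sub_nonneg.2 hη1) hη.le)) (div_nonneg ht.1 ht1.le))
  have e : (1 - t) * attCurve₁ η N t = N * ((1 - η) / η) * t := by
    rw [attCurve₁]
    field_simp
  rwa [e, ← mul_assoc] at h

/-- The noise minus `t` is constant: a line preserved by prior amplification. -/
theorem isPI_attCurve₂ {η N t : ℝ} (ht : t ∈ Set.Ico (0 : ℝ) 1) (h0 : 0 ≤ attCurve₂ η N t) :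
    IsPI t (2 * ((N + 1) * (1 - η)) - 1 + t) (attenuator t (attCurve₂ η N t)) := by
  have ht1 := sub_pos.2 ht.2
  have h := isPI_attenuator ht.1 ht.2.le h0
  have e : (1 - t) * attCurve₂ η N t = (N + 1) * (1 - η) - (1 - t) := by
    rw [attCurve₂]
    field_simp
  have e2 : 2 * ((N + 1) * (1 - η) - (1 - t)) + (1 - t) = 2 * ((N + 1) * (1 - η)) - 1 + t := by
    ring
  rwa [e, e2] at h

theorem isPI_ampCurve₁ {g N t : ℝ} (hg : 1 ≤ g) (hN : 0 ≤ N) (ht : 1 < t) :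
    IsPI t (2 * (N * (g - 1)) + (t - 1)) (amplifier t (ampCurve₁ g N t)) := by
  have ht1 := sub_pos.2 ht
  have h := isPI_amplifier (N := ampCurve₁ g N t) ht.le
    (mul_nonneg hN (div_nonneg (sub_nonneg.2 hg) ht1.le))
  have e : (t - 1) * ampCurve₁ g N t = N * (g - 1) := by
    rw [ampCurve₁]
    field_simp
  rwa [e] at h

theorem isPI_ampCurve₂ {g N t : ℝ} (ht : 1 < t) (h0 : 0 ≤ ampCurve₂ g N t) :
    IsPI t (2 * ((N + 1) * ((g - 1) / g)) * t + (1 - t)) (amplifier t (ampCurve₂ g N t)) := by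
  have ht1 := sub_pos.2 ht
  have h := isPI_amplifier ht.le h0
  have e : (t - 1) * ampCurve₂ g N t = (N + 1) * ((g - 1) / g) * t - (t - 1) := by
    have e1 : (t - 1) * (t / (t - 1)) = t := mul_div_cancel₀ _ ht1.ne'
    rw [ampCurve₂]
    linear_combination ((N + 1) * ((g - 1) / g)) * e1
  have e2 : 2 * ((N + 1) * ((g - 1) / g) * t - (t - 1)) + (t - 1) =
      2 * ((N + 1) * ((g - 1) / g)) * t + (1 - t) := by ring
  rwa [e, e2] at h

/-! ### Comparison and vanishing of the capacities in terms of the pair `(x, y)` -/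

variable {𝒦 : QChannel mode mode → ℝ≥0∞} {x y x' y' : ℝ} {Λ Λ' : QChannel mode mode}

/-- Subsequent attenuation does not increase the capacity. -/
theorem IsCapacity.le_of_loss (h𝒦 : IsCapacity 𝒦) (h : IsPI x y Λ) (h' : IsPI x' y' Λ')
    (hx' : 0 ≤ x') (hx : 0 < x) (hxx : x' ≤ x) (hy : y' = x' / x * y + (1 - x' / x)) :
    𝒦 Λ' ≤ 𝒦 Λ := by
  obtain ⟨Δ, G, W, hW, hΔ⟩ := exists_isPI_loss (div_nonneg hx' hx.le) ((div_le_one hx).2 hxx)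
  have hc := hΔ.comp (div_nonneg hx' hx.le) h
  rw [div_mul_cancel₀ _ hx.ne', ← hy] at hc
  rw [h'.unique hc]
  exact h𝒦.postcomp_le hW

/-- Previous amplification does not increase the capacity. -/
theorem IsCapacity.le_of_amp (h𝒦 : IsCapacity 𝒦) (h : IsPI x y Λ) (h' : IsPI x' y' Λ')
    (hx : 0 < x) (hxx : x ≤ x') (hy : y' = x' - x + y) : 𝒦 Λ' ≤ 𝒦 Λ := by
  obtain ⟨Δ, G, W, hW, hΔ⟩ := exists_isPI_amp ((one_le_div hx).2 hxx)
  have hc := h.comp hx.le hΔ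
  rw [mul_sub, mul_div_cancel₀ _ hx.ne', mul_one, ← hy] at hc
  rw [h'.unique hc]
  exact h𝒦.precomp_le hW

/-- The capacity vanishes above the entanglement-breaking threshold. -/
theorem IsCapacity.eq_zero_of_le (h𝒦 : IsCapacity 𝒦) (h : IsPI x y Λ) (hx : 0 < x)
    (hy : 1 + x ≤ y) : 𝒦 Λ = 0 := by
  -- This value `z` is forced by the noise `z (1 - x/z) + (1 + z) = y` of the attenuator `x/z`
  -- followed by the entanglement-breaking channel. The threshold condition is the same as `x ≤ z`.
  have hz : 0 < (y - 1 + x) / 2 := by linarith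
  obtain ⟨Θ, F, V, hV, hEB, hΘ⟩ := exists_isPI_eb hz.le
  obtain ⟨Δ, G, W, hW, hΔ⟩ := exists_isPI_loss (div_nonneg hx.le hz.le)
    ((div_le_one hz).2 (by linarith))
  have hc := hΘ.comp hz.le hΔ
  rw [mul_sub, mul_div_cancel₀ _ hz.ne'] at hc
  have e : (y - 1 + x) / 2 * 1 - x + (1 + (y - 1 + x) / 2) = y := by ring
  rw [e] at hc
  rw [h.unique hc]
  exact le_antisymm ((h𝒦.precomp_le hW).trans_eq (h𝒦.eq_zero hV hEB)) zero_le

end BosonicGaussian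

end

/-! ### The four curves -/

theorem corollary2 (𝒦 : BosonicGaussian.QChannel BosonicGaussian.QSystem.mode
      BosonicGaussian.QSystem.mode → ENNReal)
    (h𝒦 : 𝒦 = BosonicGaussian.quantumCapacity ∨ 𝒦 = BosonicGaussian.privateCapacity ∨
      𝒦 = BosonicGaussian.twoWayQuantumCapacity ∨ 𝒦 = BosonicGaussian.secretKeyCapacity) :
    (∀ η N : ℝ, 0 < η → η ≤ 1 → 0 ≤ N →
      MonotoneOn
        (fun η' => 𝒦 (BosonicGaussian.attenuator η' (BosonicGaussian.attCurve₁ η N η')))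
        (Set.Ico 0 1)) ∧
    (∀ η N : ℝ, 0 ≤ η → η ≤ 1 → 0 ≤ N →
      AntitoneOn
        (fun η' => 𝒦 (BosonicGaussian.attenuator η' (BosonicGaussian.attCurve₂ η N η')))
        {η' | η' ∈ Set.Ico 0 1 ∧ 0 ≤ BosonicGaussian.attCurve₂ η N η'}) ∧
    (∀ g N : ℝ, 1 ≤ g → 0 ≤ N →
      AntitoneOn
        (fun g' => 𝒦 (BosonicGaussian.amplifier g' (BosonicGaussian.ampCurve₁ g N g')))
        (Set.Ioi 1)) ∧
    (∀ g N : ℝ, 1 ≤ g → 0 ≤ N →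
      MonotoneOn
        (fun g' => 𝒦 (BosonicGaussian.amplifier g' (BosonicGaussian.ampCurve₂ g N g')))
        {g' | g' ∈ Set.Ioi 1 ∧ 0 ≤ BosonicGaussian.ampCurve₂ g N g'}) := by
  have hcap : BosonicGaussian.IsCapacity 𝒦 := h𝒦
  refine ⟨fun η N hη hη1 hN η₁ h₁ η₂ h₂ h => ?_, fun η N hη hη1 hN η₁ h₁ η₂ h₂ h => ?_,
    fun g N hg hN g₁ h₁ g₂ h₂ h => ?_, fun g N hg hN g₁ h₁ g₂ h₂ h => ?_⟩
  -- The attenuator ratio divides by the larger transmissivity; if that is `0`, the two points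
  -- coincide.
  · rcases h₂.1.eq_or_lt with h0 | h0
    · rw [le_antisymm h (h0 ▸ h₁.1)]
    · refine hcap.le_of_loss (BosonicGaussian.isPI_attCurve₁ hη hη1 hN h₂)
        (BosonicGaussian.isPI_attCurve₁ hη hη1 hN h₁) h₁.1 h0 h ?_
      generalize N * ((1 - η) / η) = c
      field_simp
      ring
  · have e₁ := BosonicGaussian.isPI_attCurve₂ h₁.1 h₁.2
    have e₂ := BosonicGaussian.isPI_attCurve₂ h₂.1 h₂.2
    rcases h₁.1.1.eq_or_lt with h0 | h0
    · rcases h₂.1.1.eq_or_lt with h0' | h0'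
      · rw [← h0, ← h0']
      -- No amplifier starts from transmissivity `0`. Admissibility of that point means `(N + 1)(1 -
      -- η) ≥ 1`, which puts every other point of the curve above the entanglement-breaking
      -- threshold.
      · have hc := h₁.2
        rw [← h0, BosonicGaussian.attCurve₂, sub_zero, div_one] at hc
        exact (hcap.eq_zero_of_le e₂ h0' (by linarith)).trans_le zero_le
    · exact hcap.le_of_amp e₁ e₂ h0 h (by ring)
  · exact hcap.le_of_amp (BosonicGaussian.isPI_ampCurve₁ hg hN h₁) (BosonicGaussian.isPI_ampCurve₁ hg hN h₂)
      (one_pos.trans h₁) h (by ring)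
  · have h0 : 0 < g₂ := one_pos.trans h₂.1
    refine hcap.le_of_loss (BosonicGaussian.isPI_ampCurve₂ h₂.1 h₂.2) (BosonicGaussian.isPI_ampCurve₂ h₁.1 h₁.2)
      (one_pos.trans h₁.1).le h0 h ?_
    generalize (N + 1) * ((g - 1) / g) = c
    field_simp
    ring
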